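/- **Setup.** Let $(\mathcal S,\mathcal A,P,c,\gamma)$ be a finite Markov decision process with costs $c(s,a)\in[0,1]$ and discount factor $\gamma\in(0,1)$, let $\mathcal Z=\mathcal S\times\mathcal A$, and let $\pi$ be a policy. Let $P^\pi((s,a),(s',a'))=P(s'|s,a)\pi(a'|s')$ and $\kappa^\pi_q(s)=(1-\gamma)\sum_{t\ge0}\gamma^t\Pr^\pi\{s_t=s\mid s_0=q\}$. Fix an origin state $s_{or}$ and $f,\varepsilon^{(\mathcal S)}\in[0,1]$, and put $\kappa(s)=(1-f)\kappa^\pi_{s_{or}}(s)+f|\mathcal S|^{-1}\sum_{q}\kappa^\pi_{q}(s)$. Assume $\underline\kappa:=\min_s\kappa(s)>0$ and $\varepsilon^{(\mathcal A)}\in(0,\tfrac{(1-\gamma)\underline\kappa}{4}]$. For $\bullet\in\{\mathcal S,\mathcal A\}$ let $\tilde\pi^{(\bullet)}(a|s)=(1-\varepsilon^{(\bullet)})\pi(a|s)+\varepsilon^{(\bullet)}/|\mathcal A|$. Put $w(s,a)=\kappa(s)\,\tilde\pi^{(\mathcal A)}(a|s)$, $W=\mathrm{diag}(w)$, $\|v\|_W^2=\sum_z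 w(z)v(z)^2$. Let $\Phi\in\mathbb R^{\mathcal Z\times d}$ ($d\ge1$) have full column rank, with rows $\phi(z)^T$; let $\Omega=\|\Phi\|_2$ and $\mu=\lambda_{\min}(\Phi^TW\Phi)$. **Algorithm (CTD).** Start at $\theta_0=0$. Along a single online trajectory of the MDP, for $t=0,\dots,2N-1$ set $\theta_{t+1}=\theta_t-\iota\hat F_t(\theta_t)$, where $\hat F_t$ is sampled as follows, with fresh randomness. Draw $\tilde s$ equal to $s_{or}$ with probability $1-f$ and uniform on $\mathcal S$ with probability $f$, and independently $\tilde t$ with $\Pr\{\tilde t=l\}=(1-\gamma)\gamma^l$, $l\ge0$. If $\tilde t\ge m$, set $\hat F_t=0$ and do not move. Otherwise follow $\tilde\pi^{(\mathcal S)}$ until the trajectory first visits $\tilde s$, then follow $\pi$ for $\tilde t$ steps; at the state $s$ so reached, draw $a\sim\tilde\pi^{(\mathcal A)}(\cdot|s)$, $s'\sim P(\cdot|s,a)$, $a'\sim\pi(\cdot|s')$, and with $z=(s,a)$, $z'=(s',a')$ set $\hat F_t(\theta)=\phi(z)\,[\phi(z)^T\theta-c(z)-\gamma\phi(z')^T\theta]$;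 the next iteration starts at $s'$. Assume that almost surely every one of these visits to a target $\tilde s$ takes place in finite time. The output is $\hat Q_{N,2N}=N^{-1}\sum_{t=N}^{2N-1}\Phi\theta_t$. **Theorem.** The projected Bellman equation $\bar Q=\Phi[\Phi^TW\Phi]^{-1}\Phi^TW(\gamma P^\pi\bar Q+c)$ has a unique solution $\bar Q$. Suppose that $$m\ \ge\ \log_{1/\gamma}\Big(\frac{(\Omega^2+1)|\mathcal S|^{1/2}}{\mu}\Big),\qquad 0<\iota\le\frac{1-\gamma}{512\,\Omega^2},$$ let $T=\lceil\frac{8}{(1-\gamma)\iota\mu}\rceil$ and $C_2(\iota,m)=\frac{6\iota|\mathcal S|^{1/2}\Omega^2\gamma^m}{\mu}\big(1+2\iota|\mathcal S|^{1/2}\Omega^2\gamma^m\big)$. Then for every $N\ge T$, $\|\hat Q_{N,2N}-\bar Q\|_W^2$ is integrable and $$\mathbb E\|\hat Q_{N,2N}-\bar Q\|_W^2\ \le\ \frac{196\,[11+2\log_2(T\Omega^2/\mu)]}{\lfloor N/T\rfloor(1-\gamma)^2}+\frac{556\sqrt{\Omega^2T^2C_2(\iota,m)}}{\sqrt{(1-\gamma)^4\min\{1,\mu\}}}.$$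 -/

import Mathlib

open MeasureTheory

/-- A finite discounted Markov decision process; `P s a s'` is the probability of moving from `s`
to `s'` under action `a`. Costs lie in `[0, 1]`. -/
structure MDP (S A : Type*) [Fintype S] [Fintype A] where
  P : S → A → S → ℝ
  P_nonneg : ∀ s a s', 0 ≤ P s a s'
  P_sum : ∀ s a, ∑ s', P s a s' = 1
  c : S → A → ℝ
  c_nonneg : ∀ s a, 0 ≤ c s a
  c_le_one : ∀ s a, c s a ≤ 1
  γ : ℝ
  γ_nonneg : 0 ≤ γ
  γ_lt_one : γ < 1

/-- `π s a` is the probability of choosing action `a` in state `s`. -/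
def IsPolicy {S A : Type*} [Fintype A] (π : S → A → ℝ) : Prop :=
  (∀ s a, 0 ≤ π s a) ∧ ∀ s, ∑ a, π s a = 1

noncomputable section

/-- The policy `(1 - ε) π + ε · uniform(A)`. -/
def perturbed {S A : Type*} [Fintype A] (π : S → A → ℝ) (ε : ℝ) : S → A → ℝ :=
  fun s a => (1 - ε) * π s a + ε / (Fintype.card A : ℝ)

namespace MDP

variable {S A : Type*} [Fintype S] [Fintype A] [DecidableEq S] [DecidableEq A]

/-- One-step transition matrix of the states under `π`. -/
def stateMatrix (M : MDP S A) (π : S → A → ℝ) : Matrix S S ℝ :=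
  Matrix.of fun s s' => ∑ a, π s a * M.P s a s'

/-- Transition matrix of the state-action pairs under `π`. -/
def pairMatrix (M : MDP S A) (π : S → A → ℝ) : Matrix (S × A) (S × A) ℝ :=
  Matrix.of fun z z' => M.P z.1 z.2 z'.1 * π z'.1 z'.2

/-- Discounted visitation distribution `κ^π_q(s) = (1-γ) ∑ₜ γᵗ Pr^π(s_t = s | s_0 = q)`. -/
def visitation (M : MDP S A) (π : S → A → ℝ) (q s : S) : ℝ :=
  (1 - M.γ) * ∑' t : ℕ, M.γ ^ t * (M.stateMatrix π ^ t) q s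

/-- `κ^π_{s_or,f} = (1-f) κ^π_{s_or} + f · (average of κ^π_q over all states q)`. -/
def mixedVisitation (M : MDP S A) (π : S → A → ℝ) (sor : S) (f : ℝ) (s : S) : ℝ :=
  (1 - f) * M.visitation π sor s
    + f * ∑ q, (Fintype.card S : ℝ)⁻¹ * M.visitation π q s

/-- The weights `w(s,a) = κ^π_{s_or,f}(s) · π̃(a|s)`, with `π̃` the action-exploration policy. -/
def weight (M : MDP S A) (π : S → A → ℝ) (sor : S) (f εA : ℝ) (z : S × A) : ℝ :=
  M.mixedVisitation π sor f z.1 * perturbed π εA z.1 z.2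

end MDP

/-- `‖v‖_W² = ∑_z w(z) v(z)²`. -/
def wNormSq {Z : Type*} [Fintype Z] (w v : Z → ℝ) : ℝ := ∑ z, w z * v z ^ 2

/-- The weighted Gram matrix `Φᵀ diag(w) Φ`. -/
def gram {Z : Type*} [Fintype Z] [DecidableEq Z] {d : ℕ} (Φ : Matrix Z (Fin d) ℝ) (w : Z → ℝ) :
    Matrix (Fin d) (Fin d) ℝ :=
  Φ.transpose * Matrix.diagonal w * Φ

theorem gram_isHermitian {Z : Type*} [Fintype Z] [DecidableEq Z] {d : ℕ}
    (Φ : Matrix Z (Fin d) ℝ) (w : Z → ℝ) : (gram Φ w).IsHermitian := by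
  have h := Matrix.isHermitian_conjTranspose_mul_mul Φ (Matrix.isHermitian_diagonal w)
  rwa [Matrix.conjTranspose_eq_transpose_of_trivial] at h

/-- The smallest eigenvalue of `Φᵀ diag(w) Φ`. -/
def muMin {Z : Type*} [Fintype Z] [DecidableEq Z] {d : ℕ} (Φ : Matrix Z (Fin d) ℝ)
    (w : Z → ℝ) : ℝ :=
  ⨅ j, (gram_isHermitian Φ w).eigenvalues j

/-- The spectral norm `‖Φ‖₂`. -/
def specNorm {Z : Type*} [Fintype Z] {d : ℕ} (Φ : Matrix Z (Fin d) ℝ) : ℝ :=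
  ‖(Matrix.toEuclideanLin Φ).toContinuousLinearMap‖

/-- The projected Bellman equation `Q = Φ (Φᵀ W Φ)⁻¹ Φᵀ W (γ P^π Q + c)`, `W = diag(w)`. -/
def ProjBellman {S A : Type*} [Fintype S] [Fintype A] [DecidableEq S] [DecidableEq A] {d : ℕ}
    (M : MDP S A) (π : S → A → ℝ) (Φ : Matrix (S × A) (Fin d) ℝ) (w : S × A → ℝ)
    (Q : S × A → ℝ) : Prop :=
  Q = (Φ * (gram Φ w)⁻¹ * Φ.transpose * Matrix.diagonal w).mulVec
    (M.γ • (M.pairMatrix π).mulVec Q + fun z => M.c z.1 z.2)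

/-- First time at which `path` visits `g` (only used for paths that do visit `g`). -/
def hitTime {S : Type*} (path : ℕ → S) (g : S) : ℕ := sInf {n | path n = g}

open Classical in
/-- The policy that chooses the action at time `n` of a trajectory with target state `g` and mixing
length `l`: the state-exploration policy `πS` until `g` is first visited, then the policy `π`,
except at time `hitTime + l` where it is the action-exploration policy `πA`. -/
def behavior {S A : Type*} (π πS πA : S → A → ℝ) (path : ℕ → S) (g : S) (l n : ℕ) :
    S → A → ℝ :=
  if ∀ k ≤ n, path k ≠ g then πS
  else if n = hitTime path g + l then πA
  else π

/-- The samples of a CTD run on a probability space. Iteration `i` draws a random origin `origin i`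
and an independent geometric length `len i`. When `len i < m` it extends the online trajectory:
`st i n`, `ac i n` are the states and actions of the part of the trajectory that belongs to
iteration `i`, which starts where the previous one stopped. When `len i ≥ m` nothing is sampled.
`ℱ i 0` is the information available before iteration `i`; `ℱ i (2n+1)` and `ℱ i (2n+2)` are the
information in iteration `i` just after its `n`-th state and just after its `n`-th action. -/
structure CTDRun {S A : Type*} [Fintype S] [Fintype A] [DecidableEq S]
    (M : MDP S A) (π : S → A → ℝ) (sor : S) (f : ℝ) (m : ℕ) (εS εA : ℝ)
    {Ω : Type*} [MeasurableSpace Ω] (ℙ : Measure Ω) where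
  origin : ℕ → Ω → S
  len : ℕ → Ω → ℕ
  st : ℕ → ℕ → Ω → S
  ac : ℕ → ℕ → Ω → A
  ℱ : ℕ → ℕ → MeasurableSpace Ω
  ℱ_le : ∀ i k E, MeasurableSet[ℱ i k] E → MeasurableSet E
  ℱ_step : ∀ i k E, MeasurableSet[ℱ i k] E → MeasurableSet[ℱ i (k + 1)] E
  ℱ_iter : ∀ i k E, MeasurableSet[ℱ i k] E → MeasurableSet[ℱ (i + 1) 0] E
  meas_start : ∀ s, MeasurableSet[ℱ 0 0] {ω | st 0 0 ω = s}
  meas_origin : ∀ i s, MeasurableSet[ℱ i 1] {ω | origin i ω = s}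
  meas_len : ∀ i l, MeasurableSet[ℱ i 1] {ω | len i ω = l}
  meas_st : ∀ i n s, MeasurableSet[ℱ i (2 * n + 1)] {ω | st i n ω = s}
  meas_ac : ∀ i n a, MeasurableSet[ℱ i (2 * n + 2)] {ω | ac i n ω = a}
  /-- The next iteration continues the same trajectory. -/
  start_next : ∀ i ω, st (i + 1) 0 ω =
    if len i ω < m then
      st i (hitTime (fun n => st i n ω) (origin i ω) + len i ω + 1) ω
    else st i 0 ω
  /-- Given the past, the origin is `sor` with probability `1 - f` and uniform on `S` with
  probability `f`, and the length is geometric on `{0, 1, …}` with success probability `1 - γ`,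
  independent of the origin. -/
  law_sample : ∀ i s l E, MeasurableSet[ℱ i 0] E →
    ℙ.real (E ∩ {ω | origin i ω = s ∧ len i ω = l}) =
      ℙ.real E * ((1 - f) * (if s = sor then 1 else 0) + f / (Fintype.card S : ℝ))
        * ((1 - M.γ) * M.γ ^ l)
  /-- Given the past, actions are drawn from the policy in force at that time. -/
  law_action : ∀ i n s a (p : S → A → ℝ) E, MeasurableSet[ℱ i (2 * n + 1)] E →
    (∀ ω ∈ E, len i ω < m ∧ st i n ω = s ∧
      behavior π (perturbed π εS) (perturbed π εA) (fun k => st i k ω) (origin i ω)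
        (len i ω) n = p) →
    ℙ.real (E ∩ {ω | ac i n ω = a}) = ℙ.real E * p s a
  /-- Given the past, states move according to the transition kernel of the process. -/
  law_trans : ∀ i n s a s' E, MeasurableSet[ℱ i (2 * n + 2)] E →
    (∀ ω ∈ E, len i ω < m ∧ st i n ω = s ∧ ac i n ω = a) →
    ℙ.real (E ∩ {ω | st i (n + 1) ω = s'}) = ℙ.real E * M.P s a s'

namespace CTDRun

variable {S A : Type*} [Fintype S] [Fintype A] [DecidableEq S]
  {M : MDP S A} {π : S → A → ℝ} {sor : S} {f : ℝ} {m : ℕ} {εS εA : ℝ}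
  {Ω : Type*} [MeasurableSpace Ω] {ℙ : Measure Ω}

/-- The time, within iteration `i`, at which the operator is sampled. -/
def obsTime (X : CTDRun M π sor f m εS εA ℙ) (i : ℕ) (ω : Ω) : ℕ :=
  hitTime (fun n => X.st i n ω) (X.origin i ω) + X.len i ω

/-- The state-action pair of iteration `i` at time `n`. -/
def pair (X : CTDRun M π sor f m εS εA ℙ) (i n : ℕ) (ω : Ω) : S × A :=
  (X.st i n ω, X.ac i n ω)

/-- The stochastic operator
`F̂(θ) = φ(z) [φ(z)ᵀθ - c(z) - γ φ(z')ᵀθ] · 1[len < m]` of iteration `i`. -/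
def stochOp {d : ℕ} (X : CTDRun M π sor f m εS εA ℙ) (Φ : Matrix (S × A) (Fin d) ℝ)
    (i : ℕ) (ω : Ω) (θ : Fin d → ℝ) : Fin d → ℝ :=
  if X.len i ω < m then
    let z := X.pair i (X.obsTime i ω) ω
    let z' := X.pair i (X.obsTime i ω + 1) ω
    (Φ z ⬝ᵥ θ - M.c z.1 z.2 - M.γ * (Φ z' ⬝ᵥ θ)) • Φ z
  else 0

/-- The CTD iterates `θ₀ = 0`, `θ_{t+1} = θ_t - ι F̂_t(θ_t)`. -/
def theta {d : ℕ} (X : CTDRun M π sor f m εS εA ℙ) (Φ : Matrix (S × A) (Fin d) ℝ) (ι : ℝ) :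
    ℕ → Ω → Fin d → ℝ
  | 0, _ => 0
  | t + 1, ω => theta X Φ ι t ω - ι • X.stochOp Φ t ω (theta X Φ ι t ω)

/-- The CTD output `Q̂_{N,2N} = N⁻¹ ∑_{t=N}^{2N-1} Φ θ_t`. -/
def Qhat {d : ℕ} (X : CTDRun M π sor f m εS εA ℙ) (Φ : Matrix (S × A) (Fin d) ℝ) (ι : ℝ)
    (N : ℕ) (ω : Ω) : S × A → ℝ :=
  (N : ℝ)⁻¹ • ∑ t ∈ Finset.Ico N (2 * N), Φ.mulVec (X.theta Φ ι t ω)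

end CTDRun

/-- The epoch length `T = ⌈8 / ((1-γ) ι μ)⌉`. -/
def epochLen (γ ι μ : ℝ) : ℕ := ⌈8 / ((1 - γ) * ι * μ)⌉₊

/-- `C₂(ι,m) = (6 ι |S|^{1/2} Ω² γᵐ / μ) (1 + 2 ι |S|^{1/2} Ω² γᵐ)`. -/
def C2 (nS : ℕ) (γ Om μ ι : ℝ) (m : ℕ) : ℝ :=
  6 * ι * √(nS : ℝ) * Om ^ 2 * γ ^ m / μ * (1 + 2 * ι * √(nS : ℝ) * Om ^ 2 * γ ^ m)

/-- `σ̂(N,ι,m)²`, for feature matrix norm `Om` and smallest eigenvalue `μ`. -/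
def sigmaHatSq (nS : ℕ) (γ Om μ ι : ℝ) (m N : ℕ) : ℝ :=
  196 * (11 + 2 * Real.logb 2 ((epochLen γ ι μ : ℝ) * Om ^ 2 / μ)) /
      (((N / epochLen γ ι μ : ℕ) : ℝ) * (1 - γ) ^ 2)
    + 556 * √(Om ^ 2 * (epochLen γ ι μ : ℝ) ^ 2 * C2 nS γ Om μ ι m) /
      √((1 - γ) ^ 4 * min 1 μ)

end

noncomputable section

open Finset

set_option linter.unusedSectionVars false

/-! Write x = 1-γ, ‖·‖ for the W-norm, Y(s) for the π-average of u² at s, and r = √|S| Ω² γ^m / μ.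
The condition on m gives r ≤ 1.

Sampling. Once the trajectory has reached the random origin it is a fresh Markov chain started
there, whatever happened before. Hence, given the past, the transition used in an iteration always
has the same law: the first m steps of the discounted visitation distribution, followed by π̃ and
P^π, with probability γ^m of no sample (`real_inter_sample`). CTD is thus linear stochastic
approximation with independent samples, and no mixing argument is needed. The samples take finitely
many values, so integrability is automatic.

Coercivity. The error v = θ_t - θ̄, with u = Φv, is driven by the form Σ w u (u - γ P^π u). Young's
and Jensen's inequalities together with the balance equation γκP = κ - (1-γ)ν bound it below by a
multiple of x‖u‖² (`two_mul_bform_ge`, `bform_disc_ge`). Exploratory actions break the balance, but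
they cost only ε max_s Y(s), which ε ≤ xκ/4 absorbs. The second moment of the temporal difference is
at most twice the same form (`transSum_sq_disc_le`), so a step size of order x/Ω² suffices. At the
fixed point the second moment of the residual is only O(1/x) (`transSum_resid_sq_le`).

Truncation. Dropping the tail of mass γ^m damages the form and gives the operator a nonzero mean at
θ̄. Both effects are controlled by γ^m Ω² |v|², which is at most r‖u‖²/√|S|.

If r ≤ 1/8, the truncated form is still clearly coercive. Averaging the recursion and testing it
against the averaged error leaves a boundary term, a martingale term and a bias of order r/x³
(`integral_wNormSq_Qhat_le_of_small`).

If r > 1/8, the second term of the claimed bound is already large, and it is enough that the mean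
squared error of the iterates stays bounded by a multiple of r/(x³μ). This needs coercivity of the
truncated form for every r ≤ 1 (`bform_truncDisc_ge`), the hardest step. With one state, truncation
only rescales. Otherwise normalise the sum of u² to at most 1, let p be its largest term, s0 the
state where it sits, b² = Y(s0) and c² = 1-p. Transitions into s0 from elsewhere gain (b-c)² in
Young's inequality, and the truncation loss becomes γ^m (p + 2bc - c²) ≤ √2 γ^m. Against ‖u‖² ≥ √|S|
γ^m this leaves room for three states. For two states it is a tie; the balance equation of a
two-state chain breaks it (`two_state_form_ge`). -/

/-- A probability vector. -/
def IsProbVec {S : Type*} [Fintype S] (ν : S → ℝ) : Prop := (∀ s, 0 ≤ ν s) ∧ ∑ s, ν s = 1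

theorem IsProbVec.le_one {S : Type*} [Fintype S] {ν : S → ℝ} (h : IsProbVec ν) (s : S) :
    ν s ≤ 1 := h.2 ▸ single_le_sum (fun i _ => h.1 i) (mem_univ s)

/-- A probability average is at most an upper bound of the averaged function. -/
theorem IsProbVec.sum_mul_le {S : Type*} [Fintype S] {ν : S → ℝ} (h : IsProbVec ν) {Y : S → ℝ}
    {B : ℝ} (hY : ∀ s, Y s ≤ B) : ∑ s, ν s * Y s ≤ B :=
  calc ∑ s, ν s * Y s ≤ ∑ s, ν s * B := sum_le_sum fun s _ => mul_le_mul_of_nonneg_left (hY s) (h.1 s)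
    _ = B := by rw [← sum_mul, h.2, one_mul]

/-- Cauchy-Schwarz for a probability vector. -/
theorem IsProbVec.sq_sum_mul_le {S : Type*} [Fintype S] {ν : S → ℝ} (h : IsProbVec ν) (Y : S → ℝ) :
    (∑ s, ν s * Y s) ^ 2 ≤ ∑ s, ν s * Y s ^ 2 := by
  have := sum_sq_le_sum_mul_sum_of_sq_le_mul univ (r := fun s => ν s * Y s)
    (f := ν) (g := fun s => ν s * Y s ^ 2) (fun s _ => h.1 s)
    (fun s _ => mul_nonneg (h.1 s) (sq_nonneg _)) (fun s _ => le_of_eq (by ring))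
  rwa [h.2, one_mul] at this

/-! ### Occupation measures, their truncations and balance equations -/

namespace MDP

variable {S A : Type*} [Fintype S] [Fintype A] [DecidableEq S]

/-- The distribution of the random origin. -/
def originDist (S : Type*) [Fintype S] [DecidableEq S] (sor : S) (f : ℝ) (s : S) : ℝ :=
  (1 - f) * (if s = sor then 1 else 0) + f / (Fintype.card S : ℝ)

theorem originDist_isProbVec (sor : S) {f : ℝ} (hf : f ∈ Set.Icc (0 : ℝ) 1) :
    IsProbVec (originDist S sor f) := by
  constructor
  · intro s
    have h1 : 0 ≤ 1 - f := by linarith [hf.2]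
    have h0 := hf.1
    unfold originDist
    split_ifs <;> positivity
  · have : Nonempty S := ⟨sor⟩
    have hc : (Fintype.card S : ℝ) ≠ 0 := by exact_mod_cast Fintype.card_ne_zero
    simp only [originDist, sum_add_distrib, ← mul_sum, sum_ite_eq', mem_univ, if_true, sum_const,
      card_univ, nsmul_eq_mul]
    field_simp
    ring

variable (M : MDP S A) {π : S → A → ℝ}

theorem stateMatrix_nonneg (hπ : IsPolicy π) (s s' : S) : 0 ≤ M.stateMatrix π s s' :=
  sum_nonneg fun a _ => mul_nonneg (hπ.1 s a) (M.P_nonneg s a s')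

theorem stateMatrix_sum (hπ : IsPolicy π) (s : S) : ∑ s', M.stateMatrix π s s' = 1 := by
  simp only [stateMatrix, Matrix.of_apply]
  rw [sum_comm]
  simp only [← mul_sum, M.P_sum, mul_one, hπ.2 s]

/-- The distribution of the state after `l` steps from the distribution `ν`. -/
def occ (π : S → A → ℝ) (ν : S → ℝ) (l : ℕ) : S → ℝ := Matrix.vecMul ν (M.stateMatrix π ^ l)

theorem occ_zero (π : S → A → ℝ) (ν : S → ℝ) : M.occ π ν 0 = ν := by simp [occ]

theorem occ_succ (π : S → A → ℝ) (ν : S → ℝ) (l : ℕ) :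
    M.occ π ν (l + 1) = Matrix.vecMul (M.occ π ν l) (M.stateMatrix π) := by
  simp [occ, pow_succ, Matrix.vecMul_vecMul]

theorem occ_succ_apply (π : S → A → ℝ) (ν : S → ℝ) (l : ℕ) (s : S) :
    M.occ π ν (l + 1) s = ∑ q, M.occ π ν l q * M.stateMatrix π q s := by
  rw [occ_succ]; rfl

theorem occ_add (π : S → A → ℝ) (ν : S → ℝ) (k l : ℕ) :
    M.occ π ν (k + l) = M.occ π (M.occ π ν k) l := by
  simp [occ, pow_add, Matrix.vecMul_vecMul]

theorem occ_isProbVec (hπ : IsPolicy π) {ν : S → ℝ} (hν : IsProbVec ν) (l : ℕ) :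
    IsProbVec (M.occ π ν l) := by
  induction l with
  | zero => rwa [occ_zero]
  | succ l ih =>
    constructor
    · intro s
      rw [occ_succ_apply]
      exact sum_nonneg fun q _ => mul_nonneg (ih.1 q) (M.stateMatrix_nonneg hπ q s)
    · simp only [occ_succ_apply]
      rw [sum_comm]
      simp only [← mul_sum, M.stateMatrix_sum hπ, mul_one, ih.2]

/-- The discounted visitation distribution from the initial distribution `ν`. -/
def disc (π : S → A → ℝ) (ν : S → ℝ) (s : S) : ℝ :=
  (1 - M.γ) * ∑' l : ℕ, M.γ ^ l * M.occ π ν l s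

/-- The part of the discounted visitation distribution of the first `m` steps. -/
def truncDisc (π : S → A → ℝ) (ν : S → ℝ) (m : ℕ) (s : S) : ℝ :=
  (1 - M.γ) * ∑ l ∈ range m, M.γ ^ l * M.occ π ν l s

theorem summable_occ (hπ : IsPolicy π) {ν : S → ℝ} (hν : IsProbVec ν) (s : S) :
    Summable fun l : ℕ => M.γ ^ l * M.occ π ν l s := by
  refine Summable.of_nonneg_of_le (fun l => mul_nonneg (pow_nonneg M.γ_nonneg _)
    ((M.occ_isProbVec hπ hν l).1 s)) (fun l => ?_)
    (summable_geometric_of_lt_one M.γ_nonneg M.γ_lt_one)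
  exact mul_le_of_le_one_right (pow_nonneg M.γ_nonneg _) ((M.occ_isProbVec hπ hν l).le_one s)

theorem one_sub_γ_pos : 0 < 1 - M.γ := by linarith [M.γ_lt_one]

theorem disc_isProbVec (hπ : IsPolicy π) {ν : S → ℝ} (hν : IsProbVec ν) :
    IsProbVec (M.disc π ν) := by
  constructor
  · intro s
    exact mul_nonneg M.one_sub_γ_pos.le (tsum_nonneg fun l => mul_nonneg (pow_nonneg M.γ_nonneg _)
      ((M.occ_isProbVec hπ hν l).1 s))
  · simp only [disc, ← mul_sum]
    rw [← Summable.tsum_finsetSum fun s _ => M.summable_occ hπ hν s]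
    simp only [← mul_sum, (M.occ_isProbVec hπ hν _).2, mul_one]
    rw [tsum_geometric_of_lt_one M.γ_nonneg M.γ_lt_one, mul_inv_cancel₀ M.one_sub_γ_pos.ne']

/-- By the Markov property the tail after m steps is again a discounted visitation distribution,
restarted from the state distribution at time m. Every truncation estimate below splits along this
identity. -/
theorem disc_eq_truncDisc_add (hπ : IsPolicy π) {ν : S → ℝ} (hν : IsProbVec ν) (m : ℕ) (s : S) :
    M.disc π ν s = M.truncDisc π ν m s + M.γ ^ m * M.disc π (M.occ π ν m) s := by
  simp only [disc, truncDisc]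
  rw [← (M.summable_occ hπ hν s).sum_add_tsum_nat_add m, mul_add]
  congr 1
  rw [mul_left_comm, ← tsum_mul_left (a := M.γ ^ m)]
  congr 2
  funext l
  rw [← occ_add, add_comm l m, pow_add, mul_assoc]

theorem truncDisc_nonneg (hπ : IsPolicy π) {ν : S → ℝ} (hν : IsProbVec ν) (m : ℕ) (s : S) :
    0 ≤ M.truncDisc π ν m s :=
  mul_nonneg M.one_sub_γ_pos.le (sum_nonneg fun l _ => mul_nonneg (pow_nonneg M.γ_nonneg _)
      ((M.occ_isProbVec hπ hν l).1 s))

theorem truncDisc_sum (hπ : IsPolicy π) {ν : S → ℝ} (hν : IsProbVec ν) (m : ℕ) :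
    ∑ s, M.truncDisc π ν m s = 1 - M.γ ^ m := by
  have h := (M.disc_isProbVec hπ hν).2
  simp only [M.disc_eq_truncDisc_add hπ hν m, sum_add_distrib, ← mul_sum,
    (M.disc_isProbVec hπ (M.occ_isProbVec hπ hν m)).2] at h
  linarith

/-- Balance equation of the truncated visitation distribution. -/
theorem truncDisc_flow (π : S → A → ℝ) (ν : S → ℝ) (m : ℕ) (s : S) :
    M.γ * ∑ q, M.truncDisc π ν m q * M.stateMatrix π q s
      = M.truncDisc π ν m s - (1 - M.γ) * (ν s - M.γ ^ m * M.occ π ν m s) := by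
  induction m with
  | zero => simp [truncDisc, occ_zero]
  | succ m ih =>
    have h : ∀ q, M.truncDisc π ν (m + 1) q
        = M.truncDisc π ν m q + (1 - M.γ) * (M.γ ^ m * M.occ π ν m q) := fun q => by
      simp only [truncDisc, sum_range_succ, mul_add]
    have h2 : ∑ q, M.truncDisc π ν (m + 1) q * M.stateMatrix π q s
        = ∑ q, M.truncDisc π ν m q * M.stateMatrix π q s
          + (1 - M.γ) * (M.γ ^ m * M.occ π ν (m + 1) s) := by
      rw [occ_succ_apply, mul_sum, mul_sum, ← sum_add_distrib]
      exact sum_congr rfl fun q _ => by rw [h]; ring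
    rw [h2, mul_add, ih, h]
    ring

/-- Balance equation of the discounted visitation distribution. -/
theorem disc_flow (hπ : IsPolicy π) {ν : S → ℝ} (hν : IsProbVec ν) (s : S) :
    M.γ * ∑ q, M.disc π ν q * M.stateMatrix π q s = M.disc π ν s - (1 - M.γ) * ν s := by
  have h : ∑ q, M.disc π ν q * M.stateMatrix π q s = M.disc π (M.occ π ν 1) s := by
    simp only [disc]
    simp only [mul_assoc, ← mul_sum, ← tsum_mul_right]
    rw [← Summable.tsum_finsetSum fun q _ => by
      simpa only [mul_assoc] using (M.summable_occ hπ hν q).mul_right (M.stateMatrix π q s)]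
    congr 2
    funext l
    rw [← occ_add, add_comm 1 l, occ_succ_apply, mul_sum]
  rw [h, M.disc_eq_truncDisc_add hπ hν 1 s]
  simp [truncDisc, occ_zero]

/-- Discounted visitation is linear in the initial distribution, so mixing the visitation
distributions amounts to mixing the starting states. -/
theorem mixedVisitation_eq_disc (hπ : IsPolicy π) (sor : S) (f : ℝ)
    (s : S) : M.mixedVisitation π sor f s = M.disc π (originDist S sor f) s := by
  have hs : ∀ q : S, IsProbVec (Pi.single q (1 : ℝ)) := fun q =>
    ⟨fun s => by
      by_cases h : s = q
      · subst h; simp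
      · simp [h], by simp⟩
  have hv : ∀ q, M.visitation π q s = (1 - M.γ) * ∑' l : ℕ, M.γ ^ l * M.occ π (Pi.single q 1) l s :=
    fun q => by simp [visitation, occ]
  have ho : ∀ l, M.occ π (originDist S sor f) l s
      = ∑ q, originDist S sor f q * M.occ π (Pi.single q 1) l s := fun l => by
    simp [occ, Matrix.vecMul, dotProduct, Pi.single_apply]
  have hd : M.disc π (originDist S sor f) s
      = ∑ q, originDist S sor f q * M.visitation π q s := by
    simp only [hv, disc, ho, mul_sum (s := univ), mul_left_comm _ (originDist S sor f _)]
    rw [Summable.tsum_finsetSum fun q _ => (M.summable_occ hπ (hs q) s).mul_left _, mul_sum]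
    exact sum_congr rfl fun q _ => by rw [tsum_mul_left]; ring
  rw [hd]
  simp only [mixedVisitation, originDist, add_mul, sum_add_distrib, mul_sum]
  congr 1
  · simp
  · exact sum_congr rfl fun q _ => by ring

end MDP

/-! ### Averages over actions and state-action weights -/

/-- Average over the actions, under `p`, of a function of the state-action pairs. -/
def polAvg {S A : Type*} [Fintype A] (p : S → A → ℝ) (h : S × A → ℝ) (s : S) : ℝ :=
  ∑ a, p s a * h (s, a)

/-- The weights `κ(s) π̃(a|s)`. -/
def stWeight {S A : Type*} [Fintype A] (π : S → A → ℝ) (ε : ℝ) (κ : S → ℝ) (z : S × A) : ℝ :=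
  κ z.1 * perturbed π ε z.1 z.2

/-- The uniform policy. -/
def unif (S A : Type*) [Fintype A] : S → A → ℝ := fun _ _ => (Fintype.card A : ℝ)⁻¹

section

variable {S A : Type*} [Fintype S] [Fintype A]

theorem unif_isPolicy [Nonempty A] : IsPolicy (unif S A) :=
  ⟨fun _ _ => by unfold unif; positivity, fun _ => by simp [unif]⟩

theorem perturbed_isPolicy [Nonempty A] {π : S → A → ℝ} (hπ : IsPolicy π) {ε : ℝ} (h0 : 0 ≤ ε)
    (h1 : ε ≤ 1) : IsPolicy (perturbed π ε) := by
  constructor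
  · intro s a
    have := hπ.1 s a
    have h2 : 0 ≤ 1 - ε := by linarith
    unfold perturbed
    positivity
  · intro s
    simp only [perturbed, sum_add_distrib, ← mul_sum, hπ.2 s, sum_const, card_univ, nsmul_eq_mul]
    field_simp
    ring

theorem polAvg_perturbed (π : S → A → ℝ) (ε : ℝ) (h : S × A → ℝ) (s : S) :
    polAvg (perturbed π ε) h s = (1 - ε) * polAvg π h s + ε * polAvg (unif S A) h s := by
  simp only [polAvg, perturbed, unif, mul_sum, ← sum_add_distrib]
  exact sum_congr rfl fun a _ => by ring

theorem sum_stWeight_mul (π : S → A → ℝ) (ε : ℝ) (κ : S → ℝ) (h : S × A → ℝ) :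
    ∑ z, stWeight π ε κ z * h z = ∑ s, κ s * polAvg (perturbed π ε) h s := by
  rw [Fintype.sum_prod_type]
  refine sum_congr rfl fun s _ => ?_
  simp only [stWeight, polAvg, mul_sum, mul_assoc]

theorem wNormSq_stWeight (π : S → A → ℝ) (ε : ℝ) (κ : S → ℝ) (u : S × A → ℝ) :
    wNormSq (stWeight π ε κ) u
      = ∑ s, κ s * polAvg (perturbed π ε) (fun z => u z ^ 2) s :=
  sum_stWeight_mul π ε κ fun z => u z ^ 2

theorem IsPolicy.sq_polAvg_le {π : S → A → ℝ} (hπ : IsPolicy π) (u : S × A → ℝ) (s : S) :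
    polAvg π u s ^ 2 ≤ polAvg π (fun z => u z ^ 2) s :=
  IsProbVec.sq_sum_mul_le ⟨hπ.1 s, hπ.2 s⟩ _

theorem IsPolicy.polAvg_nonneg {π : S → A → ℝ} (hπ : IsPolicy π) {h : S × A → ℝ}
    (hh : ∀ z, 0 ≤ h z) (s : S) : 0 ≤ polAvg π h s :=
  sum_nonneg fun a _ => mul_nonneg (hπ.1 s a) (hh _)

theorem IsPolicy.polAvg_le {π : S → A → ℝ} (hπ : IsPolicy π) {h : S × A → ℝ} {B : ℝ} {s : S}
    (hh : ∀ a, h (s, a) ≤ B) : polAvg π h s ≤ B :=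
  IsProbVec.sum_mul_le ⟨hπ.1 s, hπ.2 s⟩ hh

end

/-! ### The temporal-difference form and its lower bound for any weights in balance -/

namespace MDP

variable {S A : Type*} [Fintype S] [Fintype A] [DecidableEq S] (M : MDP S A)

/-- The bilinear form `∑ w u (v - γ P^π v)`. -/
def bform (π : S → A → ℝ) (w u v : S × A → ℝ) : ℝ :=
  ∑ z, w z * (u z * (v z - M.γ * (M.pairMatrix π).mulVec v z))

/-- The sum of `h z z'` over the transitions `z → z'` from the weights `w`. -/
def transSum (π : S → A → ℝ) (w : S × A → ℝ) (h : S × A → S × A → ℝ) : ℝ :=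
  ∑ z, ∑ z', w z * M.pairMatrix π z z' * h z z'

variable {π : S → A → ℝ}

theorem pairMatrix_mulVec (π : S → A → ℝ) (u : S × A → ℝ) (z : S × A) :
    (M.pairMatrix π).mulVec u z = ∑ s', M.P z.1 z.2 s' * polAvg π u s' := by
  simp only [Matrix.mulVec, dotProduct, pairMatrix, Matrix.of_apply, Fintype.sum_prod_type, polAvg,
    mul_sum, mul_assoc]

theorem pairMatrix_nonneg (hπ : IsPolicy π) (z z' : S × A) : 0 ≤ M.pairMatrix π z z' :=
  mul_nonneg (M.P_nonneg _ _ _) (hπ.1 _ _)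

theorem pairMatrix_sum (hπ : IsPolicy π) (z : S × A) : ∑ z', M.pairMatrix π z z' = 1 := by
  have := M.pairMatrix_mulVec π (fun _ => 1) z
  simpa [Matrix.mulVec, dotProduct, polAvg, hπ.2, M.P_sum] using this

theorem polAvg_sum_P (p : S → A → ℝ) (Y : S → ℝ) (s : S) :
    polAvg p (fun z => ∑ s', M.P z.1 z.2 s' * Y s') s = ∑ s', M.stateMatrix p s s' * Y s' := by
  simp only [polAvg, stateMatrix, Matrix.of_apply, mul_sum, sum_mul]
  rw [sum_comm]
  exact sum_congr rfl fun _ _ => sum_congr rfl fun _ _ => by ring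

theorem bform_stWeight (π : S → A → ℝ) (ε : ℝ) (κ : S → ℝ) (u v : S × A → ℝ) :
    M.bform π (stWeight π ε κ) u v
      = ∑ s, κ s * ((1 - ε) * polAvg π (fun z => u z * (v z - M.γ * (M.pairMatrix π).mulVec v z)) s
        + ε * polAvg (unif S A) (fun z => u z * (v z - M.γ * (M.pairMatrix π).mulVec v z)) s) := by
  simp only [bform, sum_stWeight_mul, polAvg_perturbed]

/-- Lower bound of the part of the form where actions follow `π`; transitions into `s0` gain `J`. -/
theorem polAvg_form_ge (hπ : IsPolicy π) (u : S × A → ℝ) (s0 : S) {J : ℝ}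
    (hJ : ∀ s, s ≠ s0 → ∀ a, 2 * u (s, a) * polAvg π u s0
      ≤ u (s, a) ^ 2 + polAvg π (fun z => u z ^ 2) s0 - J) (s : S) :
    (1 - M.γ / 2) * polAvg π (fun z => u z ^ 2) s
        - M.γ / 2 * ∑ s', M.stateMatrix π s s' * polAvg π (fun z => u z ^ 2) s'
        + M.γ / 2 * J * (if s = s0 then 0 else M.stateMatrix π s s0)
      ≤ polAvg π (fun z => u z * (u z - M.γ * (M.pairMatrix π).mulVec u z)) s := by
  set Y := polAvg π (fun z => u z ^ 2) with hY
  have hpt : ∀ a, (1 - M.γ / 2) * u (s, a) ^ 2 - M.γ / 2 * ∑ s', M.P s a s' *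
      (Y s' - J * (if s = s0 then 0 else if s' = s0 then 1 else 0))
      ≤ u (s, a) * (u (s, a) - M.γ * (M.pairMatrix π).mulVec u (s, a)) := by
    intro a
    rw [pairMatrix_mulVec]
    -- Young's inequality, then Jensen for the average over the next action. Only transitions from
    -- another state into `s0` use the sharper inequality `hJ`.
    have h1 : ∑ s', M.P s a s' * (2 * u (s, a) * polAvg π u s') ≤ ∑ s', M.P s a s' *
        (u (s, a) ^ 2 + (Y s' - J * (if s = s0 then 0 else if s' = s0 then 1 else 0))) := by
      refine sum_le_sum fun s' _ => mul_le_mul_of_nonneg_left ?_ (M.P_nonneg s a s')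
      have h2 := hπ.sq_polAvg_le u s'
      rw [← hY] at h2
      by_cases hs : s = s0
      · simp only [hs, if_true]
        nlinarith [sq_nonneg (u (s0, a) - polAvg π u s')]
      · by_cases hs' : s' = s0
        · subst hs'
          simp only [hs, if_true, if_false]
          linarith [hJ s hs a]
        · simp only [hs, hs', if_false]
          nlinarith [sq_nonneg (u (s, a) - polAvg π u s')]
    have h3 : ∑ s', M.P s a s' * (2 * u (s, a) * polAvg π u s')
        = 2 * u (s, a) * ∑ s', M.P s a s' * polAvg π u s' := by
      rw [mul_sum]; exact sum_congr rfl fun _ _ => by ring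
    simp only [mul_add, sum_add_distrib, ← sum_mul, M.P_sum, one_mul] at h1
    rw [h3] at h1
    nlinarith [mul_le_mul_of_nonneg_left h1 M.γ_nonneg]
  have h := sum_le_sum fun a (_ : a ∈ univ) => mul_le_mul_of_nonneg_left (hpt a) (hπ.1 s a)
  refine le_trans (le_of_eq ?_) h
  have e1 : ∑ a, π s a * ∑ s', M.P s a s' *
      (Y s' - J * (if s = s0 then 0 else if s' = s0 then 1 else 0))
      = ∑ s', M.stateMatrix π s s' * (Y s' - J * (if s = s0 then 0 else if s' = s0 then 1 else 0)) :=
    M.polAvg_sum_P π _ s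
  have e2 : ∑ s', M.stateMatrix π s s' * (Y s' - J * (if s = s0 then 0 else if s' = s0 then 1 else 0))
      = ∑ s', M.stateMatrix π s s' * Y s' - J * (if s = s0 then 0 else M.stateMatrix π s s0) := by
    by_cases hs : s = s0
    · simp [hs]
    · simp [hs, mul_sub, sum_sub_distrib, mul_comm]
  simp only [mul_sub, sum_sub_distrib, mul_left_comm (π s _) (M.γ / 2), mul_left_comm (π s _)
    (1 - M.γ / 2), ← mul_sum]
  rw [e2] at e1
  simp only [mul_sub, sum_sub_distrib] at e1
  have e0 : Y s = ∑ a, π s a * u (s, a) ^ 2 := rfl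
  rw [e0]
  linear_combination M.γ / 2 * e1

/-- Young's inequality in the form uq ≤ u² + q²/4, with q the expected next value and q² ≤ B by
Jensen. The balance equation does not cover uniform actions, so the next value is bounded by its
maximum; this is affordable because it is later multiplied by ε. -/
theorem unif_form_ge [Nonempty A] (hπ : IsPolicy π) (u : S × A → ℝ) {B : ℝ}
    (hB : ∀ s, polAvg π (fun z => u z ^ 2) s ≤ B) (s : S) :
    (1 - M.γ) * polAvg (unif S A) (fun z => u z ^ 2) s - M.γ / 4 * B
      ≤ polAvg (unif S A) (fun z => u z * (u z - M.γ * (M.pairMatrix π).mulVec u z)) s := by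
  have hpt : ∀ a, (1 - M.γ) * u (s, a) ^ 2 - M.γ / 4 * B
      ≤ u (s, a) * (u (s, a) - M.γ * (M.pairMatrix π).mulVec u (s, a)) := by
    intro a
    rw [pairMatrix_mulVec]
    have h1 := IsProbVec.sq_sum_mul_le ⟨M.P_nonneg s a, M.P_sum s a⟩ (polAvg π u)
    have h2 := IsProbVec.sum_mul_le ⟨M.P_nonneg s a, M.P_sum s a⟩
      (fun s' => (hπ.sq_polAvg_le u s').trans (hB s'))
    nlinarith [mul_nonneg M.γ_nonneg
      (sq_nonneg (u (s, a) - (∑ s', M.P s a s' * polAvg π u s') / 2)),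
      mul_le_mul_of_nonneg_left (h1.trans h2) M.γ_nonneg]
  have hu := (unif_isPolicy (S := S) (A := A))
  have h := sum_le_sum fun a (_ : a ∈ univ) => mul_le_mul_of_nonneg_left (hpt a) (hu.1 s a)
  refine le_trans (le_of_eq ?_) h
  simp only [mul_sub, sum_sub_distrib, ← sum_mul, hu.2, one_mul, mul_left_comm _ (1 - M.γ),
    ← mul_sum, polAvg]

/-- After weighting by κ, the balance equation replaces γΣκPY by ΣκY - (1-γ)ΣrY, which leaves a full
(1-γ)‖u‖². The factor of J is γ times the flow into `s0` from the other states, again rewritten by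
balance. The source r may be signed, so that both ν and ν - γ^m · (law at time m) are allowed. -/
theorem two_mul_bform_ge [Nonempty A] (hπ : IsPolicy π) {ε : ℝ} (h0 : 0 ≤ ε) (h1 : ε ≤ 1)
    {κ r : S → ℝ} (hκ : ∀ s, 0 ≤ κ s)
    (hflow : ∀ s, M.γ * ∑ q, κ q * M.stateMatrix π q s = κ s - (1 - M.γ) * r s)
    (u : S × A → ℝ) {B : ℝ} (hB : ∀ s, polAvg π (fun z => u z ^ 2) s ≤ B) (s0 : S) {J : ℝ}
    (hJ : ∀ s, s ≠ s0 → ∀ a, 2 * u (s, a) * polAvg π u s0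
      ≤ u (s, a) ^ 2 + polAvg π (fun z => u z ^ 2) s0 - J) :
    (1 - M.γ) * (wNormSq (stWeight π ε κ) u
        + ε * ∑ s, κ s * polAvg (unif S A) (fun z => u z ^ 2) s
        + (1 - ε) * ∑ s, r s * polAvg π (fun z => u z ^ 2) s)
      + (1 - ε) * J * (κ s0 - (1 - M.γ) * r s0 - M.γ * κ s0 * M.stateMatrix π s0 s0)
      - ε * M.γ / 2 * (∑ s, κ s) * B
      ≤ 2 * M.bform π (stWeight π ε κ) u u := by
  rw [bform_stWeight, wNormSq_stWeight]
  set Y := polAvg π (fun z => u z ^ 2) with hY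
  set Yu := polAvg (unif S A) (fun z => u z ^ 2) with hYu
  have hε : 0 ≤ 1 - ε := by linarith
  have h := sum_le_sum fun s (_ : s ∈ univ) => mul_le_mul_of_nonneg_left
    (add_le_add (mul_le_mul_of_nonneg_left (M.polAvg_form_ge hπ u s0 hJ s) hε)
    (mul_le_mul_of_nonneg_left (M.unif_form_ge hπ u hB s) h0)) (hκ s)
  refine le_trans (le_of_eq ?_) (mul_le_mul_of_nonneg_left h zero_le_two)
  have e1 : M.γ * ∑ s, κ s * ∑ s', M.stateMatrix π s s' * Y s'
      = ∑ s, κ s * Y s - (1 - M.γ) * ∑ s, r s * Y s := by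
    have : ∑ s, κ s * ∑ s', M.stateMatrix π s s' * Y s'
        = ∑ s', (∑ s, κ s * M.stateMatrix π s s') * Y s' := by
      simp only [mul_sum, sum_mul]
      rw [sum_comm]
      exact sum_congr rfl fun _ _ => sum_congr rfl fun _ _ => by ring
    rw [this, mul_sum]
    simp only [← mul_assoc, hflow, sub_mul, sum_sub_distrib, mul_sum]
  have e2 : M.γ * ∑ s, κ s * (if s = s0 then 0 else M.stateMatrix π s s0)
      = κ s0 - (1 - M.γ) * r s0 - M.γ * κ s0 * M.stateMatrix π s0 s0 := by
    rw [← hflow s0, ← Finset.sum_erase_add univ _ (mem_univ s0),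
      ← Finset.sum_erase_add univ (fun q => κ q * M.stateMatrix π q s0) (mem_univ s0)]
    have : ∑ x ∈ univ.erase s0, κ x * (if x = s0 then 0 else M.stateMatrix π x s0)
        = ∑ x ∈ univ.erase s0, κ x * M.stateMatrix π x s0 :=
      sum_congr rfl fun x hx => by rw [if_neg (ne_of_mem_erase hx)]
    rw [this]
    simp only [if_true]
    ring
  have e3 : ∑ s, κ s * polAvg (perturbed π ε) (fun z => u z ^ 2) s
      = (1 - ε) * ∑ s, κ s * Y s + ε * ∑ s, κ s * Yu s := by
    simp only [polAvg_perturbed, ← hY, ← hYu, mul_sum, ← sum_add_distrib]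
    exact sum_congr rfl fun _ _ => by ring
  have e4 : ∑ s, κ s * ((1 - ε) * ((1 - M.γ / 2) * Y s
        - M.γ / 2 * ∑ s', M.stateMatrix π s s' * Y s'
        + M.γ / 2 * J * (if s = s0 then 0 else M.stateMatrix π s s0))
        + ε * ((1 - M.γ) * Yu s - M.γ / 4 * B))
      = (1 - ε) * (1 - M.γ / 2) * ∑ s, κ s * Y s
        - (1 - ε) / 2 * (M.γ * ∑ s, κ s * ∑ s', M.stateMatrix π s s' * Y s')
        + (1 - ε) / 2 * J * (M.γ * ∑ s, κ s * (if s = s0 then 0 else M.stateMatrix π s s0))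
        + ε * (1 - M.γ) * ∑ s, κ s * Yu s - ε * M.γ / 4 * B * ∑ s, κ s := by
    have : ∀ s, κ s * ((1 - ε) * ((1 - M.γ / 2) * Y s
        - M.γ / 2 * ∑ s', M.stateMatrix π s s' * Y s'
        + M.γ / 2 * J * (if s = s0 then 0 else M.stateMatrix π s s0))
        + ε * ((1 - M.γ) * Yu s - M.γ / 4 * B))
      = (1 - ε) * (1 - M.γ / 2) * (κ s * Y s)
        - (1 - ε) / 2 * M.γ * (κ s * ∑ s', M.stateMatrix π s s' * Y s')
        + (1 - ε) / 2 * J * M.γ * (κ s * (if s = s0 then 0 else M.stateMatrix π s s0))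
        + ε * (1 - M.γ) * (κ s * Yu s) - ε * M.γ / 4 * B * κ s := fun s => by ring
    simp only [this, sum_add_distrib, sum_sub_distrib, ← mul_sum]
    ring
  rw [e3, e4, e1, e2]
  ring

/-- Second moment of the temporal difference along the transitions. -/
theorem transSum_sq_eq (hπ : IsPolicy π) (w u : S × A → ℝ) :
    M.transSum π w (fun z z' => (u z - M.γ * u z') ^ 2)
      = 2 * M.bform π w u u - wNormSq w u + M.γ ^ 2 * M.transSum π w (fun _ z' => u z' ^ 2) := by
  have h : ∀ z, ∑ z', w z * M.pairMatrix π z z' * (u z - M.γ * u z') ^ 2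
      = 2 * (w z * (u z * (u z - M.γ * (M.pairMatrix π).mulVec u z))) - w z * u z ^ 2
        + M.γ ^ 2 * ∑ z', w z * M.pairMatrix π z z' * u z' ^ 2 := by
    intro z
    have : ∀ z', w z * M.pairMatrix π z z' * (u z - M.γ * u z') ^ 2
        = M.pairMatrix π z z' * (w z * u z ^ 2)
          - 2 * M.γ * w z * u z * (M.pairMatrix π z z' * u z')
          + M.γ ^ 2 * (w z * M.pairMatrix π z z' * u z' ^ 2) := fun z' => by ring
    simp only [this, sum_add_distrib, sum_sub_distrib, ← sum_mul, ← mul_sum, M.pairMatrix_sum hπ]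
    simp only [Matrix.mulVec, dotProduct]
    ring
  simp only [transSum, bform, wNormSq, h, sum_add_distrib, sum_sub_distrib, ← mul_sum]

theorem transSum_next (π : S → A → ℝ) (ε : ℝ) (κ : S → ℝ) (h : S × A → ℝ) :
    M.transSum π (stWeight π ε κ) (fun _ z' => h z')
      = (1 - ε) * ∑ s, κ s * ∑ s', M.stateMatrix π s s' * polAvg π h s'
        + ε * ∑ s, κ s * ∑ s', M.stateMatrix (unif S A) s s' * polAvg π h s' := by
  have h1 : ∀ z, ∑ z', stWeight π ε κ z * M.pairMatrix π z z' * h z'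
      = stWeight π ε κ z * ∑ s', M.P z.1 z.2 s' * polAvg π h s' := fun z => by
    rw [← pairMatrix_mulVec]
    simp only [Matrix.mulVec, dotProduct, mul_sum, mul_assoc]
  simp only [transSum, h1]
  rw [sum_stWeight_mul π ε κ fun z => ∑ s', M.P z.1 z.2 s' * polAvg π h s']
  simp only [polAvg_perturbed]
  simp only [M.polAvg_sum_P, mul_add, sum_add_distrib, mul_left_comm (κ _), ← mul_sum]

/-- Under π, one step multiplies the weighted mass by at most 1/γ, again by balance; the exploratory
part is bounded by the maximum B. With `transSum_sq_eq` this controls the variance of the updates by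
the form. -/
theorem gamma_transSum_next_le [Nonempty A] {ε : ℝ} (h0 : 0 ≤ ε)
    {κ r : S → ℝ} (hκ : ∀ s, 0 ≤ κ s) (hκ1 : ∑ s, κ s ≤ 1)
    (hflow : ∀ s, M.γ * ∑ q, κ q * M.stateMatrix π q s = κ s - (1 - M.γ) * r s)
    (u : S × A → ℝ) {B : ℝ} (hB : ∀ s, polAvg π (fun z => u z ^ 2) s ≤ B) (hB0 : 0 ≤ B) :
    M.γ * M.transSum π (stWeight π ε κ) (fun _ z' => u z' ^ 2)
      ≤ wNormSq (stWeight π ε κ) u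
        - (1 - ε) * (1 - M.γ) * ∑ s, r s * polAvg π (fun z => u z ^ 2) s + ε * M.γ * B := by
  set Y := polAvg π (fun z => u z ^ 2) with hY
  have hYu : 0 ≤ ∑ s, κ s * polAvg (unif S A) (fun z => u z ^ 2) s :=
    sum_nonneg fun s _ => mul_nonneg (hκ s) (unif_isPolicy.polAvg_nonneg (fun _ => sq_nonneg _) s)
  have e3 : wNormSq (stWeight π ε κ) u = (1 - ε) * ∑ s, κ s * Y s
      + ε * ∑ s, κ s * polAvg (unif S A) (fun z => u z ^ 2) s := by
    simp only [wNormSq_stWeight, polAvg_perturbed, ← hY, mul_sum, ← sum_add_distrib]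
    exact sum_congr rfl fun _ _ => by ring
  have e1 : M.γ * ∑ s, κ s * ∑ s', M.stateMatrix π s s' * Y s'
      = ∑ s, κ s * Y s - (1 - M.γ) * ∑ s, r s * Y s := by
    have : ∑ s, κ s * ∑ s', M.stateMatrix π s s' * Y s'
        = ∑ s', (∑ s, κ s * M.stateMatrix π s s') * Y s' := by
      simp only [mul_sum, sum_mul]
      rw [sum_comm]
      exact sum_congr rfl fun _ _ => sum_congr rfl fun _ _ => by ring
    rw [this, mul_sum]
    simp only [← mul_assoc, hflow, sub_mul, sum_sub_distrib, mul_sum]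
  have e2 : ∑ s, κ s * ∑ s', M.stateMatrix (unif S A) s s' * Y s' ≤ B :=
    calc _ ≤ ∑ s, κ s * B := sum_le_sum fun s _ => mul_le_mul_of_nonneg_left
          (IsProbVec.sum_mul_le ⟨M.stateMatrix_nonneg unif_isPolicy s,
            M.stateMatrix_sum unif_isPolicy s⟩ hB) (hκ s)
      _ ≤ B := by rw [← sum_mul]; exact mul_le_of_le_one_left hB0 hκ1
  rw [transSum_next, e3, ← hY]
  have := mul_le_mul_of_nonneg_left e2 (mul_nonneg h0 M.γ_nonneg)
  nlinarith [mul_nonneg h0 hYu]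

end MDP

/-! ### Coercivity of the full form, and of the truncated form for a small tail -/

namespace MDP

variable {S A : Type*} [Fintype S] [Fintype A] [DecidableEq S] (M : MDP S A)
variable {π : S → A → ℝ}

theorem exists_max_polAvg [Nonempty S] (π : S → A → ℝ) (u : S × A → ℝ) :
    ∃ s1, ∀ s, polAvg π (fun z => u z ^ 2) s ≤ polAvg π (fun z => u z ^ 2) s1 := by
  obtain ⟨s1, -, h⟩ := exists_max_image univ (polAvg π (fun z => u z ^ 2)) univ_nonempty
  exact ⟨s1, fun s => h s (mem_univ s)⟩

theorem wNormSq_nonneg {Z : Type*} [Fintype Z] {w : Z → ℝ} (hw : ∀ z, 0 ≤ w z) (u : Z → ℝ) :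
    0 ≤ wNormSq w u := sum_nonneg fun z _ => mul_nonneg (hw z) (sq_nonneg _)

theorem stWeight_nonneg [Nonempty A] (hπ : IsPolicy π) {ε : ℝ} (h0 : 0 ≤ ε) (h1 : ε ≤ 1)
    {κ : S → ℝ} (hκ : ∀ s, 0 ≤ κ s) (z : S × A) : 0 ≤ stWeight π ε κ z :=
  mul_nonneg (hκ _) ((perturbed_isPolicy hπ h0 h1).1 _ _)

/-- The part of the weighted norm that comes from a single state. -/
theorem single_le_wNormSq [Nonempty A] (hπ : IsPolicy π) {ε : ℝ} (h0 : 0 ≤ ε) (h1 : ε ≤ 1)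
    {κ : S → ℝ} (hκ : ∀ s, 0 ≤ κ s) (u : S × A → ℝ) (s : S) :
    (1 - ε) * (κ s * polAvg π (fun z => u z ^ 2) s) ≤ wNormSq (stWeight π ε κ) u := by
  have hp := perturbed_isPolicy hπ h0 h1
  rw [wNormSq_stWeight]
  refine le_trans ?_ (single_le_sum (fun s _ => mul_nonneg (hκ s)
    (hp.polAvg_nonneg (fun _ => sq_nonneg _) s)) (mem_univ s))
  rw [polAvg_perturbed]
  have := mul_nonneg (hκ s) (mul_nonneg h0
    ((unif_isPolicy (S := S) (A := A)).polAvg_nonneg (fun z => sq_nonneg (u z)) s))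
  nlinarith

/-- The exploration error is small compared with the weighted norm. -/
theorem exploration_le [Nonempty A] (hπ : IsPolicy π) {ε : ℝ} (h0 : 0 ≤ ε) (h1 : ε < 1)
    {κ : S → ℝ} (hκ : ∀ s, 0 ≤ κ s) (hε : ∀ s, ε ≤ (1 - M.γ) * κ s / 4) (u : S × A → ℝ) (s : S) :
    ε * polAvg π (fun z => u z ^ 2) s
      ≤ (1 - M.γ) * wNormSq (stWeight π ε κ) u / (4 * (1 - ε)) := by
  have h := single_le_wNormSq hπ h0 h1.le hκ u s
  have hY := hπ.polAvg_nonneg (fun z => sq_nonneg (u z)) s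
  rw [le_div_iff₀ (by linarith)]
  have h2 := mul_le_mul_of_nonneg_right (hε s) hY
  have h3 := mul_le_mul_of_nonneg_left h M.one_sub_γ_pos.le
  nlinarith

/-- Summing the exploration condition over all states. The more states there are, the smaller ε must
be: the two- and three-state cases use ε ≤ (1-γ)/8 and ε ≤ 1/12. -/
theorem card_mul_eps_le {ε : ℝ} {κ : S → ℝ} (hκ : ∑ s, κ s = 1)
    (hε : ∀ s, ε ≤ (1 - M.γ) * κ s / 4) : (Fintype.card S : ℝ) * ε ≤ (1 - M.γ) / 4 := by
  have h := sum_le_sum fun s (_ : s ∈ univ) => hε s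
  rw [sum_const, card_univ, nsmul_eq_mul, ← sum_div, ← mul_sum, hκ] at h
  linarith

theorem eps_le [Nonempty S] {ε : ℝ} (h0 : 0 ≤ ε) {κ : S → ℝ} (hκ : ∑ s, κ s = 1)
    (hε : ∀ s, ε ≤ (1 - M.γ) * κ s / 4) : ε ≤ (1 - M.γ) / 4 := by
  have h := M.card_mul_eps_le hκ hε
  have : (1 : ℝ) ≤ Fintype.card S := by exact_mod_cast Fintype.card_pos
  nlinarith

variable [Nonempty A] [Nonempty S]

/-- The full form is coercive. -/
theorem bform_disc_ge (hπ : IsPolicy π) {ε : ℝ} (h0 : 0 ≤ ε) {ν : S → ℝ} (hν : IsProbVec ν)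
    (hε : ∀ s, ε ≤ (1 - M.γ) * M.disc π ν s / 4) (u : S × A → ℝ) :
    (1 - M.γ) / 3 * wNormSq (stWeight π ε (M.disc π ν)) u
      ≤ M.bform π (stWeight π ε (M.disc π ν)) u u := by
  have hκ := M.disc_isProbVec hπ hν
  have hx := M.one_sub_γ_pos
  have hε4 := M.eps_le h0 hκ.2 hε
  have hγ := M.γ_nonneg
  obtain ⟨s1, hs1⟩ := exists_max_polAvg π u
  have h := M.two_mul_bform_ge hπ h0 (by linarith) hκ.1 (M.disc_flow hπ hν) u hs1 s1 (J := 0)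
    fun s _ a => by
      nlinarith [hπ.sq_polAvg_le u s1, sq_nonneg (u (s, a) - polAvg π u s1)]
  have hW := wNormSq_nonneg (stWeight_nonneg hπ h0 (by linarith) hκ.1) u
  have hB := M.exploration_le hπ h0 (by linarith) hκ.1 hε u s1
  -- ε ≤ 1/4, hence 4(1-ε) ≥ 3. The exploration loss is then at most a sixth of (1-γ)‖u‖².
  have hB' : (1 - M.γ) * wNormSq (stWeight π ε (M.disc π ν)) u / (4 * (1 - ε))
      ≤ (1 - M.γ) * wNormSq (stWeight π ε (M.disc π ν)) u / 3 :=
    div_le_div_of_nonneg_left (mul_nonneg hx.le hW) (by norm_num) (by linarith)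
  have h1 : 0 ≤ ∑ s, M.disc π ν s * polAvg (unif S A) (fun z => u z ^ 2) s :=
    sum_nonneg fun s _ => mul_nonneg (hκ.1 s) (unif_isPolicy.polAvg_nonneg (fun _ => sq_nonneg _) s)
  have h2 : 0 ≤ ∑ s, ν s * polAvg π (fun z => u z ^ 2) s :=
    sum_nonneg fun s _ => mul_nonneg (hν.1 s) (hπ.polAvg_nonneg (fun _ => sq_nonneg _) s)
  rw [hκ.2] at h
  have h3 : ε * M.γ / 2 * 1 * polAvg π (fun z => u z ^ 2) s1
      ≤ ε * polAvg π (fun z => u z ^ 2) s1 / 2 := by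
    nlinarith [mul_nonneg h0 (hπ.polAvg_nonneg (fun z => sq_nonneg (u z)) s1)]
  have h4 := mul_nonneg hx.le (mul_nonneg h0 h1)
  have h5 := mul_nonneg hx.le (mul_nonneg (by linarith : 0 ≤ 1 - ε) h2)
  nlinarith

/-- The second moment of the temporal difference is at most twice the form. -/
theorem transSum_sq_disc_le (hπ : IsPolicy π) {ε : ℝ} (h0 : 0 ≤ ε) {ν : S → ℝ}
    (hν : IsProbVec ν) (hε : ∀ s, ε ≤ (1 - M.γ) * M.disc π ν s / 4) (u : S × A → ℝ) :
    M.transSum π (stWeight π ε (M.disc π ν)) (fun z z' => (u z - M.γ * u z') ^ 2)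
      ≤ 2 * M.bform π (stWeight π ε (M.disc π ν)) u u := by
  have hκ := M.disc_isProbVec hπ hν
  have hx := M.one_sub_γ_pos
  have hε4 := M.eps_le h0 hκ.2 hε
  have hγ := M.γ_nonneg
  obtain ⟨s1, hs1⟩ := exists_max_polAvg π u
  have hB0 := hπ.polAvg_nonneg (fun z => sq_nonneg (u z)) s1
  have hW := wNormSq_nonneg (stWeight_nonneg hπ h0 (by linarith) hκ.1) u
  have hB := M.exploration_le hπ h0 (by linarith) hκ.1 hε u s1
  have hB' : (1 - M.γ) * wNormSq (stWeight π ε (M.disc π ν)) u / (4 * (1 - ε))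
      ≤ (1 - M.γ) * wNormSq (stWeight π ε (M.disc π ν)) u / 3 :=
    div_le_div_of_nonneg_left (mul_nonneg hx.le hW) (by norm_num) (by linarith)
  have h := M.gamma_transSum_next_le h0 hκ.1 hκ.2.le (M.disc_flow hπ hν) u hs1 hB0
  have h2 : 0 ≤ ∑ s, ν s * polAvg π (fun z => u z ^ 2) s :=
    sum_nonneg fun s _ => mul_nonneg (hν.1 s) (hπ.polAvg_nonneg (fun _ => sq_nonneg _) s)
  have h5 := mul_nonneg (mul_nonneg (by linarith : 0 ≤ 1 - ε) hx.le) h2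
  rw [M.transSum_sq_eq hπ]
  have h6 := mul_le_mul_of_nonneg_left h hγ
  have h7 : ε * M.γ * polAvg π (fun z => u z ^ 2) s1 ≤ ε * polAvg π (fun z => u z ^ 2) s1 := by
    nlinarith [mul_nonneg h0 hB0]
  have h8 := mul_nonneg h0 hB0
  nlinarith

/-- Weight lost by the truncation. -/
theorem wNormSq_truncDisc (hπ : IsPolicy π) (ε : ℝ) {ν : S → ℝ} (hν : IsProbVec ν) (m : ℕ)
    (u : S × A → ℝ) :
    wNormSq (stWeight π ε (M.disc π ν)) u = wNormSq (stWeight π ε (M.truncDisc π ν m)) u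
      + M.γ ^ m * wNormSq (stWeight π ε (M.disc π (M.occ π ν m))) u := by
  simp only [wNormSq_stWeight, M.disc_eq_truncDisc_add hπ hν m, add_mul, sum_add_distrib, mul_assoc,
    ← mul_sum]

theorem wNormSq_le_of_sq_le (hπ : IsPolicy π) {ε : ℝ} (h0 : 0 ≤ ε) (h1 : ε ≤ 1) {κ : S → ℝ}
    (hκ : IsProbVec κ) {u : S × A → ℝ} {p : ℝ} (hu : ∀ z, u z ^ 2 ≤ p) :
    wNormSq (stWeight π ε κ) u ≤ p := by
  rw [wNormSq_stWeight]
  exact hκ.sum_mul_le fun s => (perturbed_isPolicy hπ h0 h1).polAvg_le fun a => hu (s, a)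

/-- Lower bound of the truncated form. -/
theorem two_mul_bform_truncDisc_ge (hπ : IsPolicy π) {ε : ℝ} (h0 : 0 ≤ ε) {ν : S → ℝ}
    (hν : IsProbVec ν) (hε : ∀ s, ε ≤ (1 - M.γ) * M.disc π ν s / 4) (m : ℕ) (u : S × A → ℝ)
    (s0 : S) {J : ℝ} (hJ : ∀ s, s ≠ s0 → ∀ a, 2 * u (s, a) * polAvg π u s0
      ≤ u (s, a) ^ 2 + polAvg π (fun z => u z ^ 2) s0 - J) :
    (1 - M.γ) * (wNormSq (stWeight π ε (M.truncDisc π ν m)) u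
        + ε * ∑ s, M.truncDisc π ν m s * polAvg (unif S A) (fun z => u z ^ 2) s
        + (1 - ε) * (∑ s, ν s * polAvg π (fun z => u z ^ 2) s
          - M.γ ^ m * ∑ s, M.occ π ν m s * polAvg π (fun z => u z ^ 2) s))
      + (1 - ε) * J * (M.truncDisc π ν m s0 - (1 - M.γ) * (ν s0 - M.γ ^ m * M.occ π ν m s0)
          - M.γ * M.truncDisc π ν m s0 * M.stateMatrix π s0 s0)
      - M.γ * (1 - M.γ ^ m) * ((1 - M.γ) * wNormSq (stWeight π ε (M.disc π ν)) u / (8 * (1 - ε)))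
      ≤ 2 * M.bform π (stWeight π ε (M.truncDisc π ν m)) u u := by
  have hκ := M.disc_isProbVec hπ hν
  have hx := M.one_sub_γ_pos
  have hγ := M.γ_nonneg
  have hε4 := M.eps_le h0 hκ.2 hε
  obtain ⟨s1, hs1⟩ := exists_max_polAvg π u
  have h := M.two_mul_bform_ge hπ h0 (by linarith) (M.truncDisc_nonneg hπ hν m)
    (M.truncDisc_flow π ν m) u hs1 s0 hJ
  have hB := M.exploration_le hπ h0 (by linarith) hκ.1 hε u s1
  rw [M.truncDisc_sum hπ hν] at h
  have hG : M.γ ^ m ≤ 1 := pow_le_one₀ hγ M.γ_lt_one.le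
  simp only [sub_mul _ _ (polAvg π _ _), sum_sub_distrib, mul_assoc (M.γ ^ m), ← mul_sum] at h
  refine le_trans (sub_le_sub_left ?_ _) h
  have e : (1 - M.γ) * wNormSq (stWeight π ε (M.disc π ν)) u / (8 * (1 - ε))
      = (1 - M.γ) * wNormSq (stWeight π ε (M.disc π ν)) u / (4 * (1 - ε)) / 2 := by
    have : (1 - ε) ≠ 0 := by linarith
    field_simp
    ring
  rw [e]
  have := mul_le_mul_of_nonneg_left hB (mul_nonneg hγ (by linarith : 0 ≤ 1 - M.γ ^ m))
  nlinarith

/-- Truncation loses mass γ^m twice: in the norm, where u² ≤ p enters, and in the balance equation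
at time m, where only π-averages enter. Keeping p and c apart matters when they sum to 1. -/
theorem two_mul_bform_truncDisc_ge_of_sq_le (hπ : IsPolicy π) {ε : ℝ} (h0 : 0 ≤ ε) {ν : S → ℝ}
    (hν : IsProbVec ν) (hε : ∀ s, ε ≤ (1 - M.γ) * M.disc π ν s / 4) (m : ℕ) {u : S × A → ℝ}
    {p c : ℝ} (hu : ∀ z, u z ^ 2 ≤ p) (hc : ∀ s, polAvg π (fun z => u z ^ 2) s ≤ c) :
    (1 - M.γ) * (wNormSq (stWeight π ε (M.disc π ν)) u * (1 - 1 / (8 * (1 - ε)))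
        - M.γ ^ m * (p + c))
      ≤ 2 * M.bform π (stWeight π ε (M.truncDisc π ν m)) u u := by
  have hκ := M.disc_isProbVec hπ hν
  have hx := M.one_sub_γ_pos
  have hγ := M.γ_nonneg
  have hε4 := M.eps_le h0 hκ.2 hε
  have hε1 : 0 < 1 - ε := by linarith
  have hG : M.γ ^ m ≤ 1 := pow_le_one₀ hγ M.γ_lt_one.le
  have hG0 : 0 ≤ M.γ ^ m := pow_nonneg hγ m
  obtain ⟨s1, hs1⟩ := exists_max_polAvg π u
  have h := M.two_mul_bform_truncDisc_ge hπ h0 hν hε m u s1 (J := 0)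
    fun s _ a => by
      nlinarith [hπ.sq_polAvg_le u s1, sq_nonneg (u (s, a) - polAvg π u s1)]
  refine le_trans ?_ h
  have hW := wNormSq_nonneg (stWeight_nonneg hπ h0 (by linarith) hκ.1) u
  have ht := M.wNormSq_truncDisc hπ ε hν m u
  have ho := M.occ_isProbVec hπ hν m
  have h1 := wNormSq_le_of_sq_le hπ h0 (by linarith : ε ≤ 1) (M.disc_isProbVec hπ ho) hu
  have h2 := ho.sum_mul_le hc
  have h3 : 0 ≤ ∑ s, M.truncDisc π ν m s * polAvg (unif S A) (fun z => u z ^ 2) s :=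
    sum_nonneg fun s _ => mul_nonneg (M.truncDisc_nonneg hπ hν m s)
      (unif_isPolicy.polAvg_nonneg (fun _ => sq_nonneg _) s)
  have h4 : 0 ≤ ∑ s, ν s * polAvg π (fun z => u z ^ 2) s :=
    sum_nonneg fun s _ => mul_nonneg (hν.1 s) (hπ.polAvg_nonneg (fun _ => sq_nonneg _) s)
  have h5 : 0 ≤ ∑ s, M.occ π ν m s * polAvg π (fun z => u z ^ 2) s :=
    sum_nonneg fun s _ => mul_nonneg (ho.1 s) (hπ.polAvg_nonneg (fun _ => sq_nonneg _) s)
  set W := wNormSq (stWeight π ε (M.disc π ν)) u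
  have h6 : M.γ * (1 - M.γ ^ m) * ((1 - M.γ) * W / (8 * (1 - ε)))
      ≤ (1 - M.γ) * W / (8 * (1 - ε)) := by
    refine mul_le_of_le_one_left (by positivity) ?_
    nlinarith [M.γ_lt_one]
  have h7 : (1 - M.γ) * (W * (1 / (8 * (1 - ε)))) = (1 - M.γ) * W / (8 * (1 - ε)) := by ring
  have h8 := mul_le_mul_of_nonneg_left h1 hG0
  have h9 := mul_le_mul_of_nonneg_left h2 hG0
  have h10 : (1 - ε) * (M.γ ^ m * ∑ s, M.occ π ν m s * polAvg π (fun z => u z ^ 2) s)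
      ≤ M.γ ^ m * c := (mul_le_of_le_one_left (mul_nonneg hG0 h5) (by linarith)).trans h9
  have h11 : W - M.γ ^ m * (p + c) ≤ wNormSq (stWeight π ε (M.truncDisc π ν m)) u
        + ε * ∑ s, M.truncDisc π ν m s * polAvg (unif S A) (fun z => u z ^ 2) s
        + (1 - ε) * (∑ s, ν s * polAvg π (fun z => u z ^ 2) s
          - M.γ ^ m * ∑ s, M.occ π ν m s * polAvg π (fun z => u z ^ 2) s) := by
    have := mul_nonneg h0 h3
    have := mul_nonneg hε1.le h4
    linarith
  have h12 := mul_le_mul_of_nonneg_left h11 hx.le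
  linarith

/-- The truncated analogue of `transSum_sq_disc_le`. The missing tail and the exploration error are
no longer absorbed into the norm and appear as an additive term with the factor 1-γ. -/
theorem transSum_sq_truncDisc_le (hπ : IsPolicy π) {ε : ℝ} (h0 : 0 ≤ ε) {ν : S → ℝ}
    (hν : IsProbVec ν) (hε : ∀ s, ε ≤ (1 - M.γ) * M.disc π ν s / 4) (m : ℕ) {u : S × A → ℝ}
    {U : ℝ} (hu : ∀ z, u z ^ 2 ≤ U) :
    M.transSum π (stWeight π ε (M.truncDisc π ν m)) (fun z z' => (u z - M.γ * u z') ^ 2)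
      ≤ 2 * M.bform π (stWeight π ε (M.truncDisc π ν m)) u u
        + (1 - M.γ) * (M.γ ^ m * U + wNormSq (stWeight π ε (M.disc π ν)) u / (4 * (1 - ε))) := by
  have hκ := M.disc_isProbVec hπ hν
  have hx := M.one_sub_γ_pos
  have hε4 := M.eps_le h0 hκ.2 hε
  have hγ := M.γ_nonneg
  have hγ1 := M.γ_lt_one
  have hG0 : 0 ≤ M.γ ^ m := pow_nonneg hγ m
  have hG : M.γ ^ m ≤ 1 := pow_le_one₀ hγ M.γ_lt_one.le
  have hκm := M.truncDisc_nonneg hπ hν m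
  obtain ⟨s1, hs1⟩ := exists_max_polAvg π u
  have hB0 := hπ.polAvg_nonneg (fun z => sq_nonneg (u z)) s1
  have hW := wNormSq_nonneg (stWeight_nonneg hπ h0 (by linarith) hκm) u
  have hB := M.exploration_le hπ h0 (by linarith) hκ.1 hε u s1
  have h := M.gamma_transSum_next_le h0 hκm
    (by rw [M.truncDisc_sum hπ hν]; linarith) (M.truncDisc_flow π ν m) u hs1 hB0
  simp only [sub_mul _ _ (polAvg π _ _), sum_sub_distrib, mul_assoc (M.γ ^ m), ← mul_sum] at h
  have h2 : 0 ≤ ∑ s, ν s * polAvg π (fun z => u z ^ 2) s :=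
    sum_nonneg fun s _ => mul_nonneg (hν.1 s) (hπ.polAvg_nonneg (fun _ => sq_nonneg _) s)
  have ho := M.occ_isProbVec hπ hν m
  have h3 := mul_le_mul_of_nonneg_left
    (ho.sum_mul_le fun s => hπ.polAvg_le (h := fun z => u z ^ 2) (s := s) fun a => hu (s, a)) hG0
  have hU : 0 ≤ M.γ ^ m * U :=
    mul_nonneg hG0 ((sq_nonneg _).trans (hu (s1, Classical.arbitrary A)))
  have h5 := mul_nonneg (mul_nonneg (by linarith : 0 ≤ 1 - ε) hx.le) h2
  rw [M.transSum_sq_eq hπ]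
  have h4 := mul_le_mul_of_nonneg_left h3 (mul_nonneg (by linarith : 0 ≤ 1 - ε) hx.le)
  have h6 : (1 - ε) * (1 - M.γ) * (M.γ ^ m * U) ≤ (1 - M.γ) * (M.γ ^ m * U) := by
    nlinarith [mul_nonneg h0 (mul_nonneg hx.le hU)]
  have h7 : ε * M.γ * polAvg π (fun z => u z ^ 2) s1 ≤ ε * polAvg π (fun z => u z ^ 2) s1 := by
    nlinarith [mul_nonneg h0 hB0]
  have h8 : M.γ * M.transSum π (stWeight π ε (M.truncDisc π ν m)) (fun _ z' => u z' ^ 2)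
      ≤ wNormSq (stWeight π ε (M.truncDisc π ν m)) u + (1 - M.γ) * (M.γ ^ m * U
        + wNormSq (stWeight π ε (M.disc π ν)) u / (4 * (1 - ε))) := by
    rw [mul_add, ← mul_div_assoc]
    linarith
  have h9 : 0 ≤ (1 - M.γ) * (M.γ ^ m * U
        + wNormSq (stWeight π ε (M.disc π ν)) u / (4 * (1 - ε))) := by
    have := wNormSq_nonneg (stWeight_nonneg hπ h0 (by linarith) hκ.1) u
    have : 0 ≤ 1 - ε := by linarith
    positivity
  have h10 := mul_le_mul_of_nonneg_left h8 hγ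
  nlinarith

/-- Coercivity of the truncated form when the truncated mass is small. -/
theorem bform_truncDisc_ge_of_small (hπ : IsPolicy π) {ε : ℝ} (h0 : 0 ≤ ε) {ν : S → ℝ}
    (hν : IsProbVec ν) (hε : ∀ s, ε ≤ (1 - M.γ) * M.disc π ν s / 4) (m : ℕ) {u : S × A → ℝ}
    {U : ℝ} (hu : ∀ z, u z ^ 2 ≤ U)
    (hU : 8 * (M.γ ^ m * U) ≤ wNormSq (stWeight π ε (M.disc π ν)) u) :
    (1 - M.γ) / 4 * wNormSq (stWeight π ε (M.disc π ν)) u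
      ≤ M.bform π (stWeight π ε (M.truncDisc π ν m)) u u := by
  have hκ := M.disc_isProbVec hπ hν
  have hx := M.one_sub_γ_pos
  have hε4 := M.eps_le h0 hκ.2 hε
  have hγ := M.γ_nonneg
  have hU0 : 0 ≤ U := (sq_nonneg _).trans (hu (Classical.arbitrary S, Classical.arbitrary A))
  have h := M.two_mul_bform_truncDisc_ge_of_sq_le hπ h0 hν hε m hu
    (fun s => hπ.polAvg_le (h := fun z => u z ^ 2) (s := s) fun a => hu (s, a))
  have hW := wNormSq_nonneg (stWeight_nonneg hπ h0 (by linarith) hκ.1) u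
  have h1 : 1 / (8 * (1 - ε)) ≤ 1 / 6 :=
    one_div_le_one_div_of_le (by norm_num) (by linarith)
  have h2 := mul_le_mul_of_nonneg_left h1 hW
  have h3 : wNormSq (stWeight π ε (M.disc π ν)) u / 2
      ≤ wNormSq (stWeight π ε (M.disc π ν)) u * (1 - 1 / (8 * (1 - ε)))
        - M.γ ^ m * (U + U) := by nlinarith
  have h4 := mul_le_mul_of_nonneg_left h3 hx.le
  linarith

end MDP

/-! ### Numerical inequalities for a chain with two states -/

section TwoStates

/-- Young's inequality 2bc ≤ τb² + c²/τ makes the expression linear in b² and c². By the sign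
condition `hB` the worst point is then b² = p, c² = 1-p. The optimal τ is c/b. -/
theorem quad_nonneg_of_tangent {A B C p b c τ : ℝ} (hA : 0 ≤ A) (hτ0 : 0 < τ) (hτ1 : τ ≤ 1)
    (hB : A * (1 - τ) ≤ B) (hb : b ^ 2 ≤ p) (hc : c ^ 2 ≤ 1 - p)
    (h : 0 ≤ A * (1 - τ) * τ * p - B * τ * p - A * (1 - τ) * (1 - p) + C * τ) :
    0 ≤ A * (b - c) ^ 2 - B * b ^ 2 + C := by
  have h1 : (1 - τ) * τ * b ^ 2 - (1 - τ) * c ^ 2 ≤ τ * (b - c) ^ 2 := by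
    nlinarith [sq_nonneg (τ * b - c)]
  have h2 := mul_le_mul_of_nonneg_left h1 hA
  have h3 := mul_le_mul_of_nonneg_left hc (mul_nonneg hA (by linarith : 0 ≤ 1 - τ))
  have h4 := mul_le_mul_of_nonneg_left hb (mul_nonneg (by linarith : 0 ≤ B - A * (1 - τ)) hτ0.le)
  refine (mul_nonneg_iff_of_pos_left hτ0).1 ?_
  nlinarith

variable {r p b c : ℝ}

/-- Here r stands for √2. The inequality gives a surplus v = 0.163 in `two_state_scale` from the
jump (b-c)² alone, with N = φ = 0. For p ≤ 0.6 the term r - p already suffices. -/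
theorem two_state_gain (hr : 1.4142 ≤ r) (hr' : r ≤ 1.4143) (hp : 0 ≤ p) (hb : b ^ 2 ≤ p)
    (hc : c ^ 2 ≤ 1 - p) :
    0 ≤ r * (b - c) ^ 2 - p * b ^ 2 + ((r - 0.163) * p - p ^ 2) := by
  have hp1 : p ≤ 1 := by nlinarith [sq_nonneg c]
  rcases le_total p 0.6 with h | h
  · nlinarith [mul_nonneg (by linarith : 0 ≤ r) (sq_nonneg (b - c)), mul_le_mul_of_nonneg_left hb hp]
  rcases le_total p 0.85 with h' | h'
  -- 1.31 - p roughly follows the optimal √((1-p)/p) on this range.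
  · refine quad_nonneg_of_tangent (τ := 1.31 - p) (by linarith) (by linarith) (by linarith)
      (by nlinarith) hb hc ?_
    nlinarith [mul_nonneg (by linarith : 0 ≤ p) (sq_nonneg (p - 0.77)), sq_nonneg (p - 0.77),
      mul_nonneg (by linarith : 0 ≤ 1 - p) (sq_nonneg (p - 0.77))]
  · refine quad_nonneg_of_tangent (τ := 0.45) (by linarith) (by norm_num) (by norm_num)
      (by nlinarith) hb hc ?_
    nlinarith [mul_nonneg (by linarith : 0 ≤ p - 0.85) (by linarith : 0 ≤ 1 - p)]

/-- The surplus rises to 0.2 when the normalised outflow φ of the large state is at least 0.3G; that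
is the term 0.3p. -/
theorem two_state_gain_flow (hr : 1.4142 ≤ r) (hr' : r ≤ 1.4143) (hp : 0 ≤ p) (hb : b ^ 2 ≤ p)
    (hc : c ^ 2 ≤ 1 - p) :
    0 ≤ (r + 0.3 * p) * (b - c) ^ 2 - p * b ^ 2 + ((r - 0.2) * p - p ^ 2) := by
  have hp1 : p ≤ 1 := by nlinarith [sq_nonneg c]
  rcases le_total p 0.6 with h | h
  · nlinarith [mul_nonneg (by linarith : 0 ≤ r + 0.3 * p) (sq_nonneg (b - c)),
      mul_le_mul_of_nonneg_left hb hp]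
  rcases le_total p 0.78 with h' | h'
  · refine quad_nonneg_of_tangent (τ := 1.31 - p) (by linarith) (by linarith) (by linarith)
      (by nlinarith) hb hc ?_
    nlinarith [mul_nonneg (by linarith : 0 ≤ p) (sq_nonneg (p - 0.71)), sq_nonneg (p - 0.71),
      mul_nonneg (by linarith : 0 ≤ 1 - p) (sq_nonneg (p - 0.71)),
      mul_nonneg (mul_nonneg hp hp) (sq_nonneg (p - 0.71))]
  rcases le_total p 0.85 with h'' | h''
  · refine quad_nonneg_of_tangent (τ := 0.55) (by linarith) (by norm_num) (by norm_num)
      (by nlinarith) hb hc ?_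
    nlinarith [mul_nonneg (by linarith : 0 ≤ p - 0.78) (by linarith : 0 ≤ 0.85 - p)]
  · refine quad_nonneg_of_tangent (τ := 0.5) (by linarith) (by norm_num) (by norm_num)
      (by nlinarith) hb hc ?_
    nlinarith [mul_nonneg (by linarith : 0 ≤ p - 0.85) (by linarith : 0 ≤ 1 - p)]

/-- The surplus rises to 0.2 when a fraction N ≥ 0.07 of the mass started in the small state never
leaves it, since the boundary loss then carries the factor 1 - N ≤ 0.93. -/
theorem two_state_gain_stay (hr : 1.4142 ≤ r) (hr' : r ≤ 1.4143) (hp : 0 ≤ p) (hb : b ^ 2 ≤ p)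
    (hc : c ^ 2 ≤ 1 - p) :
    0 ≤ (r - 0.07 * p) * (b - c) ^ 2 - 0.93 * p * b ^ 2 + ((r - 0.2) * p - p ^ 2) := by
  have hp1 : p ≤ 1 := by nlinarith [sq_nonneg c]
  rcases le_total p 0.6 with h | h
  · nlinarith [mul_nonneg (by linarith : 0 ≤ r - 0.07 * p) (sq_nonneg (b - c)),
      mul_le_mul_of_nonneg_left hb hp]
  rcases le_total p 0.85 with h' | h'
  · refine quad_nonneg_of_tangent (τ := 1.31 - p) (by linarith) (by linarith) (by linarith)
      (by nlinarith) hb hc ?_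
    nlinarith [mul_nonneg (by linarith : 0 ≤ p) (sq_nonneg (p - 0.77)), sq_nonneg (p - 0.77),
      mul_nonneg (by linarith : 0 ≤ 1 - p) (sq_nonneg (p - 0.77)),
      mul_nonneg (mul_nonneg hp hp) (sq_nonneg (p - 0.77))]
  · refine quad_nonneg_of_tangent (τ := 0.45) (by linarith) (by norm_num) (by norm_num)
      (by nlinarith) hb hc ?_
    nlinarith [mul_nonneg (by linarith : 0 ≤ p - 0.85) (by linarith : 0 ≤ 1 - p)]

/-- The surplus is 0.195 when the large state has occupation k₂ ≥ 1.2G. The jump then counts 1 + 1.2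
times, once from the boundary loss and 1.2 times from k₂. -/
theorem two_state_gain_occupied (hr : 1.4142 ≤ r) (hb : b ^ 2 ≤ p) (hc : c ^ 2 ≤ 1 - p) :
    0 ≤ 2.2 * (b - c) ^ 2 - 1 * b ^ 2 + (r - 0.195 - p) := by
  have hp1 : p ≤ 1 := by nlinarith [sq_nonneg c]
  rcases le_total p 0.6 with h | h
  · nlinarith [sq_nonneg (b - c)]
  rcases le_total p 0.76 with h' | h'
  · refine quad_nonneg_of_tangent (τ := 0.65) (by norm_num) (by norm_num) (by norm_num)
      (by norm_num) hb hc ?_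
    linarith
  · refine quad_nonneg_of_tangent (τ := 6 / 11) (by norm_num) (by norm_num) (by norm_num)
      (by norm_num) hb hc ?_
    linarith

/-- A short horizon leaves a fixed amount of probability in the starting state. -/
theorem one_sub_pow_ge {γ α : ℝ} {m : ℕ} (hγ0 : 0 ≤ γ) (hγ1 : γ < 1)
    (hα1 : α ≤ 1 - γ) (hα : γ ^ m ≤ 0.07 → α ≤ 4 * γ ^ m * (1 - γ)) : 0.07 ≤ (1 - α) ^ m := by
  rcases le_total 0.07 (γ ^ m) with h | h
  · exact h.trans (pow_le_pow_left₀ hγ0 (by linarith) m)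
  · have hα := hα h
    have hG := pow_nonneg hγ0 m
    set G := γ ^ m with hGdef
    set y : ℝ := m * (1 - γ) with hy
    have hy0 : 0 ≤ y := mul_nonneg m.cast_nonneg (by linarith)
    have h1 : G ≤ Real.exp (-y) := by
      have : γ ≤ Real.exp (-(1 - γ)) := by
        have := Real.add_one_le_exp (-(1 - γ)); linarith
      calc G ≤ Real.exp (-(1 - γ)) ^ m := pow_le_pow_left₀ hγ0 this m
        _ = Real.exp (-y) := by rw [← Real.exp_nat_mul]; congr 1; rw [hy]; ring
    -- The maximum of y²e^{-y} is 4/e², about 0.541. With G ≤ 0.07 it gives Gy ≤ 0.2, so mα ≤ 0.8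
    -- and Bernoulli's inequality leaves 0.2.
    have h2 : y ^ 2 * Real.exp (-y) ≤ 0.55 := by
      have h3 : y / 2 ≤ Real.exp (y / 2 - 1) := by
        have := Real.add_one_le_exp (y / 2 - 1); linarith
      have h4 : (y / 2) ^ 2 ≤ Real.exp (y - 2) := by
        calc (y / 2) ^ 2 ≤ Real.exp (y / 2 - 1) ^ 2 := pow_le_pow_left₀ (by linarith) h3 2
          _ = Real.exp (y - 2) := by rw [← Real.exp_nat_mul]; congr 1; push_cast; ring
      have h5 : (y / 2) ^ 2 * Real.exp (-y) ≤ Real.exp (-2) := by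
        calc _ ≤ Real.exp (y - 2) * Real.exp (-y) :=
              mul_le_mul_of_nonneg_right h4 (Real.exp_pos _).le
          _ = Real.exp (-2) := by rw [← Real.exp_add]; congr 1; ring
      have h6 : Real.exp (-2) ≤ 0.1375 := by
        have e : Real.exp 2 = Real.exp 1 ^ 2 := by rw [← Real.exp_nat_mul]; norm_num
        rw [Real.exp_neg, e, inv_le_comm₀ (by positivity) (by norm_num)]
        have := Real.exp_one_gt_d9
        norm_num at this ⊢
        nlinarith
      linarith
    have h7 : (G * y) ^ 2 ≤ 0.2 ^ 2 := by
      have : (G * y) ^ 2 ≤ 0.07 * (y ^ 2 * Real.exp (-y)) := by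
        calc (G * y) ^ 2 = G * (y ^ 2 * G) := by ring
          _ ≤ 0.07 * (y ^ 2 * Real.exp (-y)) := by gcongr
      norm_num at h2 this ⊢
      linarith
    have h8 : G * y ≤ 0.2 := abs_le_of_sq_le_sq' h7 (by norm_num) |>.2
    have h9 : (m : ℝ) * α ≤ 0.8 := by
      have := mul_le_mul_of_nonneg_left hα m.cast_nonneg
      have e : (m : ℝ) * (4 * G * (1 - γ)) = 4 * (G * y) := by rw [hy]; ring
      rw [e] at this
      linarith
    have hB := one_add_mul_le_pow (a := -α) (by linarith) m
    have : (1 + -α) ^ m = (1 - α) ^ m := by ring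
    linarith

/-- Index 1 is the state with small values, index 2 the state `s0`; ρ is the initial law and μ the
law at time m. Balance writes the inflow into state 2 through k₂, φ and ρ₂ - Gμ₂, and the source
terms collect into (ρ₂ - Gμ₂)(B - J - Y₁). Since μ₁ ≥ ρ₁N, the factor ρ₂ - Gμ₂ is at least -G(1-N).
-/
theorem two_state_key {ε G k₁ k₂ Y₁ Yu₁ ρ₁ ρ₂ μ₁ μ₂ N B J φ ω : ℝ}
    (hε0 : 0 ≤ ε) (hε1 : 0 < 1 - ε) (hG0 : 0 ≤ G) (hN0 : 0 ≤ N) (hN1 : N ≤ 1) (hG1 : G ≤ 1)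
    (hk₁ : 0 ≤ k₁) (hk₂ : 0 ≤ k₂) (hk : k₁ + k₂ = 1 - G) (hY₁ : 0 ≤ Y₁) (hYu : 0 ≤ Yu₁)
    (hg : Y₁ ≤ B - J) (hρ₂ : 0 ≤ ρ₂) (hρ : ρ₁ + ρ₂ = 1) (hμ : μ₁ + μ₂ = 1)
    (hst : ρ₁ * N ≤ μ₁) :
    ω + (J * k₂ + k₁ * ((1 - ε) * Y₁ + ε * Yu₁)) * (1 - ε)
        + (1 - ε) * (J * φ - G * (1 - N) * (B - J))
      ≤ ω + ε * (k₁ * Yu₁)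
        + (1 - ε) * (ρ₁ * Y₁ + ρ₂ * B - G * (μ₁ * Y₁ + μ₂ * B)
          + J * (k₂ + φ - ρ₂ + G * μ₂)) := by
  have e1 : ρ₁ = 1 - ρ₂ := by linarith
  have e2 : μ₁ = 1 - μ₂ := by linarith
  have h1 : -(G * (1 - N)) ≤ ρ₂ - G * μ₂ := by
    have : μ₂ ≤ 1 - (1 - ρ₂) * N := by
      rw [e1] at hst
      linarith
    have h2 := mul_le_mul_of_nonneg_left this hG0
    have h4 : G * N ≤ 1 := mul_le_one₀ hG1 hN0 hN1
    have h3 : 0 ≤ ρ₂ * (1 - G * N) := mul_nonneg hρ₂ (by linarith)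
    linarith
  have h2 := mul_le_mul_of_nonneg_right h1 (sub_nonneg.2 hg)
  have h3 : k₁ * Y₁ ≤ (1 - G) * Y₁ := mul_le_mul_of_nonneg_right (by linarith) hY₁
  have h4 : 0 ≤ G * (1 - N) * Y₁ := mul_nonneg (mul_nonneg hG0 (by linarith)) hY₁
  have h5 : ρ₁ * Y₁ + ρ₂ * B - G * (μ₁ * Y₁ + μ₂ * B) + J * (k₂ + φ - ρ₂ + G * μ₂)
      = (1 - G) * Y₁ + (ρ₂ - G * μ₂) * (B - J - Y₁) + J * (k₂ + φ) := by
    rw [e1, e2]; ring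
  rw [h5]
  have h6 : k₁ * Y₁ + J * k₂ + (J * φ - G * (1 - N) * (B - J))
      ≤ (1 - G) * Y₁ + (ρ₂ - G * μ₂) * (B - J - Y₁) + J * (k₂ + φ) := by linarith
  have h7 := mul_le_mul_of_nonneg_left h6 hε1.le
  have h8 : 0 ≤ ε * (k₁ * Yu₁) * ε := by positivity
  have h9 : 0 ≤ k₁ * Y₁ * (1 - ε) * ε := by positivity
  linarith

/-- A surplus v pays for the exploration loss. From ε ≤ (1-γ)/8 one gets 1 - ε ≥ (7+γ)/8, and `hv`
is the tight case W = rG. The excess W - rG pays for itself because 7/8 - 1/7 > 1/80. For γ near 1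
and q = 1 the requirement is v just below 0.195. -/
theorem two_state_conclude {γ ε G W r v q X : ℝ} (hγ0 : 0 ≤ γ) (hγ1 : γ < 1)
    (hε : ε ≤ (1 - γ) / 8) (hG0 : 0 ≤ G) (hr : 0 ≤ r) (hW : r * G ≤ W)
    (hq0 : 0 ≤ q) (hq : 1 - G ≤ q) (hv : r / 80 * (7 + γ) ≤ (7 + γ) * ((7 + γ) / 8 * v) - r * γ * q)
    (hv0 : 0 ≤ v) (hX : (W - r * G) + v * G ≤ X) :
    W / 80 ≤ (1 - ε) * X - γ * (1 - G) * W / (8 * (1 - ε)) := by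
  have hε1 : 7 / 8 ≤ 1 - ε := by linarith
  have h0 : 0 ≤ W - r * G := by linarith
  have h1 := mul_le_mul_of_nonneg_left hX (by linarith : 0 ≤ 1 - ε)
  have h2 : γ * (1 - G) / (8 * (1 - ε)) ≤ 1 / 7 := by
    rw [div_le_div_iff₀ (by linarith) (by norm_num)]
    nlinarith [mul_nonneg hγ0 hG0]
  have h3 := mul_le_mul_of_nonneg_right h2 h0
  have h5 : (7 + γ) / 8 * v ≤ (1 - ε) * v := mul_le_mul_of_nonneg_right (by linarith) hv0
  have h6 : γ * (1 - G) * r / (8 * (1 - ε)) ≤ r * γ * q / (7 + γ) := by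
    refine div_le_div₀ (by positivity) ?_ (by linarith) (by linarith)
    have := mul_le_mul_of_nonneg_left hq (mul_nonneg hγ0 hr)
    linarith
  have h7 : r / 80 ≤ (7 + γ) / 8 * v - r * γ * q / (7 + γ) := by
    rw [← mul_le_mul_iff_left₀ (by linarith : 0 < 7 + γ), sub_mul,
      div_mul_cancel₀ _ (by linarith : 7 + γ ≠ 0)]
    linarith
  have h4 := mul_le_mul_of_nonneg_right (h7.trans (sub_le_sub h5 h6)) hG0
  have e : γ * (1 - G) * W / (8 * (1 - ε)) = γ * (1 - G) / (8 * (1 - ε)) * (W - r * G)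
      + γ * (1 - G) * r / (8 * (1 - ε)) * G := by ring
  rw [e]
  have h8 := mul_le_mul_of_nonneg_right hε1 h0
  linarith

/-- The occupation gain after normalisation by the truncated mass. -/
theorem two_state_scale {r p N G φ B J W ω v : ℝ} (hp0 : 0 < p) (hG : 0 < G) (hJ0 : 0 ≤ J)
    (hW : r * G ≤ W) (hWω : W - G * p ≤ ω)
    (hv : v * p ≤ (r - p) * (p + J) - (1 - N) * p * (B - J) + J * p * (φ / G)) :
    (W - r * G) + v * G ≤ ω + J / p * ω + (J * φ - G * (1 - N) * (B - J)) := by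
  have hJp0 : 0 ≤ J / p := by positivity
  have h1 : (W - G * p) * (1 + J / p) ≤ ω * (1 + J / p) :=
    mul_le_mul_of_nonneg_right hWω (by linarith)
  have h2 : 0 ≤ (W - r * G) * (J / p) := mul_nonneg (by linarith) hJp0
  have h3 : v ≤ (r - p) * (1 + J / p) - (1 - N) * (B - J) + J * (φ / G) := by
    have : (r - p) * (1 + J / p) - (1 - N) * (B - J) + J * (φ / G)
        = ((r - p) * (p + J) - (1 - N) * p * (B - J) + J * p * (φ / G)) / p := by
      field_simp
    rw [this, le_div_iff₀ hp0]
    exact hv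
  have h4 := mul_le_mul_of_nonneg_right h3 hG.le
  have h5 : J * (φ / G) * G = J * φ := by field_simp
  have h6 : ((r - p) * (1 + J / p) - (1 - N) * (B - J) + J * (φ / G)) * G
      = (r * G - G * p) * (1 + J / p) - G * (1 - N) * (B - J) + J * (φ / G) * G := by ring
  rw [h6, h5] at h4
  linarith

/-- If state 2 has little occupation and little outflow, then by balance it has little inflow: γk₁α
≤ 2.5G(1-γ), while k₁ ≥ 1 - 2.2G. Hence the leaving probability α is small enough for the bound on
N. -/
theorem two_state_stay {γ G φ k₁ k₂ ρ₂ μ₂ α F N : ℝ} (hγ : 3 / 4 ≤ γ) (hγ1 : γ < 1)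
    (hG0 : 0 < G) (hG : G ≤ 0.18) (hφ : φ ≤ 0.3 * G) (hk₂ : k₂ ≤ 1.2 * G) (hk : k₁ + k₂ = 1 - G)
    (hρ₂ : 0 ≤ ρ₂) (hμ₂ : μ₂ ≤ 1) (hα0 : 0 ≤ α) (hF : F = γ * k₁ * α)
    (hFx : F = (1 - γ) * (k₂ + φ - ρ₂ + G * μ₂))
    (hN : α ≤ 1 - γ → (G ≤ 0.07 → α ≤ 4 * G * (1 - γ)) → 0.07 ≤ N) : 0.07 ≤ N := by
  have hx : 0 < 1 - γ := by linarith
  have hα : α * (3 / 4 * (1 - 2.2 * G)) ≤ 2.5 * G * (1 - γ) := by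
    have h1 : γ * k₁ * α = (1 - γ) * (k₂ + φ - ρ₂ + G * μ₂) := hF.symm.trans hFx
    have h2 : k₂ + φ - ρ₂ + G * μ₂ ≤ 2.5 * G := by
      have := mul_le_mul_of_nonneg_left hμ₂ hG0.le
      linarith
    have h3 := mul_le_mul_of_nonneg_left h2 hx.le
    have h4 : 3 / 4 * (1 - 2.2 * G) ≤ γ * k₁ :=
      mul_le_mul hγ (by linarith) (by linarith) (by linarith)
    have h5 := mul_le_mul_of_nonneg_right h4 hα0
    linarith
  clear hF hFx
  refine hN ?_ fun hG7 => ?_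
  · by_contra hcon
    push Not at hcon
    nlinarith [mul_pos hx (by linarith : 0 < 1 - 2.2 * G)]
  · by_contra hcon
    push Not at hcon
    nlinarith [mul_pos hx hG0]

/-- The unconditional surplus 0.163 is enough for γ ≤ 3/4, and for G ≥ 0.18, where the exploration
loss shrinks by the factor 1 - G ≤ 0.82. Otherwise 0.195 is needed, and it comes from one of three
sources: outflow (φ ≥ 0.3G), occupation (k₂ ≥ 1.2G) or staying (N ≥ 0.07). If the first two fail,
`hN7` supplies the third. -/
theorem two_state_cases {γ ε G W ω k₂ φ r p b c J B N Z : ℝ} (hγ0 : 0 ≤ γ) (hγ1 : γ < 1)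
    (hε0 : 0 ≤ ε) (hε : ε ≤ (1 - γ) / 8) (hG0 : 0 ≤ G) (hp0 : 0 < p)
    (hr : 1.4142 ≤ r) (hr' : r ≤ 1.4143) (hJ : J = (b - c) ^ 2) (hB : B = b ^ 2) (hJB : J ≤ B)
    (hbp : b ^ 2 ≤ p) (hpc : c ^ 2 ≤ 1 - p) (hW : r * G ≤ W)
    (hWω : W - G * p ≤ ω) (hω0 : 0 ≤ ω) (hφ0 : 0 ≤ φ) (hk₂ : 0 ≤ k₂) (hN0 : 0 ≤ N)
    (hZ : 0 ≤ Z) (hJω : J / p * ω ≤ J * k₂ + Z)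
    (hN7 : 3 / 4 ≤ γ → 0 < G → G ≤ 0.18 → φ ≤ 0.3 * G → k₂ ≤ 1.2 * G → 0.07 ≤ N) :
    W / 80 ≤ ω + (J * k₂ + Z) * (1 - ε)
        + (1 - ε) * (J * φ - G * (1 - N) * (B - J)) - γ * (1 - G) * W / (8 * (1 - ε)) := by
  have hJ0 : 0 ≤ J := hJ ▸ sq_nonneg _
  have hε1 : 0 < 1 - ε := by linarith
  have hr0 : 0 ≤ r := by linarith
  have hW0 : 0 ≤ W := le_trans (mul_nonneg hr0 hG0) hW
  have hεω := mul_nonneg hε0 hω0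
  rcases hG0.eq_or_lt with hGz | hGpos
  · rw [← hGz]
    have h1 : 0 ≤ (J * k₂ + Z) * (1 - ε) := mul_nonneg (by positivity) hε1.le
    have h2 : γ * (1 - 0) * W / (8 * (1 - ε)) ≤ W / 7 := by
      rw [div_le_div_iff₀ (by linarith) (by norm_num)]
      nlinarith [mul_nonneg (by linarith : 0 ≤ 1 - γ) hW0]
    have h3 : 0 ≤ (1 - ε) * (J * φ - 0 * (1 - N) * (B - J)) := by
      rw [zero_mul, zero_mul, sub_zero]; positivity
    rw [← hGz] at hWω
    linarith only [h1, h2, h3, hWω, hW0]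
  have conc : ∀ v q X : ℝ, 0 ≤ q → 1 - G ≤ q →
      r / 80 * (7 + γ) ≤ (7 + γ) * ((7 + γ) / 8 * v) - r * γ * q → 0 ≤ v →
      (W - r * G) + v * G ≤ X →
      (1 - ε) * X ≤ ω + (J * k₂ + Z) * (1 - ε)
        + (1 - ε) * (J * φ - G * (1 - N) * (B - J)) →
      W / 80 ≤ ω + (J * k₂ + Z) * (1 - ε)
        + (1 - ε) * (J * φ - G * (1 - N) * (B - J)) - γ * (1 - G) * W / (8 * (1 - ε)) :=
    fun v q X hq0 hq hv hv0 hX hX' =>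
      (two_state_conclude hγ0 hγ1 hε hG0 hr0 hW hq0 hq hv hv0 hX).trans (sub_le_sub_right hX' _)
  have hJω' := mul_le_mul_of_nonneg_right hJω hε1.le
  have fin : ∀ v q : ℝ, 0 ≤ q → 1 - G ≤ q →
      r / 80 * (7 + γ) ≤ (7 + γ) * ((7 + γ) / 8 * v) - r * γ * q → 0 ≤ v →
      v * p ≤ (r - p) * (p + J) - (1 - N) * p * (B - J) + J * p * (φ / G) →
      W / 80 ≤ ω + (J * k₂ + Z) * (1 - ε)
        + (1 - ε) * (J * φ - G * (1 - N) * (B - J)) - γ * (1 - G) * W / (8 * (1 - ε)) :=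
    fun v q hq0 hq hv hv0 hvp => conc v q _ hq0 hq hv hv0
      (two_state_scale hp0 hGpos hJ0 hW hWω hvp) (by linarith only [hJω', hεω])
  have hφG : 0 ≤ J * p * (φ / G) := by positivity
  have hgN : 0 ≤ N * p * (B - J) := mul_nonneg (mul_nonneg hN0 hp0.le) (by linarith only [hJB])
  have hdir : 0.163 * p ≤ (r - p) * (p + J) - (1 - N) * p * (B - J) + J * p * (φ / G) := by
    have := two_state_gain hr hr' hp0.le hbp hpc
    rw [← hJ, ← hB] at this
    linarith only [this, hgN, hφG]
  rcases le_total γ (3 / 4) with hγ34 | hγ34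
  · exact fin 0.163 1 (by norm_num) (by linarith only [hG0])
      (by clear conc fin; nlinarith only [hγ0, hγ34, hr, hr']) (by norm_num) hdir
  rcases le_total 0.18 G with hG18 | hG18
  · exact fin 0.163 0.82 (by norm_num) (by linarith only [hG18])
      (by clear conc fin; nlinarith only [hγ34, hγ1, hr, hr']) (by norm_num) hdir
  have hn2 : r / 80 * (7 + γ) ≤ (7 + γ) * ((7 + γ) / 8 * 0.195) - r * γ * 1 := by
    nlinarith only [hγ34, hγ1, hr, hr']
  rcases le_total (0.3 * G) φ with hφ3 | hφ3
  · refine fin 0.195 1 (by norm_num) (by linarith only [hG0]) hn2 (by norm_num) ?_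
    have h1 : 0.3 ≤ φ / G := (le_div_iff₀ hGpos).2 hφ3
    have h2 := mul_le_mul_of_nonneg_left h1 (mul_nonneg hJ0 hp0.le)
    have := two_state_gain_flow hr hr' hp0.le hbp hpc
    rw [← hJ, ← hB] at this
    linarith only [this, hgN, h2, hp0]
  rcases le_total (1.2 * G) k₂ with hk3 | hk3
  · have h1 := two_state_gain_occupied hr hbp hpc
    rw [← hJ, ← hB] at h1
    have h2 := mul_le_mul_of_nonneg_left h1 hG0
    have h3 := mul_le_mul_of_nonneg_left hk3 hJ0
    have h4 : 0 ≤ J * φ := mul_nonneg hJ0 hφ0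
    have h5 : 0 ≤ G * N * (B - J) := mul_nonneg (mul_nonneg hG0 hN0) (by linarith only [hJB])
    have h6 : 0 ≤ Z * (1 - ε) := mul_nonneg hZ hε1.le
    refine conc 0.195 1 (ω + J * k₂ + (J * φ - G * (1 - N) * (B - J))) (by norm_num)
      (by linarith only [hG0]) hn2 (by norm_num) ?_ ?_
    · linarith only [h2, h3, h4, h5, hWω]
    · linarith only [h6, hεω]
  refine fin 0.195 1 (by norm_num) (by linarith only [hG0]) hn2 (by norm_num) ?_
  have h1 := mul_le_mul_of_nonneg_right (hN7 hγ34 hGpos hG18 hφ3 hk3)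
    (mul_nonneg hp0.le (by linarith only [hJB] : 0 ≤ B - J))
  have := two_state_gain_stay hr hr' hp0.le hbp hpc
  rw [← hJ, ← hB] at this
  linarith only [this, h1, hφG, hp0]

/-- The numerical inequality behind the coercivity of the truncated form with two states. -/
theorem two_state_form_ge {γ ε G W ω k₁ k₂ Y₁ Yu₁ Yt₂ ρ₁ ρ₂ μ₁ μ₂ α σ F p b c : ℝ} {m : ℕ}
    (hγ0 : 0 ≤ γ) (hγ1 : γ < 1) (hG : G = γ ^ m) (hε0 : 0 ≤ ε) (hε : ε ≤ (1 - γ) / 8)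
    (hc0 : 0 ≤ c) (hcb : c < b) (hbp : b ^ 2 ≤ p) (hpc : c ^ 2 ≤ 1 - p)
    (hWω : W - G * p ≤ ω) (hW : √2 * G ≤ W) (hk₁ : 0 ≤ k₁) (hk₂ : 0 ≤ k₂)
    (hk : k₁ + k₂ = 1 - G) (hY₁ : 0 ≤ Y₁) (hY₁c : Y₁ ≤ c ^ 2) (hYu : 0 ≤ Yu₁)
    (hYt : (1 - ε) * b ^ 2 ≤ Yt₂) (hYtp : Yt₂ ≤ p)
    (hω : ω = k₁ * ((1 - ε) * Y₁ + ε * Yu₁) + k₂ * Yt₂)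
    (hρ₂ : 0 ≤ ρ₂) (hρ : ρ₁ + ρ₂ = 1) (hμ₁ : 0 ≤ μ₁) (hμ : μ₁ + μ₂ = 1)
    (hα0 : 0 ≤ α) (hα1 : α ≤ 1) (hst : ρ₁ * (1 - α) ^ m ≤ μ₁) (hσ : σ ≤ 1)
    (hF : F = γ * k₁ * α) (hF' : F = k₂ - (1 - γ) * (ρ₂ - G * μ₂) - γ * k₂ * σ) :
    (1 - γ) * (W / 80) ≤ (1 - γ) * (ω + ε * (k₁ * Yu₁)
        + (1 - ε) * (ρ₁ * Y₁ + ρ₂ * b ^ 2 - G * (μ₁ * Y₁ + μ₂ * b ^ 2)))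
      + (1 - ε) * (b - c) ^ 2 * F - γ * (1 - G) * ((1 - γ) * W / (8 * (1 - ε))) := by
  have hx : 0 < 1 - γ := by linarith
  have hε1 : 0 < 1 - ε := by linarith
  have hG0 : 0 ≤ G := hG ▸ pow_nonneg hγ0 m
  have hG1 : G ≤ 1 := hG ▸ pow_le_one₀ hγ0 hγ1.le
  have hp0 : 0 < p := lt_of_lt_of_le (pow_pos (by linarith : 0 < b) 2) hbp
  have hr : 1.4142 ≤ √2 := Real.le_sqrt_of_sq_le (by norm_num)
  have hr' : √2 ≤ 1.4143 := Real.sqrt_le_iff.2 ⟨by norm_num, by norm_num⟩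
  have hr0 : 0 ≤ √2 := Real.sqrt_nonneg 2
  set r := √2
  have hcb' := mul_nonneg hc0 (sub_nonneg.2 hcb.le)
  have hJp : (b - c) ^ 2 ≤ p := by linarith only [hcb', sq_nonneg c, hbp]
  have hg : Y₁ ≤ b ^ 2 - (b - c) ^ 2 := by linarith only [hcb', hY₁c, sq_nonneg c]
  have hJ0 : 0 ≤ (b - c) ^ 2 := sq_nonneg _
  have hYt0 : 0 ≤ Yt₂ := le_trans (mul_nonneg hε1.le (sq_nonneg _)) hYt
  have hN0 : 0 ≤ (1 - α) ^ m := pow_nonneg (by linarith only [hα1]) m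
  have hN1 : (1 - α) ^ m ≤ 1 := pow_le_one₀ (by linarith only [hα1]) (by linarith only [hα0])
  have hN7 : α ≤ 1 - γ → (G ≤ 0.07 → α ≤ 4 * G * (1 - γ)) → 0.07 ≤ (1 - α) ^ m := by
    rw [hG]; exact one_sub_pow_ge hγ0 hγ1
  -- φ is the discounted flow out of state 2, divided by 1-γ to match the scale of the source terms.
  obtain ⟨φ, hφ0, hφx⟩ : ∃ φ, 0 ≤ φ ∧ (1 - γ) * φ = γ * k₂ * (1 - σ) :=
    ⟨γ * k₂ * (1 - σ) / (1 - γ), div_nonneg (mul_nonneg (mul_nonneg hγ0 hk₂)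
      (by linarith only [hσ])) hx.le, mul_div_cancel₀ _ hx.ne'⟩
  have hFx : F = (1 - γ) * (k₂ + φ - ρ₂ + G * μ₂) := by rw [hF']; linarith only [hφx]
  have hZ0 : 0 ≤ k₁ * ((1 - ε) * Y₁ + ε * Yu₁) := by positivity
  have hω0 : 0 ≤ ω := by rw [hω]; positivity
  have key := two_state_key (φ := φ) (ω := ω) hε0 hε1 hG0 hN0 hN1 hG1 hk₁ hk₂ hk hY₁ hYu hg hρ₂
    hρ hμ hst
  have hJω : (b - c) ^ 2 / p * ω
      ≤ (b - c) ^ 2 * k₂ + k₁ * ((1 - ε) * Y₁ + ε * Yu₁) := by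
    rw [hω, div_mul_eq_mul_div, div_le_iff₀ hp0]
    have h1 := mul_le_mul_of_nonneg_left hYtp (mul_nonneg hJ0 hk₂)
    have h2 := mul_le_mul_of_nonneg_right hJp hZ0
    linarith only [h1, h2]
  have h := two_state_cases hγ0 hγ1 hε0 hε hG0 hp0 hr hr' rfl rfl
    (by linarith only [hg, hY₁]) hbp hpc hW hWω hω0 hφ0 hk₂ hN0 hZ0 hJω
    fun h1 h2 h3 h4 h5 => two_state_stay h1 hγ1 h2 h3 h4 h5 hk hρ₂ (by linarith only [hμ, hμ₁])
      hα0 hF hFx hN7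
  have := mul_le_mul_of_nonneg_left (h.trans (sub_le_sub_right key _)) hx.le
  refine this.trans (le_of_eq ?_)
  rw [hFx]
  ring

end TwoStates

/-! ### Coercivity of the truncated form for a tail that is not small -/

namespace MDP

variable {S A : Type*} [Fintype S] [Fintype A] [DecidableEq S] (M : MDP S A)
variable {π : S → A → ℝ}

theorem bform_smul (π : S → A → ℝ) (w u : S × A → ℝ) (t : ℝ) :
    M.bform π w (t • u) (t • u) = t ^ 2 * M.bform π w u u := by
  simp only [bform, Matrix.mulVec_smul, Pi.smul_apply, smul_eq_mul, mul_sum]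
  exact sum_congr rfl fun _ _ => by ring

theorem wNormSq_smul {Z : Type*} [Fintype Z] (w u : Z → ℝ) (t : ℝ) :
    wNormSq w (t • u) = t ^ 2 * wNormSq w u := by
  simp only [wNormSq, Pi.smul_apply, smul_eq_mul, mul_sum]
  exact sum_congr rfl fun _ _ => by ring

theorem occ_ge_of_stay (hπ : IsPolicy π) {ν : S → ℝ} (hν : IsProbVec ν) (s : S) (l : ℕ) :
    ν s * M.stateMatrix π s s ^ l ≤ M.occ π ν l s := by
  induction l with
  | zero => simp [occ_zero]
  | succ l ih =>
    rw [occ_succ_apply, pow_succ, ← mul_assoc]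
    exact (mul_le_mul_of_nonneg_right ih (M.stateMatrix_nonneg hπ s s)).trans
      (single_le_sum (f := fun q => M.occ π ν l q * M.stateMatrix π q s)
        (fun q _ => mul_nonneg ((M.occ_isProbVec hπ hν l).1 q) (M.stateMatrix_nonneg hπ q s))
        (mem_univ s))

/-- Because u² + b² - 2uv ≥ (b - |u|)² and |u| ≤ c ≤ b. This supplies the gain J = (b-c)² of
`two_mul_bform_ge`. -/
theorem two_mul_mul_le_of_abs_le {u v b c : ℝ} (hu : u ^ 2 ≤ c ^ 2) (hv : v ^ 2 ≤ b ^ 2) (hc : 0 ≤ c)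
    (hcb : c ≤ b) : 2 * u * v ≤ u ^ 2 + b ^ 2 - (b - c) ^ 2 := by
  have h1 : |u| ≤ c := abs_le_of_sq_le_sq hu hc
  have h2 : |v| ≤ b := abs_le_of_sq_le_sq hv (hc.trans hcb)
  have h3 : u * v ≤ |u| * b := by
    calc u * v ≤ |u * v| := le_abs_self _
      _ = |u| * |v| := abs_mul _ _
      _ ≤ |u| * b := mul_le_mul_of_nonneg_left h2 (abs_nonneg u)
  have h4 := sq_abs u
  nlinarith [mul_nonneg (sub_nonneg.2 h1) (by linarith : 0 ≤ 2 * b - c - |u|)]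

/-- With √p = cos φ and c = sin φ the left side is at most cos 2φ + sin 2φ ≤ √2. The weight 0.4143
approximates the optimal √2 - 1. -/
theorem add_cross_sub_sq_le {p b c : ℝ} (hp0 : 0 ≤ p) (hc0 : 0 ≤ c) (hbp : b ^ 2 ≤ p)
    (hpc : c ^ 2 = 1 - p) : p + (2 * b * c - c ^ 2) ≤ 1.4143 := by
  have hs := Real.sq_sqrt hp0
  have h7 := mul_le_mul_of_nonneg_right (Real.le_sqrt_of_sq_le hbp) hc0
  have h8 : 0 ≤ 0.4143 ^ 2 * √p ^ 2 - 0.8286 * (√p * c) + c ^ 2 := by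
    nlinarith only [sq_nonneg (0.4143 * √p - c)]
  have h9 := sq_nonneg c
  rw [hs] at h8
  linarith

variable [Nonempty A] [Nonempty S]

-- Of the gain J only the source terms are kept, the rest of the inflow being nonnegative. The
-- truncation loss becomes γ^m (p + 2bc - c²) ≤ 1.4143 γ^m, and ‖u‖² ≥ √3 γ^m leaves room for the
-- exploration loss.
set_option maxHeartbeats 800000 in
theorem bform_truncDisc_ge_of_three_le (hπ : IsPolicy π) {ε : ℝ} (h0 : 0 ≤ ε) {ν : S → ℝ}
    (hν : IsProbVec ν) (hε : ∀ s, ε ≤ (1 - M.γ) * M.disc π ν s / 4) (m : ℕ) {u : S × A → ℝ}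
    (hW : √(Fintype.card S : ℝ) * M.γ ^ m ≤ wNormSq (stWeight π ε (M.disc π ν)) u)
    (hn : 3 ≤ Fintype.card S) (s0 : S) {p b c : ℝ} (hp : ∀ z, u z ^ 2 ≤ p) (hp0 : 0 ≤ p)
    (hc0 : 0 ≤ c) (hcb : c < b) (hb : polAvg π (fun z => u z ^ 2) s0 = b ^ 2)
    (hbp : b ^ 2 ≤ p) (hpc : c ^ 2 = 1 - p) (hc : ∀ s, s ≠ s0 → ∀ a, u (s, a) ^ 2 ≤ c ^ 2) :
    (1 - M.γ) * (wNormSq (stWeight π ε (M.disc π ν)) u / 80)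
      ≤ 2 * M.bform π (stWeight π ε (M.truncDisc π ν m)) u u := by
  have hκ := M.disc_isProbVec hπ hν
  have hx := M.one_sub_γ_pos
  have hγ := M.γ_nonneg
  have hG0 : 0 ≤ M.γ ^ m := pow_nonneg hγ m
  have hG1 : M.γ ^ m ≤ 1 := pow_le_one₀ hγ M.γ_lt_one.le
  have hn' : (3 : ℝ) ≤ Fintype.card S := by exact_mod_cast hn
  have hε12 : ε ≤ 1 / 12 := by
    have := M.card_mul_eps_le hκ.2 hε
    have := mul_le_mul_of_nonneg_right hn' h0
    linarith
  have hε1 : 0 < 1 - ε := by linarith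
  have hsq : 1.732 ≤ √(Fintype.card S : ℝ) := Real.le_sqrt_of_sq_le (by norm_num; linarith)
  have h := M.two_mul_bform_truncDisc_ge hπ h0 hν hε m u s0 (J := (b - c) ^ 2) fun s hs a => by
    rw [hb]
    exact two_mul_mul_le_of_abs_le (hc s hs a) ((hπ.sq_polAvg_le u s0).trans hb.le) hc0 hcb.le
  refine le_trans ?_ h
  have ht := M.wNormSq_truncDisc hπ ε hν m u
  have ho := M.occ_isProbVec hπ hν m
  have h1 := wNormSq_le_of_sq_le hπ h0 (by linarith : ε ≤ 1) (M.disc_isProbVec hπ ho) hp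
  have h3 : 0 ≤ ∑ s, M.truncDisc π ν m s * polAvg (unif S A) (fun z => u z ^ 2) s :=
    sum_nonneg fun s _ => mul_nonneg (M.truncDisc_nonneg hπ hν m s)
      (unif_isPolicy.polAvg_nonneg (fun _ => sq_nonneg _) s)
  set Y := polAvg π (fun z => u z ^ 2) with hY
  have hYc : ∀ s, s ≠ s0 → Y s ≤ c ^ 2 := fun s hs =>
    hπ.polAvg_le (h := fun z => u z ^ 2) (s := s) fun a => hc s hs a
  have h4 : ν s0 * (b - c) ^ 2 ≤ ∑ s, ν s * Y s := by
    refine le_trans ?_ (single_le_sum (f := fun s => ν s * Y s) (fun s _ => mul_nonneg (hν.1 s)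
      (hπ.polAvg_nonneg (fun _ => sq_nonneg _) s)) (mem_univ s0))
    rw [hb]
    exact mul_le_mul_of_nonneg_left (pow_le_pow_left₀ (by linarith) (by linarith) 2) (hν.1 s0)
  have h5 : ∑ s, M.occ π ν m s * Y s - (b - c) ^ 2 * M.occ π ν m s0 ≤ 2 * b * c - c ^ 2 := by
    have := ho.sum_mul_le (Y := fun s => Y s - if s = s0 then (b - c) ^ 2 else 0)
      (B := 2 * b * c - c ^ 2) fun s => by
        by_cases hs : s = s0
        · rw [hs]; simp only [if_true]; rw [hb]; exact le_of_eq (by ring)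
        · simp only [hs, if_false]
          have := hYc s hs
          linarith [mul_nonneg hc0 (sub_nonneg.2 hcb.le)]
    simpa [mul_sub, sum_sub_distrib, mul_comm] using this
  have h6 := add_cross_sub_sq_le hp0 hc0 hbp hpc
  have h7 : 0 ≤ M.truncDisc π ν m s0 - M.γ * M.truncDisc π ν m s0 * M.stateMatrix π s0 s0 := by
    have h8 := M.truncDisc_nonneg hπ hν m s0
    have h9 : M.stateMatrix π s0 s0 ≤ 1 := IsProbVec.le_one
      ⟨M.stateMatrix_nonneg hπ s0, M.stateMatrix_sum hπ s0⟩ s0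
    have h10 : M.γ * M.stateMatrix π s0 s0 ≤ 1 :=
      mul_le_one₀ M.γ_lt_one.le (M.stateMatrix_nonneg hπ s0 s0) h9
    have := mul_nonneg h8 (sub_nonneg.2 h10)
    linarith
  set W := wNormSq (stWeight π ε (M.disc π ν)) u
  have hW0 : 0 ≤ W := wNormSq_nonneg (stWeight_nonneg hπ h0 (by linarith) hκ.1) u
  -- For ε ≤ 1/12, 1/(8(1-ε)) ≤ 3/22 < 0.1364.
  have h8 : M.γ * (1 - M.γ ^ m) * ((1 - M.γ) * W / (8 * (1 - ε))) ≤ (1 - M.γ) * (W * 0.1364) := by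
    have e : (1 - M.γ) * W / (8 * (1 - ε)) ≤ (1 - M.γ) * (W * 0.1364) := by
      rw [div_le_iff₀ (by linarith)]
      have h9 := mul_nonneg hx.le hW0
      have h10 := mul_le_mul_of_nonneg_right hε12 h9
      linarith
    refine le_trans (mul_le_of_le_one_left (by positivity) ?_) e
    exact mul_le_one₀ M.γ_lt_one.le (by linarith) (by linarith)
  have h9 := mul_le_mul_of_nonneg_left h1 hG0
  have h10 := mul_le_mul_of_nonneg_left h5 hG0
  have h11 := mul_le_mul_of_nonneg_left h6 hG0
  have h12 := mul_le_mul_of_nonneg_right hsq hG0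
  have h13 : 0 ≤ (1 - ε) * (b - c) ^ 2
      * (M.truncDisc π ν m s0 - M.γ * M.truncDisc π ν m s0 * M.stateMatrix π s0 s0) :=
    mul_nonneg (mul_nonneg hε1.le (sq_nonneg _)) h7
  have hg : 0 ≤ M.γ ^ m * (2 * b * c - c ^ 2) :=
    mul_nonneg hG0 (by linarith [mul_nonneg hc0 (sub_nonneg.2 hcb.le), sq_nonneg c])
  have h14 : -(M.γ ^ m * (2 * b * c - c ^ 2)) ≤ (1 - ε) * (∑ s, ν s * Y s
      - M.γ ^ m * ∑ s, M.occ π ν m s * Y s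
      - (b - c) ^ 2 * (ν s0 - M.γ ^ m * M.occ π ν m s0)) := by
    have : -(M.γ ^ m * (2 * b * c - c ^ 2)) ≤ ∑ s, ν s * Y s
      - M.γ ^ m * ∑ s, M.occ π ν m s * Y s
      - (b - c) ^ 2 * (ν s0 - M.γ ^ m * M.occ π ν m s0) := by linarith
    have := mul_le_mul_of_nonneg_left this hε1.le
    have := mul_nonneg h0 hg
    linarith
  have h15 : W / 80 + W * 0.1364 ≤ wNormSq (stWeight π ε (M.truncDisc π ν m)) u
        + ε * ∑ s, M.truncDisc π ν m s * polAvg (unif S A) (fun z => u z ^ 2) s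
        + (1 - ε) * (∑ s, ν s * Y s
      - M.γ ^ m * ∑ s, M.occ π ν m s * Y s
      - (b - c) ^ 2 * (ν s0 - M.γ ^ m * M.occ π ν m s0)) := by
    have := mul_nonneg h0 h3
    linarith
  have h16 := mul_le_mul_of_nonneg_left h15 hx.le
  linarith

/-- The truncation loss can nearly exhaust √2 γ^m, so nothing is left for the exploration loss
unless the whole inflow into `s0` is kept. All quantities of a two-state chain are passed to
`two_state_form_ge`. -/
theorem bform_truncDisc_ge_of_eq_two (hπ : IsPolicy π) {ε : ℝ} (h0 : 0 ≤ ε) {ν : S → ℝ}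
    (hν : IsProbVec ν) (hε : ∀ s, ε ≤ (1 - M.γ) * M.disc π ν s / 4) (m : ℕ) {u : S × A → ℝ}
    (hW : √2 * M.γ ^ m ≤ wNormSq (stWeight π ε (M.disc π ν)) u)
    (hn : Fintype.card S = 2) (s0 : S) {p b c : ℝ} (hp : ∀ z, u z ^ 2 ≤ p)
    (hc0 : 0 ≤ c) (hcb : c < b) (hb : polAvg π (fun z => u z ^ 2) s0 = b ^ 2)
    (hbp : b ^ 2 ≤ p) (hpc : c ^ 2 = 1 - p) (hc : ∀ s, s ≠ s0 → ∀ a, u (s, a) ^ 2 ≤ c ^ 2) :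
    (1 - M.γ) * (wNormSq (stWeight π ε (M.disc π ν)) u / 80)
      ≤ 2 * M.bform π (stWeight π ε (M.truncDisc π ν m)) u u := by
  have hκ := M.disc_isProbVec hπ hν
  have hx := M.one_sub_γ_pos
  have hγ := M.γ_nonneg
  have hG0 : 0 ≤ M.γ ^ m := pow_nonneg hγ m
  have hε8 : ε ≤ (1 - M.γ) / 8 := by
    have := M.card_mul_eps_le hκ.2 hε
    rw [hn] at this
    push_cast at this
    linarith
  obtain ⟨s1, hs1, hsum⟩ : ∃ s1, s1 ≠ s0 ∧ ∀ h : S → ℝ, ∑ s, h s = h s1 + h s0 := by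
    have hcard : (univ.erase s0).card = 1 := by rw [card_erase_of_mem (mem_univ _), card_univ, hn]
    obtain ⟨s1, hs1⟩ := card_eq_one.1 hcard
    refine ⟨s1, ne_of_mem_erase (hs1 ▸ mem_singleton_self s1), fun h => ?_⟩
    rw [← sum_erase_add univ h (mem_univ s0), hs1, sum_singleton]
  have h := M.two_mul_bform_truncDisc_ge hπ h0 hν hε m u s0 (J := (b - c) ^ 2) fun s hs a => by
    rw [hb]
    exact two_mul_mul_le_of_abs_le (hc s hs a) ((hπ.sq_polAvg_le u s0).trans hb.le) hc0 hcb.le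
  refine le_trans ?_ h
  have ht := M.wNormSq_truncDisc hπ ε hν m u
  have ho := M.occ_isProbVec hπ hν m
  have h1 := mul_le_mul_of_nonneg_left (wNormSq_le_of_sq_le hπ h0
    (by linarith : ε ≤ 1) (M.disc_isProbVec hπ ho) hp) hG0
  have hks := M.truncDisc_sum hπ hν m
  have hk := M.truncDisc_nonneg hπ hν m
  have hfl := M.truncDisc_flow π ν m s0
  have hP := M.stateMatrix_sum hπ s1
  have hPn := M.stateMatrix_nonneg hπ
  have hP0 : M.stateMatrix π s0 s0 ≤ 1 := IsProbVec.le_one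
      ⟨M.stateMatrix_nonneg hπ s0, M.stateMatrix_sum hπ s0⟩ s0
  have hst := M.occ_ge_of_stay hπ hν s1 m
  have hρ := hν.2
  have hμ := ho.2
  have hY1 := hπ.polAvg_nonneg (fun z => sq_nonneg (u z)) s1
  have hYu := (unif_isPolicy (S := S) (A := A)).polAvg_nonneg (fun z => sq_nonneg (u z))
  have hYc : polAvg π (fun z => u z ^ 2) s1 ≤ c ^ 2 :=
    hπ.polAvg_le (h := fun z => u z ^ 2) (s := s1) fun a => hc s1 hs1 a
  have hYt : polAvg (perturbed π ε) (fun z => u z ^ 2) s0 ≤ p :=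
    (perturbed_isPolicy hπ h0 (by linarith)).polAvg_le (h := fun z => u z ^ 2) (s := s0)
      fun a => hp (s0, a)
  have hω := wNormSq_stWeight π ε (M.truncDisc π ν m) u
  rw [hsum] at hks hfl hP hρ hμ hω
  rw [polAvg_perturbed] at hYt
  rw [polAvg_perturbed, polAvg_perturbed] at hω
  simp only [hsum]
  rw [hb] at hω hYt ⊢
  have hP1 : M.stateMatrix π s1 s1 = 1 - M.stateMatrix π s1 s0 := by linarith
  rw [hP1] at hst
  have hP1' : M.stateMatrix π s1 s0 ≤ 1 := by linarith [hPn s1 s1]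
  have hm := two_state_form_ge hγ M.γ_lt_one rfl h0 hε8 hc0 hcb hbp hpc.le
    (by linarith : wNormSq (stWeight π ε (M.disc π ν)) u - M.γ ^ m * p
      ≤ wNormSq (stWeight π ε (M.truncDisc π ν m)) u) hW (hk s1) (hk s0) hks hY1 hYc (hYu s1)
    (by linarith [mul_nonneg h0 (hYu s0)] : (1 - ε) * b ^ 2
      ≤ (1 - ε) * b ^ 2 + ε * polAvg (unif S A) (fun z => u z ^ 2) s0)
    hYt hω (hν.1 s0) hρ (ho.1 s1) hμ (hPn s1 s0) hP1' hst hP0 rfl (by linarith)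
  have h2 : 0 ≤ (1 - M.γ) * (ε * (M.truncDisc π ν m s0
      * polAvg (unif S A) (fun z => u z ^ 2) s0)) :=
    mul_nonneg hx.le (mul_nonneg h0 (mul_nonneg (hk s0) (hYu s0)))
  have hF : M.γ * M.truncDisc π ν m s1 * M.stateMatrix π s1 s0
      = M.truncDisc π ν m s0 - (1 - M.γ) * (ν s0 - M.γ ^ m * M.occ π ν m s0)
          - M.γ * M.truncDisc π ν m s0 * M.stateMatrix π s0 s0 := by linarith
  rw [hF] at hm
  linarith

/-- Here p is the largest u², attained in `z0.1`; outside that state every u² is at most 1-p. If the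
π-average at `z0.1` is also at most 1-p, the truncation loss is γ^m (p + (1-p)) = γ^m, and 6/7 -
1/√2 > 1/80 suffices. Otherwise b > c, and the gain of transitions into `z0.1` is used. -/
theorem bform_truncDisc_ge_aux (hπ : IsPolicy π) {ε : ℝ} (h0 : 0 ≤ ε) {ν : S → ℝ}
    (hν : IsProbVec ν) (hε : ∀ s, ε ≤ (1 - M.γ) * M.disc π ν s / 4) (m : ℕ) {u : S × A → ℝ}
    (hu : ∑ z, u z ^ 2 ≤ 1)
    (hW : √(Fintype.card S : ℝ) * M.γ ^ m ≤ wNormSq (stWeight π ε (M.disc π ν)) u)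
    (hn : 2 ≤ Fintype.card S) :
    (1 - M.γ) * (wNormSq (stWeight π ε (M.disc π ν)) u / 80)
      ≤ 2 * M.bform π (stWeight π ε (M.truncDisc π ν m)) u u := by
  classical
  have hκ := M.disc_isProbVec hπ hν
  have hx := M.one_sub_γ_pos
  have hγ := M.γ_nonneg
  have hG0 : 0 ≤ M.γ ^ m := pow_nonneg hγ m
  have hn' : (2 : ℝ) ≤ Fintype.card S := by exact_mod_cast hn
  obtain ⟨z0, -, hz0⟩ := exists_max_image univ (fun z => u z ^ 2) univ_nonempty
  have hp : ∀ z, u z ^ 2 ≤ u z0 ^ 2 := fun z => hz0 z (mem_univ z)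
  have hp1 : u z0 ^ 2 ≤ 1 :=
    (single_le_sum (f := fun z => u z ^ 2) (fun z _ => sq_nonneg _) (mem_univ z0)).trans hu
  have hc : ∀ s, s ≠ z0.1 → ∀ a, u (s, a) ^ 2 ≤ 1 - u z0 ^ 2 := by
    intro s hs a
    have hne : (s, a) ≠ z0 := fun h => hs (by rw [← h])
    have := sum_le_sum_of_subset_of_nonneg (subset_univ ({(s, a), z0} : Finset (S × A)))
      (f := fun z => u z ^ 2) fun z _ _ => sq_nonneg _
    rw [sum_pair hne] at this
    linarith
  have hY0 := hπ.polAvg_nonneg (fun z => sq_nonneg (u z)) z0.1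
  have hYp : polAvg π (fun z => u z ^ 2) z0.1 ≤ u z0 ^ 2 :=
    hπ.polAvg_le (h := fun z => u z ^ 2) (s := z0.1) fun a => hp (z0.1, a)
  have hc2 : √(1 - u z0 ^ 2) ^ 2 = 1 - u z0 ^ 2 := Real.sq_sqrt (by linarith)
  have hb2 := Real.sq_sqrt hY0
  rcases le_or_gt (√(polAvg π (fun z => u z ^ 2) z0.1)) (√(1 - u z0 ^ 2)) with hcb | hcb
  · have hYc : ∀ s, polAvg π (fun z => u z ^ 2) s ≤ 1 - u z0 ^ 2 := by
      intro s
      by_cases hs : s = z0.1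
      · rw [hs, ← hb2, ← hc2]
        exact pow_le_pow_left₀ (Real.sqrt_nonneg _) hcb 2
      · exact hπ.polAvg_le (h := fun z => u z ^ 2) (s := s) fun a => hc s hs a
    have h := M.two_mul_bform_truncDisc_ge_of_sq_le hπ h0 hν hε m hp hYc
    refine le_trans (mul_le_mul_of_nonneg_left ?_ hx.le) h
    have hsq : 1.4142 ≤ √(Fintype.card S : ℝ) := Real.le_sqrt_of_sq_le (by norm_num; linarith)
    have hε8 : ε ≤ 1 / 8 := by
      have := M.card_mul_eps_le hκ.2 hε
      nlinarith
    have hW0 := wNormSq_nonneg (stWeight_nonneg hπ h0 (by linarith) hκ.1) u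
    have h1 : 1 / (8 * (1 - ε)) ≤ 1 / 7 :=
      one_div_le_one_div_of_le (by norm_num) (by linarith)
    have h2 := mul_le_mul_of_nonneg_left h1 hW0
    have h3 := mul_le_mul_of_nonneg_right hsq hG0
    linarith
  · rcases hn.eq_or_lt with hn2 | hn3
    · refine M.bform_truncDisc_ge_of_eq_two hπ h0 hν hε m ?_ hn2.symm z0.1 hp (Real.sqrt_nonneg _)
        hcb hb2.symm (hb2.le.trans hYp) hc2 fun s hs a => (hc s hs a).trans hc2.ge
      rwa [← hn2, Nat.cast_ofNat] at hW
    · exact M.bform_truncDisc_ge_of_three_le hπ h0 hν hε m hW hn3 z0.1 hp (sq_nonneg _)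
        (Real.sqrt_nonneg _) hcb hb2.symm (hb2.le.trans hYp) hc2
        fun s hs a => (hc s hs a).trans hc2.ge

/-- Coercivity of the truncated form with at least two states. -/
theorem bform_truncDisc_ge (hπ : IsPolicy π) {ε : ℝ} (h0 : 0 ≤ ε) {ν : S → ℝ}
    (hν : IsProbVec ν) (hε : ∀ s, ε ≤ (1 - M.γ) * M.disc π ν s / 4) (m : ℕ) {u : S × A → ℝ} {U : ℝ}
    (hu : ∑ z, u z ^ 2 ≤ U)
    (hW : √(Fintype.card S : ℝ) * (M.γ ^ m * U) ≤ wNormSq (stWeight π ε (M.disc π ν)) u)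
    (hn : 2 ≤ Fintype.card S) :
    (1 - M.γ) / 160 * wNormSq (stWeight π ε (M.disc π ν)) u
      ≤ M.bform π (stWeight π ε (M.truncDisc π ν m)) u u := by
  have hU0 : 0 ≤ U := (sum_nonneg fun z _ => sq_nonneg (u z)).trans hu
  rcases hU0.eq_or_lt with hU | hU
  · have : u = 0 := by
      funext z
      have := (single_le_sum (f := fun z => u z ^ 2) (fun z _ => sq_nonneg _) (mem_univ z)).trans
        (hu.trans hU.ge)
      exact pow_eq_zero_iff two_ne_zero |>.1 (le_antisymm this (sq_nonneg _))
    simp [this, wNormSq, bform]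
  · have ht : (√U)⁻¹ ^ 2 = U⁻¹ := by rw [inv_pow, Real.sq_sqrt hU0]
    -- Both sides are homogeneous of degree two, so U may be normalised to 1.
    have h := M.bform_truncDisc_ge_aux hπ h0 hν hε m (u := (√U)⁻¹ • u) ?_ ?_ hn
    · rw [bform_smul, wNormSq_smul, ht] at h
      have := mul_le_mul_of_nonneg_left h hU0
      field_simp at this
      linarith
    · simp only [Pi.smul_apply, smul_eq_mul, mul_pow, ht, ← mul_sum]
      rwa [inv_mul_le_iff₀ hU, mul_one]
    · rw [wNormSq_smul, ht, le_inv_mul_iff₀ hU]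
      linarith

end MDP

/-! ### The feature matrix: spectral norm and Gram matrix -/

section Features

variable {Z : Type*} [Fintype Z] {d : ℕ} (Φ : Matrix Z (Fin d) ℝ)

theorem sum_sq_mulVec_le (v : Fin d → ℝ) :
    ∑ z, Φ.mulVec v z ^ 2 ≤ specNorm Φ ^ 2 * (v ⬝ᵥ v) := by
  have h := (Matrix.toEuclideanLin Φ).toContinuousLinearMap.le_opNorm (WithLp.toLp 2 v)
  have h2 := pow_le_pow_left₀ (norm_nonneg _) h 2
  rw [mul_pow, EuclideanSpace.norm_sq_eq, EuclideanSpace.norm_sq_eq] at h2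
  simpa [specNorm, dotProduct, sq] using h2

/-- Apply Φ to its own row φ(z): the entry at z is |φ(z)|², so |φ(z)|⁴ ≤ Ω² |φ(z)|². -/
theorem dotProduct_row_le (z : Z) : Φ z ⬝ᵥ Φ z ≤ specNorm Φ ^ 2 := by
  have h := (single_le_sum (f := fun z' => Φ.mulVec (Φ z) z' ^ 2) (fun _ _ => sq_nonneg _)
    (mem_univ z)).trans (sum_sq_mulVec_le Φ (Φ z))
  have h1 : Φ.mulVec (Φ z) z = Φ z ⬝ᵥ Φ z := rfl
  simp only [h1] at h
  have h0 : 0 ≤ Φ z ⬝ᵥ Φ z := sum_nonneg fun _ _ => mul_self_nonneg _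
  rcases h0.eq_or_lt with h0 | h0
  · rw [← h0]; positivity
  · rw [sq] at h
    exact le_of_mul_le_mul_right h h0

theorem mulVec_injective_of_rank_eq (hΦ : Φ.rank = d) : Function.Injective Φ.mulVec := by
  have h1 := Φ.mulVecLin.finrank_range_add_finrank_ker
  rw [Module.finrank_fin_fun] at h1
  have h2 : Module.finrank ℝ (LinearMap.range Φ.mulVecLin) = d := hΦ
  have h3 : LinearMap.ker Φ.mulVecLin = ⊥ := Submodule.finrank_eq_zero.1 (by omega)
  exact LinearMap.ker_eq_bot.1 h3

variable [DecidableEq Z]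

theorem dotProduct_gram_mulVec (w : Z → ℝ) (v : Fin d → ℝ) :
    v ⬝ᵥ (gram Φ w).mulVec v = wNormSq w (Φ.mulVec v) := by
  rw [gram, ← Matrix.mulVec_mulVec, ← Matrix.mulVec_mulVec, Matrix.dotProduct_mulVec,
    Matrix.vecMul_transpose]
  simp only [dotProduct, Matrix.mulVec_diagonal, wNormSq]
  exact sum_congr rfl fun _ _ => by ring

/-- The Rayleigh quotient bound, by expansion in an eigenbasis of the Gram matrix. -/
theorem muMin_mul_le (w : Z → ℝ) (v : Fin d → ℝ) :
    muMin Φ w * (v ⬝ᵥ v) ≤ wNormSq w (Φ.mulVec v) := by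
  set hA := gram_isHermitian Φ w
  set b := hA.eigenvectorBasis
  have h1 : ∀ j, muMin Φ w ≤ hA.eigenvalues j := fun j => ciInf_le (Finite.bddBelow_range _) j
  set x : EuclideanSpace ℝ (Fin d) := WithLp.toLp 2 v
  set y : EuclideanSpace ℝ (Fin d) := WithLp.toLp 2 ((gram Φ w).mulVec v)
  have h2 : v ⬝ᵥ v = ∑ j, inner ℝ x (b j) * inner ℝ (b j) x := by
    rw [b.sum_inner_mul_inner]
    simp only [x, EuclideanSpace.inner_eq_star_dotProduct, star_trivial]
  have h3 : v ⬝ᵥ (gram Φ w).mulVec v = ∑ j, inner ℝ x (b j) * inner ℝ (b j) y := by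
    rw [b.sum_inner_mul_inner]
    simp [x, y, EuclideanSpace.inner_eq_star_dotProduct, dotProduct_comm]
  have h4 : ∀ j, inner ℝ (b j) y = hA.eigenvalues j * inner ℝ (b j) x := by
    intro j
    have e := hA.mulVec_eigenvectorBasis j
    simp only [EuclideanSpace.inner_eq_star_dotProduct, x, y, star_trivial]
    rw [dotProduct_comm, Matrix.dotProduct_mulVec, ← Matrix.mulVec_transpose]
    have ht : (gram Φ w).transpose = gram Φ w := by
      have := hA
      rwa [Matrix.IsHermitian, Matrix.conjTranspose_eq_transpose_of_trivial] at this
    rw [ht, e, smul_dotProduct, smul_eq_mul, dotProduct_comm]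
  rw [← dotProduct_gram_mulVec, h2, h3, mul_sum]
  refine sum_le_sum fun j _ => ?_
  rw [h4, ← real_inner_comm x (b j)]
  have := mul_le_mul_of_nonneg_right (h1 j) (mul_self_nonneg (inner ℝ (b j) x))
  linarith

theorem muMin_pos (hd : 0 < d) (hΦ : Φ.rank = d) {w : Z → ℝ} (hw : ∀ z, 0 < w z) :
    0 < muMin Φ w := by
  have hinj := mulVec_injective_of_rank_eq Φ hΦ
  have hp : (gram Φ w).PosDef := by
    have := (Matrix.PosDef.diagonal hw).conjTranspose_mul_mul_same hinj
    rwa [Matrix.conjTranspose_eq_transpose_of_trivial] at this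
  have : Nonempty (Fin d) := ⟨⟨0, hd⟩⟩
  obtain ⟨j, hj⟩ := exists_eq_ciInf_of_finite (f := (gram_isHermitian Φ w).eigenvalues)
  rw [muMin, ← hj]
  exact hp.eigenvalues_pos j

theorem isUnit_gram (hΦ : Φ.rank = d) {w : Z → ℝ} (hw : ∀ z, 0 < w z) : IsUnit (gram Φ w) := by
  have := (Matrix.PosDef.diagonal hw).conjTranspose_mul_mul_same (mulVec_injective_of_rank_eq Φ hΦ)
  rw [Matrix.conjTranspose_eq_transpose_of_trivial] at this
  exact this.isUnit

end Features

/-! ### The projected Bellman equation as a linear system -/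

namespace MDP

variable {S A : Type*} [Fintype S] [Fintype A] [DecidableEq S] [DecidableEq A] (M : MDP S A)
variable {π : S → A → ℝ} {d : ℕ} {Φ : Matrix (S × A) (Fin d) ℝ} {w : S × A → ℝ}

/-- The matrix `Φᵀ W (I - γ P^π) Φ` of the projected Bellman equation. -/
def tdMatrix (π : S → A → ℝ) (Φ : Matrix (S × A) (Fin d) ℝ) (w : S × A → ℝ) :
    Matrix (Fin d) (Fin d) ℝ :=
  Φ.transpose * Matrix.diagonal w * (1 - M.γ • M.pairMatrix π) * Φ

theorem dotProduct_transpose_diagonal_mulVec (w h : S × A → ℝ) (v : Fin d → ℝ) :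
    v ⬝ᵥ (Φ.transpose * Matrix.diagonal w).mulVec h = ∑ z, w z * (Φ.mulVec v z * h z) := by
  rw [← Matrix.mulVec_mulVec, Matrix.dotProduct_mulVec, Matrix.vecMul_transpose]
  simp only [dotProduct, Matrix.mulVec_diagonal]
  exact sum_congr rfl fun _ _ => by ring

theorem tdMatrix_mulVec (π : S → A → ℝ) (w : S × A → ℝ) (θ : Fin d → ℝ) :
    (M.tdMatrix π Φ w).mulVec θ = (Φ.transpose * Matrix.diagonal w).mulVec
      (Φ.mulVec θ - M.γ • (M.pairMatrix π).mulVec (Φ.mulVec θ)) := by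
  rw [tdMatrix, ← Matrix.mulVec_mulVec, ← Matrix.mulVec_mulVec, Matrix.sub_mulVec,
    Matrix.one_mulVec, Matrix.smul_mulVec]

theorem dotProduct_tdMatrix_mulVec (π : S → A → ℝ) (w : S × A → ℝ) (v θ : Fin d → ℝ) :
    v ⬝ᵥ (M.tdMatrix π Φ w).mulVec θ = M.bform π w (Φ.mulVec v) (Φ.mulVec θ) := by
  rw [tdMatrix_mulVec, dotProduct_transpose_diagonal_mulVec]
  rfl

/-- Multiplying by the invertible Gram matrix turns the projection into normal equations for the
coefficients. -/
theorem projBellman_iff (hΦ : Φ.rank = d) (hw : ∀ z, 0 < w z) (Q : S × A → ℝ) :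
    ProjBellman M π Φ w Q ↔ ∃ θ, Q = Φ.mulVec θ ∧ (M.tdMatrix π Φ w).mulVec θ
      = (Φ.transpose * Matrix.diagonal w).mulVec fun z => M.c z.1 z.2 := by
  have hu := (Matrix.isUnit_iff_isUnit_det _).1 (isUnit_gram Φ hΦ hw)
  have key : ∀ θ, (M.tdMatrix π Φ w).mulVec θ
      = (Φ.transpose * Matrix.diagonal w).mulVec (fun z => M.c z.1 z.2) ↔
      (gram Φ w).mulVec θ = (Φ.transpose * Matrix.diagonal w).mulVec
        (M.γ • (M.pairMatrix π).mulVec (Φ.mulVec θ) + fun z => M.c z.1 z.2) := fun θ => by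
    rw [tdMatrix_mulVec, Matrix.mulVec_sub, Matrix.mulVec_add, gram, sub_eq_iff_eq_add, add_comm]
    simp only [← Matrix.mulVec_mulVec]
  constructor
  · intro h
    set y := (Φ.transpose * Matrix.diagonal w).mulVec
      (M.γ • (M.pairMatrix π).mulVec Q + fun z => M.c z.1 z.2) with hy
    have hQ : Q = Φ.mulVec ((gram Φ w)⁻¹.mulVec y) := by
      rw [ProjBellman] at h
      simp only [Matrix.mul_assoc, ← Matrix.mulVec_mulVec] at h
      simp only [hy, ← Matrix.mulVec_mulVec]
      exact h
    refine ⟨_, hQ, (key _).2 ?_⟩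
    rw [← hQ, Matrix.mulVec_mulVec, Matrix.mul_nonsing_inv _ hu, Matrix.one_mulVec]
  · rintro ⟨θ, rfl, h⟩
    rw [key] at h
    have h2 := congrArg (gram Φ w)⁻¹.mulVec h
    rw [Matrix.mulVec_mulVec, Matrix.nonsing_inv_mul _ hu, Matrix.one_mulVec] at h2
    rw [ProjBellman]
    simp only [Matrix.mul_assoc, ← Matrix.mulVec_mulVec] at h2 ⊢
    exact congrArg Φ.mulVec h2

/-- Coercivity makes the square matrix of the system injective, hence invertible, as in the
Lax-Milgram lemma. -/
theorem existsUnique_projBellman (hΦ : Φ.rank = d) (hw : ∀ z, 0 < w z) {τ : ℝ} (hτ : 0 < τ)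
    (hco : ∀ u, τ * wNormSq w u ≤ M.bform π w u u) : ∃! Q, ProjBellman M π Φ w Q := by
  have hinj : Function.Injective (M.tdMatrix π Φ w).mulVec := by
    intro θ θ' h
    have h0 : (M.tdMatrix π Φ w).mulVec (θ - θ') = 0 := by rw [Matrix.mulVec_sub, h, sub_self]
    have h1 := M.dotProduct_tdMatrix_mulVec (Φ := Φ) π w (θ - θ') (θ - θ')
    rw [h0, dotProduct_zero] at h1
    have h2 := hco (Φ.mulVec (θ - θ'))
    rw [← h1] at h2
    have h3 : wNormSq w (Φ.mulVec (θ - θ')) = 0 := le_antisymm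
      (nonpos_of_mul_nonpos_right h2 hτ) (wNormSq_nonneg (fun z => (hw z).le) _)
    have h4 : Φ.mulVec (θ - θ') = 0 := by
      funext z
      have := (sum_eq_zero_iff_of_nonneg fun z _ => mul_nonneg (hw z).le (sq_nonneg _)).1 h3 z
        (mem_univ z)
      simpa [(hw z).ne'] using this
    exact sub_eq_zero.1 (mulVec_injective_of_rank_eq Φ hΦ (by simpa using h4))
  have hu := Matrix.mulVec_injective_iff_isUnit.1 hinj
  obtain ⟨θ, hθ⟩ := (Matrix.mulVec_surjective_iff_isUnit.2 hu)
    ((Φ.transpose * Matrix.diagonal w).mulVec fun z => M.c z.1 z.2)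
  refine ⟨Φ.mulVec θ, (M.projBellman_iff hΦ hw _).2 ⟨θ, rfl, hθ⟩, fun Q hQ => ?_⟩
  obtain ⟨θ', rfl, hθ'⟩ := (M.projBellman_iff hΦ hw _).1 hQ
  rw [hinj (hθ'.trans hθ.symm)]

theorem transSum_mono (hπ : IsPolicy π) (hw : ∀ z, 0 ≤ w z) {g h : S × A → S × A → ℝ}
    (hgh : ∀ z z', g z z' ≤ h z z') : M.transSum π w g ≤ M.transSum π w h :=
  sum_le_sum fun z _ => sum_le_sum fun z' _ => mul_le_mul_of_nonneg_left (hgh z z')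
    (mul_nonneg (hw z) (M.pairMatrix_nonneg hπ z z'))

theorem transSum_add (g h : S × A → S × A → ℝ) :
    M.transSum π w (fun z z' => g z z' + h z z') = M.transSum π w g + M.transSum π w h := by
  simp only [transSum, mul_add, sum_add_distrib]

theorem transSum_mul (t : ℝ) (h : S × A → S × A → ℝ) :
    M.transSum π w (fun z z' => t * h z z') = t * M.transSum π w h := by
  simp only [transSum, mul_sum]
  exact sum_congr rfl fun _ _ => sum_congr rfl fun _ _ => by ring

theorem transSum_fst (hπ : IsPolicy π) (h : S × A → ℝ) :
    M.transSum π w (fun z _ => h z) = ∑ z, w z * h z := by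
  simp only [transSum, ← sum_mul, ← mul_sum, M.pairMatrix_sum hπ, mul_one]

theorem transSum_mul_sub (hπ : IsPolicy π) (u v : S × A → ℝ) :
    M.transSum π w (fun z z' => u z * (v z - M.γ * v z')) = M.bform π w u v := by
  simp only [transSum, bform]
  refine sum_congr rfl fun z _ => ?_
  have : ∀ z', w z * M.pairMatrix π z z' * (u z * (v z - M.γ * v z'))
      = M.pairMatrix π z z' * (w z * u z * v z)
        - w z * u z * M.γ * (M.pairMatrix π z z' * v z') := fun z' => by ring
  simp only [this, sum_sub_distrib, ← sum_mul, ← mul_sum, M.pairMatrix_sum hπ, Matrix.mulVec,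
    dotProduct]
  ring

/-- The residual of `Q` in the Bellman equation along a transition. -/
def resid (Q : S × A → ℝ) (z z' : S × A) : ℝ := Q z - M.γ * Q z' - M.c z.1 z.2

theorem transSum_mul_resid (hπ : IsPolicy π) (Q u : S × A → ℝ) :
    M.transSum π w (fun z z' => u z * M.resid Q z z')
      = M.bform π w u Q - ∑ z, w z * (u z * M.c z.1 z.2) := by
  rw [← M.transSum_mul_sub hπ, ← M.transSum_fst hπ, sub_eq_add_neg, ← neg_one_mul, ← transSum_mul,
    ← transSum_add]
  congr 1
  funext z z'
  rw [resid]
  ring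

/-- Galerkin orthogonality: at the fixed point the residual is orthogonal to every feature
combination. Without truncation the operator would have mean zero there. -/
theorem transSum_resid_eq_zero (hπ : IsPolicy π) {θ : Fin d → ℝ}
    (hθ : (M.tdMatrix π Φ w).mulVec θ
      = (Φ.transpose * Matrix.diagonal w).mulVec fun z => M.c z.1 z.2) (v : Fin d → ℝ) :
    M.transSum π w (fun z z' => Φ.mulVec v z * M.resid (Φ.mulVec θ) z z') = 0 := by
  rw [M.transSum_mul_resid hπ, ← dotProduct_tdMatrix_mulVec, hθ,
    dotProduct_transpose_diagonal_mulVec, sub_self]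

end MDP

/-! ### Size of the fixed point, its residual, and the truncation bias -/

namespace MDP

variable {S A : Type*} [Fintype S] [Fintype A] [DecidableEq S] [DecidableEq A] (M : MDP S A)
variable {π : S → A → ℝ}

theorem sum_mul_cost_sq_le {w : S × A → ℝ} (hw : ∀ z, 0 ≤ w z) (hw1 : ∑ z, w z ≤ 1) :
    ∑ z, w z * M.c z.1 z.2 ^ 2 ≤ 1 :=
  (sum_le_sum fun z _ => mul_le_of_le_one_right (hw z)
    (pow_le_one₀ (M.c_nonneg _ _) (M.c_le_one _ _))).trans hw1

variable [Nonempty A] [Nonempty S]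

theorem sum_stWeight_le (hπ : IsPolicy π) {ε : ℝ} (h0 : 0 ≤ ε) (h1 : ε ≤ 1) (κ : S → ℝ) :
    ∑ z, stWeight π ε κ z = ∑ s, κ s := by
  have := sum_stWeight_mul π ε κ fun _ => 1
  simpa [polAvg, (perturbed_isPolicy hπ h0 h1).2] using this

/-- Size of the solution of the projected Bellman equation. -/
theorem wNormSq_le_of_bform_eq (hπ : IsPolicy π) {ε : ℝ} (h0 : 0 ≤ ε) {ν : S → ℝ}
    (hν : IsProbVec ν) (hε : ∀ s, ε ≤ (1 - M.γ) * M.disc π ν s / 4) {Q : S × A → ℝ}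
    (hQ : M.bform π (stWeight π ε (M.disc π ν)) Q Q
      = ∑ z, stWeight π ε (M.disc π ν) z * (Q z * M.c z.1 z.2)) :
    wNormSq (stWeight π ε (M.disc π ν)) Q ≤ 9 / (1 - M.γ) ^ 2 := by
  have hκ := M.disc_isProbVec hπ hν
  have hx := M.one_sub_γ_pos
  have hγ := M.γ_nonneg
  have hε4 := M.eps_le h0 hκ.2 hε
  have hw := stWeight_nonneg hπ h0 (by linarith) hκ.1
  have h1 := M.bform_disc_ge hπ h0 hν hε Q
  have hc := M.sum_mul_cost_sq_le hw
    ((sum_stWeight_le hπ h0 (by linarith) _).trans hκ.2).le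
  set w := stWeight π ε (M.disc π ν)
  have h2 : (1 - M.γ) * ∑ z, w z * (Q z * M.c z.1 z.2)
      ≤ (1 - M.γ) ^ 2 / 6 * wNormSq w Q + 3 / 2 * ∑ z, w z * M.c z.1 z.2 ^ 2 := by
    simp only [wNormSq, mul_sum, ← sum_add_distrib]
    refine sum_le_sum fun z _ => ?_
    have := mul_nonneg (hw z) (sq_nonneg ((1 - M.γ) * Q z - 3 * M.c z.1 z.2))
    linarith
  rw [le_div_iff₀ (by positivity)]
  have h3 := mul_le_mul_of_nonneg_left h1 hx.le
  rw [hQ] at h3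
  linarith

/-- Second moment of the residual of the solution of the projected Bellman equation. -/
theorem transSum_resid_sq_le (hπ : IsPolicy π) {ε : ℝ} (h0 : 0 ≤ ε) {ν : S → ℝ}
    (hν : IsProbVec ν) (hε : ∀ s, ε ≤ (1 - M.γ) * M.disc π ν s / 4) {Q : S × A → ℝ}
    (hQ : M.bform π (stWeight π ε (M.disc π ν)) Q Q
      = ∑ z, stWeight π ε (M.disc π ν) z * (Q z * M.c z.1 z.2)) :
    M.transSum π (stWeight π ε (M.disc π ν)) (fun z z' => M.resid Q z z' ^ 2)
      ≤ 7 / (1 - M.γ) := by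
  have hκ := M.disc_isProbVec hπ hν
  have hx := M.one_sub_γ_pos
  have hγ := M.γ_nonneg
  have hγ1 := M.γ_lt_one
  have hε4 := M.eps_le h0 hκ.2 hε
  have hw := stWeight_nonneg hπ h0 (by linarith) hκ.1
  have hW := M.wNormSq_le_of_bform_eq hπ h0 hν hε hQ
  have h1 := M.transSum_sq_disc_le hπ h0 hν hε Q
  obtain ⟨s1, hs1⟩ := exists_max_polAvg π Q
  have hB0 := hπ.polAvg_nonneg (fun z => sq_nonneg (Q z)) s1
  have hB := M.exploration_le hπ h0 (by linarith) hκ.1 hε Q s1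
  have h2 := M.gamma_transSum_next_le h0 hκ.1 hκ.2.le (M.disc_flow hπ hν) Q hs1 hB0
  have h3 : 0 ≤ ∑ s, ν s * polAvg π (fun z => Q z ^ 2) s :=
    sum_nonneg fun s _ => mul_nonneg (hν.1 s) (hπ.polAvg_nonneg (fun _ => sq_nonneg _) s)
  have h4 := mul_nonneg (mul_nonneg (by linarith : 0 ≤ 1 - ε) hx.le) h3
  have hs := (sum_stWeight_le hπ h0 (by linarith) (M.disc π ν)).trans hκ.2
  have hW0 := wNormSq_nonneg hw Q
  set w := stWeight π ε (M.disc π ν)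
  set x := 1 - M.γ with hx'
  have hB' : x * wNormSq w Q / (4 * (1 - ε)) ≤ x * wNormSq w Q / 3 :=
    div_le_div_of_nonneg_left (mul_nonneg hx.le hW0) (by norm_num) (by linarith)
  have h5 : ε * M.γ * polAvg π (fun z => Q z ^ 2) s1 ≤ ε * polAvg π (fun z => Q z ^ 2) s1 := by
    have := mul_le_mul_of_nonneg_left hγ1.le (mul_nonneg h0 hB0)
    linarith
  have h6 : M.γ * M.transSum π w (fun _ z' => Q z' ^ 2) ≤ (1 + x / 3) * wNormSq w Q := by
    linarith
  have h7 : M.transSum π w (fun z z' => M.resid Q z z' ^ 2)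
      ≤ M.transSum π w (fun z z' => (Q z - M.γ * Q z') ^ 2)
        + (M.transSum π w (fun z _ => -2 * (Q z * M.c z.1 z.2))
        + (x / 4 * (M.γ * M.transSum π w (fun _ z' => Q z' ^ 2))
          + M.transSum π w (fun _ _ => 4 * M.γ / x + 1))) := by
    rw [← mul_assoc, ← transSum_mul, ← transSum_add, ← transSum_add, ← transSum_add]
    refine M.transSum_mono hπ hw fun z z' => ?_
    have hc := M.c_nonneg z.1 z.2
    have hc1 := M.c_le_one z.1 z.2
    have e1 : M.c z.1 z.2 ^ 2 ≤ 1 := pow_le_one₀ hc hc1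
    -- Since ‖Q‖² is O(1/x²), the weight x/4 makes both terms of order 1/x.
    have e2 : 2 * M.c z.1 z.2 * Q z' ≤ x / 4 * Q z' ^ 2 + 4 / x := by
      have := sq_nonneg (x / 4 * Q z' - M.c z.1 z.2)
      have e3 : x / 4 * Q z' ^ 2 + 4 / x - 2 * M.c z.1 z.2 * Q z'
          = 4 / x * ((x / 4 * Q z' - M.c z.1 z.2) ^ 2 + (1 - M.c z.1 z.2 ^ 2)) := by
        field_simp
        ring
      have : 0 ≤ 4 / x * ((x / 4 * Q z' - M.c z.1 z.2) ^ 2 + (1 - M.c z.1 z.2 ^ 2)) := by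
        have : 0 ≤ 1 - M.c z.1 z.2 ^ 2 := by linarith
        positivity
      linarith
    have e3 := mul_le_mul_of_nonneg_left e2 hγ
    have e4 : M.γ * (4 / x) = 4 * M.γ / x := by ring
    rw [resid]
    linarith
  rw [M.transSum_fst hπ, M.transSum_fst hπ (fun _ => 4 * M.γ / x + 1), ← sum_mul, hs, one_mul] at h7
  -- By the fixed-point equation the cross term with the cost cancels the bound 2·`bform` on the
  -- second moment of Q - γQ'. This is why the residual is O(1/x) and not O(1/x²).
  have h8 : ∑ z, w z * (-2 * (Q z * M.c z.1 z.2)) = -2 * M.bform π w Q Q := by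
    rw [hQ, mul_sum]
    exact sum_congr rfl fun _ _ => by ring
  rw [h8] at h7
  have h9 : x / 4 * ((1 + x / 3) * wNormSq w Q) ≤ x / 4 * ((1 + x / 3) * (9 / x ^ 2)) := by
    gcongr
  have h10 := mul_le_mul_of_nonneg_left h6 (by positivity : 0 ≤ x / 4)
  refine (by linarith : M.transSum π w (fun z z' => M.resid Q z z' ^ 2)
    ≤ x / 4 * ((1 + x / 3) * (9 / x ^ 2)) + (4 * M.γ / x + 1)).trans ?_
  have hγx : M.γ = 1 - x := by rw [hx']; ring
  rw [hγx]
  have : x / 4 * ((1 + x / 3) * (9 / x ^ 2)) + (4 * (1 - x) / x + 1)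
      = (6.25 - 2.25 * x) / x := by
    field_simp
    ring
  rw [this]
  gcongr
  linarith

theorem stWeight_truncDisc (hπ : IsPolicy π) (ε : ℝ) {ν : S → ℝ} (hν : IsProbVec ν) (m : ℕ)
    (z : S × A) :
    stWeight π ε (M.disc π ν) z = stWeight π ε (M.truncDisc π ν m) z
      + M.γ ^ m * stWeight π ε (M.disc π (M.occ π ν m)) z := by
  rw [stWeight, M.disc_eq_truncDisc_add hπ hν m, stWeight, stWeight]
  ring

theorem transSum_truncDisc (hπ : IsPolicy π) (ε : ℝ) {ν : S → ℝ} (hν : IsProbVec ν) (m : ℕ)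
    (h : S × A → S × A → ℝ) :
    M.transSum π (stWeight π ε (M.disc π ν)) h
      = M.transSum π (stWeight π ε (M.truncDisc π ν m)) h
        + M.γ ^ m * M.transSum π (stWeight π ε (M.disc π (M.occ π ν m))) h := by
  simp only [transSum, M.stWeight_truncDisc hπ ε hν m, mul_sum, ← sum_add_distrib]
  exact sum_congr rfl fun _ _ => sum_congr rfl fun _ _ => by ring

theorem transSum_truncDisc_le (hπ : IsPolicy π) {ε : ℝ} (h0 : 0 ≤ ε) (h1 : ε ≤ 1) {ν : S → ℝ}
    (hν : IsProbVec ν) (m : ℕ) {h : S × A → S × A → ℝ} (hh : ∀ z z', 0 ≤ h z z') :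
    M.transSum π (stWeight π ε (M.truncDisc π ν m)) h
      ≤ M.transSum π (stWeight π ε (M.disc π ν)) h := by
  rw [M.transSum_truncDisc hπ ε hν m]
  have hκ := M.disc_isProbVec hπ (M.occ_isProbVec hπ hν m)
  have : 0 ≤ M.transSum π (stWeight π ε (M.disc π (M.occ π ν m))) h :=
    sum_nonneg fun z _ => sum_nonneg fun z' _ => mul_nonneg
      (mul_nonneg (stWeight_nonneg hπ h0 h1 hκ.1 z) (M.pairMatrix_nonneg hπ z z')) (hh z z')
  have := mul_nonneg (pow_nonneg M.γ_nonneg m) this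
  linarith

/-- Bias of the truncated operator. -/
theorem transSum_truncDisc_resid_ge (hπ : IsPolicy π) {ε : ℝ} (h0 : 0 ≤ ε) (h1 : ε ≤ 1) {ν : S → ℝ}
    (hν : IsProbVec ν) (m : ℕ) {g : S × A → S × A → ℝ} {u : S × A → ℝ} {U R t : ℝ}
    (hu : ∀ z, u z ^ 2 ≤ U) (ht : 0 < t)
    (hg : M.transSum π (stWeight π ε (M.disc π ν)) (fun z z' => g z z' ^ 2) ≤ R)
    (hz : M.transSum π (stWeight π ε (M.disc π ν)) (fun z z' => u z * g z z') = 0) :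
    -(t * (M.γ ^ m * U) + R / t)
      ≤ 2 * M.transSum π (stWeight π ε (M.truncDisc π ν m)) (fun z z' => u z * g z z') := by
  have hκ := M.disc_isProbVec hπ (M.occ_isProbVec hπ hν m)
  have hk := M.truncDisc_nonneg hπ hν m
  have hw := stWeight_nonneg hπ h0 h1 hκ.1
  have hw' := stWeight_nonneg hπ h0 h1 hk
  have hG0 : 0 ≤ M.γ ^ m := pow_nonneg M.γ_nonneg m
  rw [M.transSum_truncDisc hπ ε hν m] at hg hz
  -- As the full sum vanishes, the truncated sum is minus the tail, which is bounded by Young's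
  -- inequality. The parameter t stays free and is chosen by the users.
  have h2 : M.transSum π (stWeight π ε (M.disc π (M.occ π ν m))) (fun z z' => 2 * (u z * g z z'))
      ≤ M.transSum π (stWeight π ε (M.disc π (M.occ π ν m))) (fun z z' => t * U + t⁻¹ * g z z' ^ 2) := by
    refine M.transSum_mono hπ hw fun z z' => ?_
    have e := mul_le_mul_of_nonneg_left (hu z) ht.le
    have e2 : t * u z ^ 2 + t⁻¹ * g z z' ^ 2 - 2 * (u z * g z z') = t⁻¹ * (t * u z - g z z') ^ 2 := by
      field_simp
      ring
    have : 0 ≤ t⁻¹ * (t * u z - g z z') ^ 2 := by positivity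
    linarith
  rw [transSum_add, transSum_mul, transSum_mul, transSum_mul, M.transSum_fst hπ (fun _ => U), ← sum_mul,
    sum_stWeight_le hπ h0 h1, hκ.2, one_mul] at h2
  have h3 : 0 ≤ M.transSum π (stWeight π ε (M.truncDisc π ν m)) (fun z z' => g z z' ^ 2) :=
    sum_nonneg fun z _ => sum_nonneg fun z' _ => mul_nonneg
      (mul_nonneg (hw' z) (M.pairMatrix_nonneg hπ z z')) (sq_nonneg _)
  have h4 := mul_le_mul_of_nonneg_left h2 hG0
  have h5 := mul_le_mul_of_nonneg_left
    (by linarith : M.γ ^ m * M.transSum π (stWeight π ε (M.disc π (M.occ π ν m)))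
      (fun z z' => g z z' ^ 2) ≤ R) (inv_nonneg.2 ht.le)
  rw [div_eq_inv_mul]
  linarith

end MDP

/-! ### The law of a sampled transition given the past -/

section Fibers

variable {Ω : Type*} [MeasurableSpace Ω] {μ : Measure Ω} [IsFiniteMeasure μ]

theorem sum_real_inter_fiber {T : Type*} [Fintype T] {f : Ω → T}
    (hf : ∀ x, MeasurableSet {ω | f ω = x}) {C : Set Ω} (hC : MeasurableSet C) :
    ∑ x, μ.real (C ∩ {ω | f ω = x}) = μ.real C := by
  rw [← measureReal_iUnion_fintype]
  · congr 1
    ext ω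
    simp
  · intro x y hxy
    refine Set.disjoint_left.2 fun ω h1 h2 => hxy ?_
    exact h1.2.symm.trans h2.2
  · exact fun x => hC.inter (hf x)

/-- A conditional probability that does not depend on the piece survives a countable partition. The
pieces will be the possible hitting times. -/
theorem real_inter_eq_mul_of_cover {B : ℕ → Set Ω} {D F : Set Ω} {q : ℝ}
    (hB : ∀ h, MeasurableSet (B h)) (hBD : ∀ h, MeasurableSet (B h ∩ D))
    (hd : Pairwise (Function.onFun Disjoint B)) (hF : F =ᵐ[μ] ⋃ h, B h)
    (hq : ∀ h, μ.real (B h ∩ D) = μ.real (B h) * q) : μ.real (F ∩ D) = μ.real F * q := by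
  have h1 : μ.real F = ∑' h, μ.real (B h) := by
    rw [measureReal_congr hF, Measure.real, measure_iUnion hd hB,
      ENNReal.tsum_toReal_eq fun h => measure_ne_top μ _]
    rfl
  have h2 : μ.real (F ∩ D) = ∑' h, μ.real (B h ∩ D) := by
    have : (F ∩ D : Set Ω) =ᵐ[μ] ⋃ h, (B h ∩ D) := by
      rw [← Set.iUnion_inter]
      exact hF.inter (ae_eq_refl D)
    rw [measureReal_congr this, Measure.real, measure_iUnion _ hBD,
      ENNReal.tsum_toReal_eq fun h => measure_ne_top μ _]
    · rfl
    · exact fun i j hij => (hd hij).mono Set.inter_subset_left Set.inter_subset_left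
  rw [h1, h2, ← tsum_mul_right]
  exact tsum_congr hq

end Fibers

namespace CTDRun

variable {S A : Type*} [Fintype S] [Fintype A] [DecidableEq S]
  {M : MDP S A} {π : S → A → ℝ} {sor : S} {f : ℝ} {m : ℕ} {εS εA : ℝ}
  {Ω : Type*} [MeasurableSpace Ω] {ℙ : Measure Ω}

variable (X : CTDRun M π sor f m εS εA ℙ)

theorem ℱ_mono {i k k' : ℕ} (h : k ≤ k') : X.ℱ i k ≤ X.ℱ i k' := by
  induction k', h using Nat.le_induction with
  | base => exact le_rfl
  | succ n _ ih => exact fun E hE => X.ℱ_step i n E (ih E hE)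

theorem ℱ_iter_mono {i j k : ℕ} (h : i < j) : X.ℱ i k ≤ X.ℱ j 0 := by
  induction j, h using Nat.le_induction with
  | base => exact X.ℱ_iter i k
  | succ n _ ih => exact fun E hE => X.ℱ_iter n 0 E (ih E hE)

/-- The event that iteration `i` has origin `g`, which is first visited at time `h`, and length
`l`. -/
def hitEvent (i : ℕ) (g : S) (l h : ℕ) : Set Ω :=
  {ω | (X.origin i ω = g ∧ X.len i ω = l) ∧ (∀ k < h, X.st i k ω ≠ g) ∧ X.st i h ω = g}

variable {X} in
theorem hitTime_of_mem {i : ℕ} {g : S} {l h : ℕ} {ω : Ω} (hω : ω ∈ X.hitEvent i g l h) :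
    hitTime (fun n => X.st i n ω) (X.origin i ω) = h := by
  obtain ⟨⟨ho, -⟩, h1, h2⟩ := hω
  rw [ho]
  refine le_antisymm (Nat.sInf_le h2) ?_
  have hne : {n | X.st i n ω = g}.Nonempty := ⟨h, h2⟩
  by_contra hlt
  exact h1 _ (not_le.1 hlt) (Nat.sInf_mem hne)

variable {X} in
theorem obsTime_of_mem {i : ℕ} {g : S} {l h : ℕ} {ω : Ω} (hω : ω ∈ X.hitEvent i g l h) :
    X.obsTime i ω = h + l := by
  rw [obsTime, hitTime_of_mem hω, hω.1.2]

theorem measurableSet_sample (i : ℕ) (g : S) (l : ℕ) :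
    MeasurableSet[X.ℱ i 1] {ω | X.origin i ω = g ∧ X.len i ω = l} :=
  (X.meas_origin i g).inter (X.meas_len i l)

theorem measurableSet_hitEvent (i : ℕ) (g : S) (l h : ℕ) :
    MeasurableSet[X.ℱ i (2 * h + 1)] (X.hitEvent i g l h) := by
  have h1 : MeasurableSet[X.ℱ i (2 * h + 1)] {ω | ∀ k < h, X.st i k ω ≠ g} := by
    have : {ω | ∀ k < h, X.st i k ω ≠ g} = ⋂ k ∈ Set.Iio h, {ω | X.st i k ω = g}ᶜ := by
      ext ω; simp
    rw [this]
    exact MeasurableSet.biInter (Set.to_countable _) fun k hk =>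
      (X.ℱ_mono (by have := Set.mem_Iio.1 hk; omega) _ (X.meas_st i k g)).compl
  exact (X.ℱ_mono (by omega) _ (X.measurableSet_sample i g l)).inter (h1.inter (X.meas_st i h g))

variable {X} in
theorem behavior_of_mem {i : ℕ} {g : S} {l h : ℕ} {ω : Ω} (hω : ω ∈ X.hitEvent i g l h)
    (πS πA : S → A → ℝ) (j : ℕ) :
    behavior π πS πA (fun k => X.st i k ω) (X.origin i ω) (X.len i ω) (h + j)
      = if j = l then πA else π := by
  have h1 : ¬ ∀ k ≤ h + j, X.st i k ω ≠ X.origin i ω := fun hk =>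
    hk h (by omega) (hω.2.2.trans hω.1.1.symm)
  rw [behavior, if_neg h1, hitTime_of_mem hω, hω.1.2]
  simp

theorem real_inter_action {i : ℕ} {g : S} {l h j : ℕ} (hl : l < m) {C : Set Ω}
    (hC : MeasurableSet[X.ℱ i (2 * (h + j) + 1)] C) (hCB : C ⊆ X.hitEvent i g l h) (s : S) (a : A) :
    ℙ.real ((C ∩ {ω | X.st i (h + j) ω = s}) ∩ {ω | X.ac i (h + j) ω = a})
      = ℙ.real (C ∩ {ω | X.st i (h + j) ω = s}) * (if j = l then perturbed π εA else π) s a :=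
  X.law_action i (h + j) s a _ _ (hC.inter (X.meas_st i (h + j) s)) fun _ hω =>
    ⟨(hCB hω.1).1.2.trans_lt hl, hω.2, behavior_of_mem (hCB hω.1) _ _ j⟩

theorem real_inter_next {i : ℕ} {g : S} {l h j : ℕ} (hl : l < m) {C : Set Ω}
    (hC : MeasurableSet[X.ℱ i (2 * (h + j) + 1)] C) (hCB : C ⊆ X.hitEvent i g l h) (s : S) (a : A)
    (s' : S) :
    ℙ.real (((C ∩ {ω | X.st i (h + j) ω = s}) ∩ {ω | X.ac i (h + j) ω = a})
        ∩ {ω | X.st i (h + j + 1) ω = s'})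
      = ℙ.real (C ∩ {ω | X.st i (h + j) ω = s}) * (if j = l then perturbed π εA else π) s a
        * M.P s a s' := by
  rw [← X.real_inter_action hl hC hCB]
  refine X.law_trans i (h + j) s a s' _ ?_ fun _ hω =>
    ⟨(hCB hω.1.1).1.2.trans_lt hl, hω.1.2, hω.2⟩
  exact (X.ℱ_step i _ _ (hC.inter (X.meas_st i (h + j) s))).inter (X.meas_ac i (h + j) a)

/-- The Markov property after the first visit at time h. During the next l steps the policy in force
is π: the exploratory action is drawn only at step l, after the l-th state has been reached. -/
theorem real_inter_state [IsProbabilityMeasure ℙ] {i : ℕ} {g : S} {l h j : ℕ} (hl : l < m)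
    {C : Set Ω} (hC : MeasurableSet[X.ℱ i (2 * h + 1)] C) (hCB : C ⊆ X.hitEvent i g l h)
    (hj : j ≤ l) (s : S) :
    ℙ.real (C ∩ {ω | X.st i (h + j) ω = s}) = ℙ.real C * M.occ π (Pi.single g 1) j s := by
  induction j generalizing s with
  | zero =>
    rw [add_zero, MDP.occ_zero]
    by_cases hs : s = g
    · have : C ∩ {ω | X.st i h ω = s} = C :=
        Set.inter_eq_left.2 fun ω hω => (hCB hω).2.2.trans hs.symm
      rw [this, hs, Pi.single_eq_same, mul_one]
    · rw [Pi.single_eq_of_ne hs, mul_zero]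
      have : C ∩ {ω | X.st i h ω = s} = ∅ :=
        Set.eq_empty_of_forall_notMem fun ω hω => hs (hω.2.symm.trans (hCB hω.1).2.2)
      rw [this, measureReal_empty]
  | succ j ih =>
    have hC' : MeasurableSet[X.ℱ i (2 * (h + j) + 1)] C := X.ℱ_mono (by omega) _ hC
    have hm : ∀ s, MeasurableSet {ω | X.st i (h + j) ω = s} := fun s =>
      X.ℱ_le _ _ _ (X.meas_st i _ s)
    have hm' : ∀ a, MeasurableSet {ω | X.ac i (h + j) ω = a} := fun a =>
      X.ℱ_le _ _ _ (X.meas_ac i _ a)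
    have hs' : MeasurableSet (C ∩ {ω | X.st i (h + j + 1) ω = s}) :=
      (X.ℱ_le _ _ _ hC).inter (X.ℱ_le _ _ _ (X.meas_st i _ s))
    rw [← add_assoc, ← sum_real_inter_fiber hm hs', MDP.occ_succ_apply, mul_sum]
    refine sum_congr rfl fun q _ => ?_
    rw [← sum_real_inter_fiber hm' (hs'.inter (hm q)), ← mul_assoc, ← ih (by omega) q,
      MDP.stateMatrix, Matrix.of_apply, mul_sum]
    refine sum_congr rfl fun a _ => ?_
    have e : (C ∩ {ω | X.st i (h + j + 1) ω = s}) ∩ {ω | X.st i (h + j) ω = q}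
        ∩ {ω | X.ac i (h + j) ω = a} = ((C ∩ {ω | X.st i (h + j) ω = q})
        ∩ {ω | X.ac i (h + j) ω = a}) ∩ {ω | X.st i (h + j + 1) ω = s} := by
      ext ω; simp only [Set.mem_inter_iff]; tauto
    rw [e, X.real_inter_next hl hC' hCB, if_neg (by omega), mul_assoc]

/-- Law of the sampled transition, given the past and the first visit of the origin. -/
theorem real_inter_transition [IsProbabilityMeasure ℙ] {i : ℕ} {g : S} {l h : ℕ} (hl : l < m)
    {C : Set Ω} (hC : MeasurableSet[X.ℱ i (2 * h + 1)] C) (hCB : C ⊆ X.hitEvent i g l h)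
    (z z' : S × A) :
    ℙ.real (C ∩ {ω | X.pair i (h + l) ω = z ∧ X.pair i (h + l + 1) ω = z'})
      = ℙ.real C * (M.occ π (Pi.single g 1) l z.1 * perturbed π εA z.1 z.2
        * M.pairMatrix π z z') := by
  obtain ⟨s, a⟩ := z
  obtain ⟨s', a'⟩ := z'
  have hC' : MeasurableSet[X.ℱ i (2 * (h + l) + 1)] C := X.ℱ_mono (by omega) _ hC
  have h1 := X.real_inter_next hl hC' hCB s a s'
  rw [if_pos rfl, X.real_inter_state hl hC hCB le_rfl] at h1
  have hD : MeasurableSet[X.ℱ i (2 * (h + (l + 1)) + 1)]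
      ((C ∩ {ω | X.st i (h + l) ω = s}) ∩ {ω | X.ac i (h + l) ω = a}) :=
    ((X.ℱ_mono (by omega) _ hC).inter (X.ℱ_mono (by omega) _ (X.meas_st i (h + l) s))).inter
      (X.ℱ_mono (by omega) _ (X.meas_ac i (h + l) a))
  -- One step after the exploratory action the policy is π again, since l + 1 ≠ l; hence the factor
  -- π(a'|s') of `pairMatrix`.
  have h2 := X.real_inter_action hl hD (fun ω hω => hCB hω.1.1) s' a'
  rw [if_neg (by omega), ← add_assoc, h1] at h2
  have e : C ∩ {ω | X.pair i (h + l) ω = (s, a) ∧ X.pair i (h + l + 1) ω = (s', a')}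
      = (((C ∩ {ω | X.st i (h + l) ω = s}) ∩ {ω | X.ac i (h + l) ω = a})
        ∩ {ω | X.st i (h + l + 1) ω = s'}) ∩ {ω | X.ac i (h + l + 1) ω = a'} := by
    ext ω
    simp only [Set.mem_inter_iff, Set.mem_ofPred_eq, pair, Prod.mk.injEq]
    tauto
  rw [e, h2, MDP.pairMatrix, Matrix.of_apply]
  ring

/-- The transition used by iteration `i`, if any. -/
def sample (i : ℕ) (ω : Ω) : Option ((S × A) × (S × A)) :=
  if X.len i ω < m then some (X.pair i (X.obsTime i ω) ω, X.pair i (X.obsTime i ω + 1) ω) else none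

theorem measurableSet_pair (i n : ℕ) (z : S × A) :
    MeasurableSet[X.ℱ i (2 * n + 2)] {ω | X.pair i n ω = z} := by
  have : {ω | X.pair i n ω = z} = {ω | X.st i n ω = z.1} ∩ {ω | X.ac i n ω = z.2} := by
    ext ω; simp [pair, Prod.ext_iff]
  rw [this]
  exact (X.ℱ_step _ _ _ (X.meas_st i n z.1)).inter (X.meas_ac i n z.2)

/-- The law of the transition does not depend on the hitting time, so summing over it removes it.
This is where almost sure finiteness of the visit enters: the hitting events exhaust the event up to
a null set. -/
theorem real_inter_obs [IsProbabilityMeasure ℙ] {i : ℕ}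
    (hr : ∀ᵐ ω ∂ℙ, X.len i ω < m → ∃ n, X.st i n ω = X.origin i ω) {g : S} {l : ℕ} (hl : l < m)
    {E : Set Ω} (hE : MeasurableSet[X.ℱ i 0] E) (z z' : S × A) :
    ℙ.real ((E ∩ {ω | X.origin i ω = g ∧ X.len i ω = l}) ∩ {ω | X.sample i ω = some (z, z')})
      = ℙ.real E * MDP.originDist S sor f g * ((1 - M.γ) * M.γ ^ l)
        * (M.occ π (Pi.single g 1) l z.1 * perturbed π εA z.1 z.2 * M.pairMatrix π z z') := by
  have hC : ∀ h, MeasurableSet[X.ℱ i (2 * h + 1)] (E ∩ X.hitEvent i g l h) := fun h =>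
    (X.ℱ_mono (by omega) _ hE).inter (X.measurableSet_hitEvent i g l h)
  have hrec : ∀ h, (E ∩ X.hitEvent i g l h) ∩ {ω | X.sample i ω = some (z, z')}
      = (E ∩ X.hitEvent i g l h)
        ∩ {ω | X.pair i (h + l) ω = z ∧ X.pair i (h + l + 1) ω = z'} := by
    intro h
    ext ω
    simp only [Set.mem_inter_iff, Set.mem_ofPred_eq, and_congr_right_iff, and_imp]
    intro _ hω
    rw [sample, if_pos (hω.1.2.trans_lt hl), obsTime_of_mem hω]
    simp
  rw [real_inter_eq_mul_of_cover (B := fun h => E ∩ X.hitEvent i g l h)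
    (q := M.occ π (Pi.single g 1) l z.1 * perturbed π εA z.1 z.2 * M.pairMatrix π z z'),
    X.law_sample i g l E hE]
  · rfl
  · exact fun h => X.ℱ_le _ _ _ (hC h)
  · intro h
    rw [hrec]
    exact (X.ℱ_le _ _ _ (hC h)).inter ((X.ℱ_le _ _ _ (X.measurableSet_pair i _ z)).inter
      (X.ℱ_le _ _ _ (X.measurableSet_pair i _ z')))
  · refine fun h h' hne => Set.disjoint_left.2 fun ω h1 h2 => hne ?_
    exact (hitTime_of_mem h1.2).symm.trans (hitTime_of_mem h2.2)
  · filter_upwards [hr] with ω hω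
    refine propext ⟨fun h1 => ?_, fun h1 => ?_⟩
    · have hex := hω (h1.2.2.trans_lt hl)
      rw [h1.2.1] at hex
      classical
      exact Set.mem_iUnion.2 ⟨Nat.find hex, h1.1, h1.2, fun k hk => Nat.find_min hex hk,
        Nat.find_spec hex⟩
    · obtain ⟨h, h2⟩ := Set.mem_iUnion.1 h1
      exact ⟨h2.1, h2.2.1⟩
  · intro h
    rw [hrec]
    exact X.real_inter_transition hl (hC h) Set.inter_subset_right z z'

end CTDRun

/-! ### Measurability, the one-step law and finite histories -/

section Fibers

variable {Ω : Type*} [MeasurableSpace Ω] {μ : Measure Ω} [IsFiniteMeasure μ]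

theorem comp_eq_sum_indicator {T : Type*} [Fintype T] (f : Ω → T) (y : T → ℝ) :
    (fun ω => y (f ω)) = fun ω => ∑ x, {ω | f ω = x}.indicator (fun _ => y x) ω := by
  classical
  funext ω
  simp [Set.indicator_apply]

theorem integrable_comp_of_fiber {T : Type*} [Fintype T] {f : Ω → T}
    (hf : ∀ x, MeasurableSet {ω | f ω = x}) (y : T → ℝ) : Integrable (fun ω => y (f ω)) μ := by
  rw [comp_eq_sum_indicator]
  exact integrable_finsetSum _ fun x _ => (integrable_const _).indicator (hf x)

theorem integral_comp_of_fiber {T : Type*} [Fintype T] {f : Ω → T}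
    (hf : ∀ x, MeasurableSet {ω | f ω = x}) (y : T → ℝ) :
    ∫ ω, y (f ω) ∂μ = ∑ x, μ.real {ω | f ω = x} * y x := by
  rw [comp_eq_sum_indicator,
    integral_finsetSum _ fun x _ => (integrable_const _).indicator (hf x)]
  exact sum_congr rfl fun x _ => by rw [integral_indicator_const _ (hf x), smul_eq_mul]

end Fibers

/-- Allows reading a process at a random time or target with countably many values. -/
theorem measurableSet_fiber_comp {Ω T U : Type*} {m0 : MeasurableSpace Ω} [Countable T] {f : Ω → T}
    (hf : ∀ x, MeasurableSet[m0] {ω | f ω = x}) {F : T → Ω → U} {y : U}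
    (hF : ∀ x, MeasurableSet[m0] {ω | F x ω = y}) : MeasurableSet[m0] {ω | F (f ω) ω = y} := by
  have : {ω | F (f ω) ω = y} = ⋃ x, {ω | f ω = x} ∩ {ω | F x ω = y} := by
    ext ω; simp
  rw [this]
  exact MeasurableSet.iUnion fun x => (hf x).inter (hF x)

/-- The infimum of the empty set is 0, so a path that never visits `g` has hitting time 0. This case
is needed because measurability is proved on all of the sample space. -/
theorem hitTime_eq_iff {S : Type*} (path : ℕ → S) (g : S) (h : ℕ) :
    hitTime path g = h ↔ (path h = g ∧ ∀ k < h, path k ≠ g) ∨ (h = 0 ∧ ∀ k, path k ≠ g) := by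
  classical
  constructor
  · rintro rfl
    by_cases hex : ∃ n, path n = g
    · exact Or.inl ⟨Nat.sInf_mem hex, fun k hk => Nat.notMem_of_lt_sInf hk⟩
    · push Not at hex
      exact Or.inr ⟨by simp [hitTime, hex], hex⟩
  · rintro (⟨h1, h2⟩ | ⟨rfl, h2⟩)
    · refine le_antisymm (Nat.sInf_le h1) ?_
      by_contra hlt
      exact h2 _ (not_le.1 hlt) (Nat.sInf_mem (s := {n | path n = g}) ⟨h, h1⟩)
    · simp [hitTime, h2]

namespace CTDRun

variable {S A : Type*} [Fintype S] [Fintype A] [DecidableEq S]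
  {M : MDP S A} {π : S → A → ℝ} {sor : S} {f : ℝ} {m : ℕ} {εS εA : ℝ}
  {Ω : Type*} [MeasurableSpace Ω] {ℙ : Measure Ω}

variable (X : CTDRun M π sor f m εS εA ℙ)

theorem measurableSet_hitTime {i : ℕ} (g : S) (h : ℕ) :
    MeasurableSet[X.ℱ (i + 1) 0] {ω | hitTime (fun n => X.st i n ω) g = h} := by
  have hs : ∀ k, MeasurableSet[X.ℱ (i + 1) 0] {ω | X.st i k ω = g} := fun k =>
    X.ℱ_iter _ _ _ (X.meas_st i k g)
  have : {ω | hitTime (fun n => X.st i n ω) g = h}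
      = ({ω | X.st i h ω = g} ∩ ⋂ k ∈ Set.Iio h, {ω | X.st i k ω = g}ᶜ)
        ∪ ({_ω | h = 0} ∩ ⋂ k, {ω | X.st i k ω = g}ᶜ) := by
    ext ω
    simp [hitTime_eq_iff]
  rw [this]
  exact ((hs h).inter (MeasurableSet.biInter (Set.to_countable _) fun k _ => (hs k).compl)).union
    ((MeasurableSet.const _).inter (MeasurableSet.iInter fun k => (hs k).compl))

theorem measurableSet_obsTime (i n : ℕ) :
    MeasurableSet[X.ℱ (i + 1) 0] {ω | X.obsTime i ω = n} := by
  refine measurableSet_fiber_comp (f := X.origin i)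
    (F := fun g ω => hitTime (fun n => X.st i n ω) g + X.len i ω)
    (fun x => X.ℱ_iter _ _ _ (X.meas_origin i x)) fun g => ?_
  exact measurableSet_fiber_comp (f := X.len i)
    (F := fun l ω => hitTime (fun n => X.st i n ω) g + l)
    (fun x => X.ℱ_iter _ _ _ (X.meas_len i x)) fun l =>
      measurableSet_fiber_comp (f := fun ω => hitTime (fun n => X.st i n ω) g)
        (F := fun h _ => h + l) (X.measurableSet_hitTime g) fun h => MeasurableSet.const _

theorem measurableSet_sample_eq (i : ℕ) (r : Option ((S × A) × (S × A))) :
    MeasurableSet[X.ℱ (i + 1) 0] {ω | X.sample i ω = r} := by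
  refine measurableSet_fiber_comp (f := X.len i)
    (F := fun l ω => if l < m then
      some (X.pair i (X.obsTime i ω) ω, X.pair i (X.obsTime i ω + 1) ω) else none)
    (fun x => X.ℱ_iter _ _ _ (X.meas_len i x)) fun l => ?_
  refine measurableSet_fiber_comp (f := X.obsTime i)
    (F := fun n ω => if l < m then some (X.pair i n ω, X.pair i (n + 1) ω) else none)
    (X.measurableSet_obsTime i) fun n => ?_
  have hp : ∀ n z, MeasurableSet[X.ℱ (i + 1) 0] {ω | X.pair i n ω = z} := fun n z =>
    X.ℱ_iter _ _ _ (X.measurableSet_pair i n z)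
  exact measurableSet_fiber_comp (f := X.pair i n)
    (F := fun z ω => if l < m then some (z, X.pair i (n + 1) ω) else none) (hp n) fun z =>
      measurableSet_fiber_comp (f := X.pair i (n + 1))
        (F := fun z' _ => if l < m then some (z, z') else none) (hp (n + 1)) fun _ =>
          MeasurableSet.const _

/-- The law of a sampled transition. -/
def sampleProb (M : MDP S A) (π : S → A → ℝ) (εA : ℝ) (ν : S → ℝ) (m : ℕ) :
    Option ((S × A) × (S × A)) → ℝ
  | none => M.γ ^ m
  | some (z, z') => stWeight π εA (M.truncDisc π ν m) z * M.pairMatrix π z z'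

theorem sum_sampleProb_mul (M : MDP S A) (π : S → A → ℝ) (εA : ℝ) (ν : S → ℝ) (m : ℕ)
    (h : Option ((S × A) × (S × A)) → ℝ) :
    ∑ r, sampleProb M π εA ν m r * h r = M.γ ^ m * h none
      + M.transSum π (stWeight π εA (M.truncDisc π ν m)) (fun z z' => h (some (z, z'))) := by
  rw [Fintype.sum_option, Fintype.sum_prod_type]
  rfl

theorem truncDisc_eq_sum (M : MDP S A) (π : S → A → ℝ) (ν : S → ℝ) (m : ℕ) (s : S) :
    M.truncDisc π ν m s = ∑ g, ∑ l ∈ range m, ν g * ((1 - M.γ) * M.γ ^ l)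
      * M.occ π (Pi.single g 1) l s := by
  have ho : ∀ l, M.occ π ν l s = ∑ q, ν q * M.occ π (Pi.single q 1) l s := fun l => by
    simp [MDP.occ, Matrix.vecMul, dotProduct, Pi.single_apply]
  rw [sum_comm, MDP.truncDisc, mul_sum]
  refine sum_congr rfl fun l _ => ?_
  rw [ho, mul_sum, mul_sum]
  exact sum_congr rfl fun g _ => by ring

variable [Nonempty A] [IsProbabilityMeasure ℙ]

theorem real_inter_sample_some {i : ℕ}
    (hr : ∀ᵐ ω ∂ℙ, X.len i ω < m → ∃ n, X.st i n ω = X.origin i ω)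
    {E : Set Ω} (hE : MeasurableSet[X.ℱ i 0] E) (z z' : S × A) :
    ℙ.real (E ∩ {ω | X.sample i ω = some (z, z')})
      = ℙ.real E * sampleProb M π εA (MDP.originDist S sor f) m (some (z, z')) := by
  have e : E ∩ {ω | X.sample i ω = some (z, z')} = ⋃ gl ∈ (univ ×ˢ range m : Finset (S × ℕ)),
      (E ∩ {ω | X.origin i ω = gl.1 ∧ X.len i ω = gl.2}) ∩ {ω | X.sample i ω = some (z, z')} := by
    ext ω
    simp only [Set.mem_inter_iff, Set.mem_ofPred_eq, Set.mem_iUnion, mem_product, mem_univ, true_and,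
      mem_range, exists_prop, Prod.exists]
    constructor
    · rintro ⟨h1, h2⟩
      have hl : X.len i ω < m := by
        by_contra hl
        simp [sample, hl] at h2
      exact ⟨_, _, hl, ⟨h1, rfl, rfl⟩, h2⟩
    · rintro ⟨g, l, -, ⟨h1, -⟩, h2⟩
      exact ⟨h1, h2⟩
  rw [e, measureReal_biUnion_finset]
  · rw [sum_product, sampleProb, stWeight, truncDisc_eq_sum, sum_mul, sum_mul, mul_sum]
    refine sum_congr rfl fun g _ => ?_
    rw [sum_mul, sum_mul, mul_sum]
    refine sum_congr rfl fun l hl => ?_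
    rw [X.real_inter_obs hr (mem_range.1 hl) hE]
    ring
  · intro x _ y _ hxy
    refine Set.disjoint_left.2 fun ω h1 h2 => hxy ?_
    exact Prod.ext (h1.1.2.1.symm.trans h2.1.2.1) (h1.1.2.2.symm.trans h2.1.2.2)
  · intro gl _
    exact ((X.ℱ_le _ _ _ hE).inter (X.ℱ_le _ _ _ (X.measurableSet_sample i gl.1 gl.2))).inter
      (X.ℱ_le _ _ _ (X.measurableSet_sample_eq i _))

theorem sum_sampleProb (hπ : IsPolicy π) {ν : S → ℝ} (hν : IsProbVec ν)
    (h0 : 0 ≤ εA) (h1 : εA ≤ 1) :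
    ∑ r, sampleProb M π εA ν m r = 1 := by
  classical
  have h := sum_sampleProb_mul M π εA ν m fun _ => 1
  have h2 := sum_stWeight_mul π εA (M.truncDisc π ν m) fun _ => 1
  rw [M.transSum_fst hπ (fun _ => 1), h2] at h
  simp only [mul_one, polAvg, (perturbed_isPolicy hπ h0 h1).2, M.truncDisc_sum hπ hν] at h
  rw [h]
  ring

/-- Law of the sample of iteration `i`, given the past. -/
theorem real_inter_sample (hπ : IsPolicy π) (hf : f ∈ Set.Icc (0 : ℝ) 1)
    (h0 : 0 ≤ εA) (h1 : εA ≤ 1) {i : ℕ}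
    (hr : ∀ᵐ ω ∂ℙ, X.len i ω < m → ∃ n, X.st i n ω = X.origin i ω)
    {E : Set Ω} (hE : MeasurableSet[X.ℱ i 0] E) (r : Option ((S × A) × (S × A))) :
    ℙ.real (E ∩ {ω | X.sample i ω = r})
      = ℙ.real E * sampleProb M π εA (MDP.originDist S sor f) m r := by
  match r with
  | some (z, z') => exact X.real_inter_sample_some hr hE z z'
  | none =>
    -- The probability of no sample is obtained as the complement of the finitely many transitions.
    have h2 := sum_real_inter_fiber (μ := ℙ) (f := X.sample i)
      (fun r => X.ℱ_le _ _ _ (X.measurableSet_sample_eq i r)) (X.ℱ_le _ _ _ hE)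
    have h3 := sum_sampleProb (M := M) (m := m) hπ (MDP.originDist_isProbVec sor hf) h0 h1
    rw [Fintype.sum_option] at h2 h3
    simp only [X.real_inter_sample_some hr hE, ← mul_sum] at h2
    rw [← eq_sub_iff_add_eq] at h3
    rw [h3]
    linarith

/-- The samples of the first `t` iterations. -/
def hist (t : ℕ) (ω : Ω) : Fin t → Option ((S × A) × (S × A)) := fun i => X.sample i ω

theorem measurableSet_hist (t : ℕ) (x : Fin t → Option ((S × A) × (S × A))) :
    MeasurableSet[X.ℱ t 0] {ω | X.hist t ω = x} := by
  have : {ω | X.hist t ω = x} = ⋂ i : Fin t, {ω | X.sample i ω = x i} := by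
    ext ω
    simp [hist, funext_iff]
  rw [this]
  refine MeasurableSet.iInter fun i => ?_
  have hs := X.measurableSet_sample_eq i (x i)
  rcases Nat.eq_or_lt_of_le (Nat.succ_le_of_lt i.2) with h | h
  · rwa [← Nat.succ_eq_add_one, h] at hs
  · exact X.ℱ_iter_mono h _ hs

/-- `Y` is a function of the first `t` samples. -/
def Adapted {σ : Type*} (t : ℕ) (Y : Ω → σ) : Prop :=
  ∃ y : (Fin t → Option ((S × A) × (S × A))) → σ, ∀ ω, Y ω = y (X.hist t ω)

variable {X} in
theorem Adapted.comp {σ τ : Type*} {t : ℕ} {Y : Ω → σ} (hY : X.Adapted t Y) (g : σ → τ) :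
    X.Adapted t fun ω => g (Y ω) := by
  obtain ⟨y, hy⟩ := hY
  exact ⟨fun x => g (y x), fun ω => by simp only [hy]⟩

variable {X} in
theorem Adapted.prodMk {σ τ : Type*} {t : ℕ} {Y : Ω → σ} {Y' : Ω → τ} (hY : X.Adapted t Y)
    (hY' : X.Adapted t Y') : X.Adapted t fun ω => (Y ω, Y' ω) := by
  obtain ⟨y, hy⟩ := hY
  obtain ⟨y', hy'⟩ := hY'
  exact ⟨fun x => (y x, y' x), fun ω => by simp only [hy, hy']⟩

variable {X} in
theorem Adapted.succ {σ : Type*} {t : ℕ} {Y : Ω → σ} (hY : X.Adapted t Y) :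
    X.Adapted (t + 1) Y := by
  obtain ⟨y, hy⟩ := hY
  exact ⟨fun x => y fun i => x i.castSucc, fun ω => by rw [hy]; rfl⟩

theorem adapted_sample (t : ℕ) : X.Adapted (t + 1) (X.sample t) :=
  ⟨fun x => x (Fin.last t), fun _ => rfl⟩

theorem adapted_const {σ : Type*} (t : ℕ) (y : σ) : X.Adapted t fun _ => y := ⟨fun _ => y, fun _ => rfl⟩

variable {X}

/-- There are finitely many histories of length t, so an adapted quantity is a simple function.
Integrability never needs an estimate. -/
theorem Adapted.integrable {t : ℕ} {Y : Ω → ℝ} (hY : X.Adapted t Y) : Integrable Y ℙ := by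
  obtain ⟨y, hy⟩ := hY
  rw [funext hy]
  exact integrable_comp_of_fiber (fun x => X.ℱ_le _ _ _ (X.measurableSet_hist t x)) y

/-- The sample of iteration `t` is independent of the past. -/
theorem Adapted.integral_sample (hπ : IsPolicy π) (hf : f ∈ Set.Icc (0 : ℝ) 1)
    (h0 : 0 ≤ εA) (h1 : εA ≤ 1) {t : ℕ}
    (hr : ∀ᵐ ω ∂ℙ, X.len t ω < m → ∃ n, X.st t n ω = X.origin t ω)
    {σ : Type*} {Y : Ω → σ} (hY : X.Adapted t Y) (h : σ → Option ((S × A) × (S × A)) → ℝ) :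
    ∫ ω, h (Y ω) (X.sample t ω) ∂ℙ
      = ∫ ω, ∑ r, sampleProb M π εA (MDP.originDist S sor f) m r * h (Y ω) r ∂ℙ := by
  obtain ⟨y, hy⟩ := hY
  simp only [hy]
  have hm : ∀ x, MeasurableSet {ω | X.hist t ω = x} := fun x =>
    X.ℱ_le _ _ _ (X.measurableSet_hist t x)
  have hm' : ∀ x : (Fin t → Option ((S × A) × (S × A))) × Option ((S × A) × (S × A)),
      {ω | (X.hist t ω, X.sample t ω) = x} = {ω | X.hist t ω = x.1} ∩ {ω | X.sample t ω = x.2} :=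
    fun x => by ext ω; simp [Prod.ext_iff]
  rw [integral_comp_of_fiber (f := fun ω => (X.hist t ω, X.sample t ω))
    (y := fun x => h (y x.1) x.2) fun x => by
      rw [hm']
      exact (hm _).inter (X.ℱ_le _ _ _ (X.measurableSet_sample_eq t _)),
    integral_comp_of_fiber hm
      (y := fun x => ∑ r, sampleProb M π εA (MDP.originDist S sor f) m r * h (y x) r),
    Fintype.sum_prod_type]
  refine sum_congr rfl fun x _ => ?_
  rw [mul_sum]
  refine sum_congr rfl fun r _ => ?_
  rw [hm', X.real_inter_sample hπ hf h0 h1 hr (X.measurableSet_hist t x), mul_assoc]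

end CTDRun

/-! ### Drift of the squared error in one iteration -/

section Drift

variable {x r R G U W a b s k ε : ℝ}

theorem drift_le_of_small (hx : 0 < x) (hx1 : x ≤ 1) (hr : 0 < r) (hr8 : r ≤ 1 / 8) (hR : R ≤ 7 / x)
    (hW : 0 ≤ W) (ha : x / 4 * W ≤ a) (hU : G * U ≤ r * W)
    (hb : ∀ t, 0 < t → -(t * (G * U) + R / t) ≤ b) (hε : ε ≤ 1 / 4)
    (hs : s ≤ 9 / 8 * (2 * a + x * (G * U + W / (4 * (1 - ε)))) + 9 * R) (hk : 0 ≤ k)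
    (hk' : k ≤ x / 512) : -2 * a - b + k * s ≤ -a + (56 * r / x ^ 2 + 1 / 8) := by
  -- With t = x/(8r) the bias costs at most xW/8 ≤ a/2.
  have h1 := hb (x / (8 * r)) (by positivity)
  have h2 : x / (8 * r) * (G * U) ≤ x / (8 * r) * (r * W) := by gcongr
  have e2 : x / (8 * r) * (r * W) = x / 8 * W := by field_simp
  have h3 : R / (x / (8 * r)) ≤ 7 / x / (x / (8 * r)) := by gcongr
  have e3 : 7 / x / (x / (8 * r)) = 56 * r / x ^ 2 := by field_simp; ring
  have h4 : W / (4 * (1 - ε)) ≤ W / 3 := div_le_div_of_nonneg_left hW (by norm_num) (by linarith)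
  have h5 : G * U + W / (4 * (1 - ε)) ≤ W / 2 := by nlinarith
  have h6 : x * (G * U + W / (4 * (1 - ε))) ≤ x * (W / 2) := by gcongr
  have h7 := mul_le_mul_of_nonneg_left hs hk
  have ha0 : 0 ≤ a := le_trans (by positivity) ha
  have h8 : k * (9 / 8 * (2 * a + x * (G * U + W / (4 * (1 - ε)))) + 9 * R)
      ≤ x / 512 * (9 / 8 * (4 * a)) + x / 512 * (9 * (7 / x)) := by
    have : k * (9 / 8 * (2 * a + x * (G * U + W / (4 * (1 - ε)))) + 9 * R)
        ≤ k * (9 / 8 * (4 * a) + 9 * (7 / x)) := by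
      gcongr
      linarith
    refine this.trans ?_
    rw [← mul_add]
    gcongr
  -- The variance at the fixed point contributes 63/512 < 1/8; the constant 512 of the step size
  -- enters here.
  have e8 : x / 512 * (9 * (7 / x)) = 63 / 512 := by field_simp; norm_num
  have h9 : x * a ≤ a := mul_le_of_le_one_left ha0 hx1
  linarith

theorem drift_le_of_two_le {q : ℝ} (hx : 0 < x) (hx1 : x ≤ 1) (hr : 0 < r) (hr1 : r ≤ 1)
    (hR : R ≤ 7 / x) (hW : 0 ≤ W) (ha : x / 160 * W ≤ a) (hq : 1.4142 ≤ q) (hU0 : 0 ≤ G * U)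
    (hU : q * (G * U) ≤ r * W) (hb : ∀ t, 0 < t → -(t * (G * U) + R / t) ≤ b) (hε : ε ≤ 1 / 4)
    (hs : s ≤ 9 / 8 * (2 * a + x * (G * U + W / (4 * (1 - ε)))) + 9 * R) (hk : 0 ≤ k)
    (hk' : k ≤ x / 512) :
    -2 * a - b + k * s ≤ -(x / 200) * W + (990 * r / x ^ 2 + 1 / 8) := by
  have hU2 : 1.4142 * (G * U) ≤ r * W := (mul_le_mul_of_nonneg_right hq hU0).trans hU
  -- 0.007071 = 1.4142/200, so the bias costs xW/200 out of 2a ≥ xW/80. After the variance terms a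
  -- drift of xW/200 remains.
  have h1 := hb (0.007071 * x / r) (by positivity)
  have h2 : 0.007071 * x / r * (G * U) ≤ 0.007071 * x / r * (r * W / 1.4142) := by
    gcongr
    rw [le_div_iff₀ (by norm_num)]
    linarith
  have e2 : 0.007071 * x / r * (r * W / 1.4142) = x / 200 * W := by
    field_simp
    ring
  have h3 : R / (0.007071 * x / r) ≤ 990 * r / x ^ 2 := by
    calc R / (0.007071 * x / r) ≤ 7 / x / (0.007071 * x / r) := by gcongr
      _ = 7 / 0.007071 * (r / x ^ 2) := by field_simp
      _ ≤ 990 * (r / x ^ 2) := by gcongr; norm_num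
      _ = 990 * r / x ^ 2 := by ring
  have h4 : W / (4 * (1 - ε)) ≤ W / 3 := div_le_div_of_nonneg_left hW (by norm_num) (by linarith)
  have h5 : G * U + W / (4 * (1 - ε)) ≤ 1.041 * W := by
    have := mul_le_of_le_one_left hW hr1
    linarith
  have ha0 : 0 ≤ a := le_trans (by positivity) ha
  have h7 := mul_le_mul_of_nonneg_left hs hk
  have h8 : k * (9 / 8 * (2 * a + x * (G * U + W / (4 * (1 - ε)))) + 9 * R)
      ≤ x / 512 * (9 / 8 * (2 * a + x * (1.041 * W))) + x / 512 * (9 * (7 / x)) := by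
    have : k * (9 / 8 * (2 * a + x * (G * U + W / (4 * (1 - ε)))) + 9 * R)
        ≤ k * (9 / 8 * (2 * a + x * (1.041 * W)) + 9 * (7 / x)) := by
      gcongr
    refine this.trans ?_
    rw [← mul_add]
    gcongr
  have e8 : x / 512 * (9 * (7 / x)) = 63 / 512 := by field_simp; norm_num
  have h9 : x * a ≤ a := mul_le_of_le_one_left ha0 hx1
  have h10 : x * (x * W) ≤ x * W := mul_le_of_le_one_left (by positivity) hx1
  linarith

theorem drift_le_of_one (hx : 0 < x) (hx1 : x ≤ 1) (hR : R ≤ 7 / x)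
    (hW : 0 ≤ W) (ha : x / 3 * W ≤ a) (hs : s ≤ 9 / 8 * (2 * a) + 9 * R) (hk : 0 ≤ k)
    (hk' : k ≤ x / 512) : -2 * a + k * s ≤ -(x / 2) * W + 1 / 8 := by
  have ha0 : 0 ≤ a := le_trans (by positivity) ha
  have h8 : k * s ≤ x / 512 * (9 / 8 * (2 * a)) + x / 512 * (9 * (7 / x)) := by
    have : k * s ≤ k * (9 / 8 * (2 * a) + 9 * (7 / x)) := by
      gcongr
      linarith
    refine this.trans ?_
    rw [← mul_add]
    gcongr
  have e8 : x / 512 * (9 * (7 / x)) = 63 / 512 := by field_simp; norm_num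
  have h9 : x * a ≤ a := mul_le_of_le_one_left ha0 hx1
  linarith

end Drift

namespace MDP

variable {S A : Type*} [Fintype S] [Fintype A] [DecidableEq S] [DecidableEq A] (M : MDP S A)
variable {π : S → A → ℝ} {d : ℕ} {Φ : Matrix (S × A) (Fin d) ℝ} {w : S × A → ℝ}

theorem resid_add (Q u : S × A → ℝ) (z z' : S × A) :
    M.resid (Q + u) z z' = (u z - M.γ * u z') + M.resid Q z z' := by
  simp only [resid, Pi.add_apply]
  ring

theorem transSum_mul_resid_add (hπ : IsPolicy π) (Q u v : S × A → ℝ) :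
    M.transSum π w (fun z z' => v z * M.resid (Q + u) z z')
      = M.bform π w v u + M.transSum π w (fun z z' => v z * M.resid Q z z') := by
  rw [← M.transSum_mul_sub hπ, ← transSum_add]
  simp only [resid_add, mul_add]

/-- The split 9/8 against 9 keeps the part proportional to the error close to its true size, at the
price of a larger constant at the fixed point. -/
theorem transSum_resid_add_sq_le (hπ : IsPolicy π) (hw : ∀ z, 0 ≤ w z) (Q u : S × A → ℝ) :
    M.transSum π w (fun z z' => M.resid (Q + u) z z' ^ 2)
      ≤ 9 / 8 * M.transSum π w (fun z z' => (u z - M.γ * u z') ^ 2)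
        + 9 * M.transSum π w (fun z z' => M.resid Q z z' ^ 2) := by
  rw [← transSum_mul, ← transSum_mul, ← transSum_add]
  refine M.transSum_mono hπ hw fun z z' => ?_
  rw [resid_add]
  have := sq_nonneg ((u z - M.γ * u z') - 8 * M.resid Q z z')
  linarith

/-- The stochastic operator as a function of the sampled transition. -/
def tdStep (Φ : Matrix (S × A) (Fin d) ℝ) (θ : Fin d → ℝ) :
    Option ((S × A) × (S × A)) → Fin d → ℝ
  | none => 0
  | some (z, z') => M.resid (Φ.mulVec θ) z z' • Φ z

end MDP

namespace CTDRun

variable {S A : Type*} [Fintype S] [Fintype A] [DecidableEq S] [DecidableEq A]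
  {M : MDP S A} {π : S → A → ℝ} {sor : S} {f : ℝ} {m : ℕ} {εS εA : ℝ}
  {Ω : Type*} [MeasurableSpace Ω] {ℙ : Measure Ω}
  {d : ℕ} {Φ : Matrix (S × A) (Fin d) ℝ} {ν : S → ℝ}

theorem sum_sampleProb_dotProduct (v θ : Fin d → ℝ) :
    ∑ r, sampleProb M π εA ν m r * (v ⬝ᵥ M.tdStep Φ θ r)
      = M.transSum π (stWeight π εA (M.truncDisc π ν m))
        (fun z z' => Φ.mulVec v z * M.resid (Φ.mulVec θ) z z') := by
  rw [sum_sampleProb_mul]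
  simp only [MDP.tdStep, dotProduct_zero, mul_zero, zero_add, dotProduct_smul, smul_eq_mul]
  congr 1
  funext z z'
  rw [mul_comm, dotProduct_comm]
  rfl

theorem sum_sampleProb_dotProduct_self_le [Nonempty A] (hπ : IsPolicy π) (h0 : 0 ≤ εA) (h1 : εA ≤ 1)
    (hν : IsProbVec ν) (θ : Fin d → ℝ) :
    ∑ r, sampleProb M π εA ν m r * (M.tdStep Φ θ r ⬝ᵥ M.tdStep Φ θ r)
      ≤ specNorm Φ ^ 2 * M.transSum π (stWeight π εA (M.truncDisc π ν m))
        (fun z z' => M.resid (Φ.mulVec θ) z z' ^ 2) := by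
  rw [sum_sampleProb_mul, ← MDP.transSum_mul]
  simp only [MDP.tdStep, dotProduct_zero, mul_zero, zero_add, dotProduct_smul, smul_dotProduct,
    smul_eq_mul]
  refine M.transSum_mono hπ (MDP.stWeight_nonneg hπ h0 h1 (M.truncDisc_nonneg hπ hν m)) fun z z' => ?_
  have := mul_le_mul_of_nonneg_right (dotProduct_row_le Φ z)
    (sq_nonneg (M.resid (Φ.mulVec θ) z z'))
  linarith

variable (X : CTDRun M π sor f m εS εA ℙ)

theorem stochOp_eq (i : ℕ) (ω : Ω) (θ : Fin d → ℝ) :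
    X.stochOp Φ i ω θ = M.tdStep Φ θ (X.sample i ω) := by
  unfold stochOp sample
  split_ifs
  · simp only [MDP.tdStep, MDP.resid, Matrix.mulVec]
    congr 1
    ring
  · rfl

theorem theta_succ (ι : ℝ) (t : ℕ) (ω : Ω) :
    X.theta Φ ι (t + 1) ω
      = X.theta Φ ι t ω - ι • M.tdStep Φ (X.theta Φ ι t ω) (X.sample t ω) := by
  rw [← stochOp_eq]
  rfl

variable [Nonempty A] [IsProbabilityMeasure ℙ]

theorem adapted_theta (ι : ℝ) (t : ℕ) : X.Adapted t (X.theta Φ ι t) := by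
  induction t with
  | zero => exact X.adapted_const 0 0
  | succ t ih =>
    have := (ih.succ.prodMk (X.adapted_sample t)).comp fun p => p.1 - ι • M.tdStep Φ p.1 p.2
    simpa only [← X.theta_succ] using this

/-- Expected change of the squared error in one iteration. -/
theorem integral_sq_succ_le (hπ : IsPolicy π) (hf : f ∈ Set.Icc (0 : ℝ) 1)
    (h0 : 0 ≤ εA) (h1 : εA ≤ 1) {t : ℕ}
    (hr : ∀ᵐ ω ∂ℙ, X.len t ω < m → ∃ n, X.st t n ω = X.origin t ω) {ι : ℝ} (hι : 0 ≤ ι)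
    (θ' : Fin d → ℝ) {K : (Fin d → ℝ) → ℝ}
    (hK : ∀ v, -2 * M.bform π (stWeight π εA (M.truncDisc π (MDP.originDist S sor f) m))
        (Φ.mulVec v) (Φ.mulVec v)
      - 2 * M.transSum π (stWeight π εA (M.truncDisc π (MDP.originDist S sor f) m))
        (fun z z' => Φ.mulVec v z * M.resid (Φ.mulVec θ') z z')
      + ι * specNorm Φ ^ 2 * M.transSum π
        (stWeight π εA (M.truncDisc π (MDP.originDist S sor f) m))
        (fun z z' => M.resid (Φ.mulVec θ' + Φ.mulVec v) z z' ^ 2) ≤ K v) :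
    ∫ ω, (X.theta Φ ι (t + 1) ω - θ') ⬝ᵥ (X.theta Φ ι (t + 1) ω - θ') ∂ℙ
      ≤ ∫ ω, (X.theta Φ ι t ω - θ') ⬝ᵥ (X.theta Φ ι t ω - θ') ∂ℙ
        + ι * ∫ ω, K (X.theta Φ ι t ω - θ') ∂ℙ := by
  have hν := MDP.originDist_isProbVec sor hf
  have had := X.adapted_theta (Φ := Φ) ι t
  have e := had.integral_sample hπ hf h0 h1 hr fun θ r =>
    (θ - ι • M.tdStep Φ θ r - θ') ⬝ᵥ (θ - ι • M.tdStep Φ θ r - θ')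
  simp only [X.theta_succ]
  rw [e, ← integral_const_mul, ← integral_add
    (had.comp fun θ => (θ - θ') ⬝ᵥ (θ - θ')).integrable
    (had.comp fun θ => ι * K (θ - θ')).integrable]
  refine integral_mono (had.comp fun θ => ∑ r, sampleProb M π εA (MDP.originDist S sor f) m r *
    ((θ - ι • M.tdStep Φ θ r - θ') ⬝ᵥ (θ - ι • M.tdStep Φ θ r - θ'))).integrable
    (had.comp fun θ => (θ - θ') ⬝ᵥ (θ - θ') + ι * K (θ - θ')).integrable fun ω => ?_
  set θ := X.theta Φ ι t ω
  have h2 : ∀ r, (θ - ι • M.tdStep Φ θ r - θ') ⬝ᵥ (θ - ι • M.tdStep Φ θ r - θ')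
      = (θ - θ') ⬝ᵥ (θ - θ') - 2 * ι * ((θ - θ') ⬝ᵥ M.tdStep Φ θ r)
        + ι ^ 2 * (M.tdStep Φ θ r ⬝ᵥ M.tdStep Φ θ r) := fun r => by
    have : θ - ι • M.tdStep Φ θ r - θ' = (θ - θ') - ι • M.tdStep Φ θ r := by abel
    rw [this]
    simp only [sub_dotProduct, dotProduct_sub, smul_dotProduct, dotProduct_smul, smul_eq_mul]
    rw [dotProduct_comm θ (M.tdStep Φ θ r), dotProduct_comm θ' (M.tdStep Φ θ r)]
    ring
  have h3 : ∀ r, sampleProb M π εA (MDP.originDist S sor f) m r *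
      ((θ - ι • M.tdStep Φ θ r - θ') ⬝ᵥ (θ - ι • M.tdStep Φ θ r - θ'))
      = sampleProb M π εA (MDP.originDist S sor f) m r * ((θ - θ') ⬝ᵥ (θ - θ'))
        - 2 * ι * (sampleProb M π εA (MDP.originDist S sor f) m r * ((θ - θ') ⬝ᵥ M.tdStep Φ θ r))
        + ι ^ 2 * (sampleProb M π εA (MDP.originDist S sor f) m r
          * (M.tdStep Φ θ r ⬝ᵥ M.tdStep Φ θ r)) := fun r => by rw [h2]; ring
  simp only [h3, sum_add_distrib, sum_sub_distrib, ← mul_sum, ← sum_mul,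
    sum_sampleProb hπ hν h0 h1, sum_sampleProb_dotProduct]
  have h4 := mul_le_mul_of_nonneg_left
    (sum_sampleProb_dotProduct_self_le (m := m) (Φ := Φ) (M := M) hπ h0 h1 hν θ) (sq_nonneg ι)
  have h5 := mul_le_mul_of_nonneg_left (hK (θ - θ')) hι
  have h6 : Φ.mulVec θ = Φ.mulVec θ' + Φ.mulVec (θ - θ') := by
    rw [← Matrix.mulVec_add, add_sub_cancel]
  rw [h6] at h4 ⊢
  rw [M.transSum_mul_resid_add hπ]
  linarith

end CTDRun

theorem sum_dotProduct_sum_le {ι' : Type*} {d : ℕ} (s : Finset ι') (f : ι' → Fin d → ℝ) :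
    (∑ i ∈ s, f i) ⬝ᵥ (∑ i ∈ s, f i) ≤ #s * ∑ i ∈ s, f i ⬝ᵥ f i := by
  simp only [dotProduct, Finset.sum_apply]
  rw [sum_comm, mul_sum]
  refine sum_le_sum fun j _ => ?_
  have := sq_sum_le_card_mul_sum_sq (s := s) (f := fun i => f i j)
  simpa only [sq] using this

theorem dotProduct_self_nonneg_real {d : ℕ} (v : Fin d → ℝ) : 0 ≤ v ⬝ᵥ v :=
  sum_nonneg fun _ _ => mul_self_nonneg _

theorem sub_dotProduct_sub_le {d : ℕ} (u v : Fin d → ℝ) :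
    (u - v) ⬝ᵥ (u - v) ≤ 2 * (u ⬝ᵥ u) + 2 * (v ⬝ᵥ v) := by
  have := dotProduct_self_nonneg_real (u + v)
  simp only [sub_dotProduct, dotProduct_sub, add_dotProduct, dotProduct_add] at this ⊢
  linarith

namespace MDP

variable {S A : Type*} [Fintype S] [Fintype A] [DecidableEq S] [DecidableEq A] (M : MDP S A)
variable {π : S → A → ℝ} {d : ℕ} {Φ : Matrix (S × A) (Fin d) ℝ}
variable [Nonempty A] [Nonempty S]

theorem wNormSq_le_specNorm (hπ : IsPolicy π) {ε : ℝ} (h0 : 0 ≤ ε) (h1 : ε ≤ 1) {κ : S → ℝ}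
    (hκ : IsProbVec κ) (v : Fin d → ℝ) :
    wNormSq (stWeight π ε κ) (Φ.mulVec v) ≤ specNorm Φ ^ 2 * (v ⬝ᵥ v) := by
  refine wNormSq_le_of_sq_le hπ h0 h1 hκ fun z => ?_
  exact (single_le_sum (f := fun z => Φ.mulVec v z ^ 2) (fun z _ => sq_nonneg _)
    (mem_univ z)).trans (sum_sq_mulVec_le Φ v)

/-- Drift of the squared error when the truncation error is small, and second moment of the
temporal difference. -/
theorem drift_of_small (hπ : IsPolicy π) {ε : ℝ} (h0 : 0 ≤ ε) {ν : S → ℝ}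
    (hν : IsProbVec ν) (hε : ∀ s, ε ≤ (1 - M.γ) * M.disc π ν s / 4) (m : ℕ) {θ : Fin d → ℝ}
    (hθ : (M.tdMatrix π Φ (stWeight π ε (M.disc π ν))).mulVec θ
      = (Φ.transpose * Matrix.diagonal (stWeight π ε (M.disc π ν))).mulVec fun z => M.c z.1 z.2)
    {r : ℝ} (hr : 0 < r) (hr8 : r ≤ 1 / 8) {v : Fin d → ℝ}
    (hU : M.γ ^ m * (specNorm Φ ^ 2 * (v ⬝ᵥ v))
      ≤ r * wNormSq (stWeight π ε (M.disc π ν)) (Φ.mulVec v))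
    {k : ℝ} (hk : 0 ≤ k) (hk' : k ≤ (1 - M.γ) / 512) :
    -2 * M.bform π (stWeight π ε (M.truncDisc π ν m)) (Φ.mulVec v) (Φ.mulVec v)
      - 2 * M.transSum π (stWeight π ε (M.truncDisc π ν m))
        (fun z z' => Φ.mulVec v z * M.resid (Φ.mulVec θ) z z')
      + k * M.transSum π (stWeight π ε (M.truncDisc π ν m))
        (fun z z' => M.resid (Φ.mulVec θ + Φ.mulVec v) z z' ^ 2)
      ≤ -M.bform π (stWeight π ε (M.truncDisc π ν m)) (Φ.mulVec v) (Φ.mulVec v)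
        + (56 * r / (1 - M.γ) ^ 2 + 1 / 8) ∧
    M.transSum π (stWeight π ε (M.truncDisc π ν m))
        (fun z z' => M.resid (Φ.mulVec θ + Φ.mulVec v) z z' ^ 2)
      ≤ 9 / 2 * M.bform π (stWeight π ε (M.truncDisc π ν m)) (Φ.mulVec v) (Φ.mulVec v)
        + 63 / (1 - M.γ) ∧
    (1 - M.γ) / 4 * wNormSq (stWeight π ε (M.disc π ν)) (Φ.mulVec v)
      ≤ M.bform π (stWeight π ε (M.truncDisc π ν m)) (Φ.mulVec v) (Φ.mulVec v) := by
  have hκ := M.disc_isProbVec hπ hν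
  have hx := M.one_sub_γ_pos
  have hγ := M.γ_nonneg
  have hε4 := M.eps_le h0 hκ.2 hε
  have hW := wNormSq_nonneg (stWeight_nonneg hπ h0 (by linarith) hκ.1) (Φ.mulVec v)
  have hu : ∀ z, Φ.mulVec v z ^ 2 ≤ specNorm Φ ^ 2 * (v ⬝ᵥ v) := fun z =>
    (single_le_sum (f := fun z => Φ.mulVec v z ^ 2) (fun z _ => sq_nonneg _)
      (mem_univ z)).trans (sum_sq_mulVec_le Φ v)
  have hz := M.transSum_resid_eq_zero hπ hθ
  have hQ : M.bform π (stWeight π ε (M.disc π ν)) (Φ.mulVec θ) (Φ.mulVec θ)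
      = ∑ z, stWeight π ε (M.disc π ν) z * (Φ.mulVec θ z * M.c z.1 z.2) := by
    have := hz θ
    rw [M.transSum_mul_resid hπ] at this
    linarith
  have hR := M.transSum_resid_sq_le hπ h0 hν hε hQ
  have ha := M.bform_truncDisc_ge_of_small hπ h0 hν hε m hu (by nlinarith)
  have hs := (M.transSum_resid_add_sq_le hπ
    (stWeight_nonneg hπ h0 (by linarith) (M.truncDisc_nonneg hπ hν m)) (Φ.mulVec θ)
    (Φ.mulVec v)).trans (add_le_add
      (mul_le_mul_of_nonneg_left (M.transSum_sq_truncDisc_le hπ h0 hν hε m hu) (by norm_num))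
      (mul_le_mul_of_nonneg_left (M.transSum_truncDisc_le hπ h0 (by linarith) hν m
        fun _ _ => sq_nonneg _) (by norm_num)))
  have hb := fun t ht => M.transSum_truncDisc_resid_ge hπ h0 (by linarith) hν m hu (t := t) ht
    le_rfl (hz v)
  refine ⟨drift_le_of_small hx (by linarith) hr hr8 hR hW ha hU hb (by linarith) hs hk hk', ?_, ha⟩
  have h4 : wNormSq (stWeight π ε (M.disc π ν)) (Φ.mulVec v) / (4 * (1 - ε))
      ≤ wNormSq (stWeight π ε (M.disc π ν)) (Φ.mulVec v) / 3 :=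
    div_le_div_of_nonneg_left hW (by norm_num) (by linarith)
  have h5 := mul_le_mul_of_nonneg_right hr8 hW
  have h6 := mul_le_mul_of_nonneg_left (by linarith :
    M.γ ^ m * (specNorm Φ ^ 2 * (v ⬝ᵥ v))
      + wNormSq (stWeight π ε (M.disc π ν)) (Φ.mulVec v) / (4 * (1 - ε))
      ≤ wNormSq (stWeight π ε (M.disc π ν)) (Φ.mulVec v) / 2) hx.le
  have e7 : 63 / (1 - M.γ) = 9 * (7 / (1 - M.γ)) := by ring
  linarith

/-- Drift of the squared error with at least two states. -/
theorem drift_of_two_le (hπ : IsPolicy π) {ε : ℝ} (h0 : 0 ≤ ε) {ν : S → ℝ}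
    (hν : IsProbVec ν) (hε : ∀ s, ε ≤ (1 - M.γ) * M.disc π ν s / 4) (m : ℕ) {θ : Fin d → ℝ}
    (hθ : (M.tdMatrix π Φ (stWeight π ε (M.disc π ν))).mulVec θ
      = (Φ.transpose * Matrix.diagonal (stWeight π ε (M.disc π ν))).mulVec fun z => M.c z.1 z.2)
    {r : ℝ} (hr : 0 < r) (hr1 : r ≤ 1) (hn : 2 ≤ Fintype.card S) {v : Fin d → ℝ}
    (hU : √(Fintype.card S : ℝ) * (M.γ ^ m * (specNorm Φ ^ 2 * (v ⬝ᵥ v)))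
      ≤ r * wNormSq (stWeight π ε (M.disc π ν)) (Φ.mulVec v))
    {k : ℝ} (hk : 0 ≤ k) (hk' : k ≤ (1 - M.γ) / 512) :
    -2 * M.bform π (stWeight π ε (M.truncDisc π ν m)) (Φ.mulVec v) (Φ.mulVec v)
      - 2 * M.transSum π (stWeight π ε (M.truncDisc π ν m))
        (fun z z' => Φ.mulVec v z * M.resid (Φ.mulVec θ) z z')
      + k * M.transSum π (stWeight π ε (M.truncDisc π ν m))
        (fun z z' => M.resid (Φ.mulVec θ + Φ.mulVec v) z z' ^ 2)
      ≤ -((1 - M.γ) / 200) * wNormSq (stWeight π ε (M.disc π ν)) (Φ.mulVec v)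
        + (990 * r / (1 - M.γ) ^ 2 + 1 / 8) := by
  have hκ := M.disc_isProbVec hπ hν
  have hx := M.one_sub_γ_pos
  have hγ := M.γ_nonneg
  have hε4 := M.eps_le h0 hκ.2 hε
  have hW := wNormSq_nonneg (stWeight_nonneg hπ h0 (by linarith) hκ.1) (Φ.mulVec v)
  have hu : ∀ z, Φ.mulVec v z ^ 2 ≤ specNorm Φ ^ 2 * (v ⬝ᵥ v) := fun z =>
    (single_le_sum (f := fun z => Φ.mulVec v z ^ 2) (fun z _ => sq_nonneg _)
      (mem_univ z)).trans (sum_sq_mulVec_le Φ v)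
  have hz := M.transSum_resid_eq_zero hπ hθ
  have hQ : M.bform π (stWeight π ε (M.disc π ν)) (Φ.mulVec θ) (Φ.mulVec θ)
      = ∑ z, stWeight π ε (M.disc π ν) z * (Φ.mulVec θ z * M.c z.1 z.2) := by
    have := hz θ
    rw [M.transSum_mul_resid hπ] at this
    linarith
  have hR := M.transSum_resid_sq_le hπ h0 hν hε hQ
  have ha := M.bform_truncDisc_ge hπ h0 hν hε m (sum_sq_mulVec_le Φ v)
    (hU.trans (mul_le_of_le_one_left hW hr1)) hn
  have hs := (M.transSum_resid_add_sq_le hπ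
    (stWeight_nonneg hπ h0 (by linarith) (M.truncDisc_nonneg hπ hν m)) (Φ.mulVec θ)
    (Φ.mulVec v)).trans (add_le_add
      (mul_le_mul_of_nonneg_left (M.transSum_sq_truncDisc_le hπ h0 hν hε m hu) (by norm_num))
      (mul_le_mul_of_nonneg_left (M.transSum_truncDisc_le hπ h0 (by linarith) hν m
        fun _ _ => sq_nonneg _) (by norm_num)))
  have hb := fun t ht => M.transSum_truncDisc_resid_ge hπ h0 (by linarith) hν m hu (t := t) ht
    le_rfl (hz v)
  have hn' : (2 : ℝ) ≤ Fintype.card S := by exact_mod_cast hn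
  exact drift_le_of_two_le hx (by linarith) hr hr1 hR hW ha
    (Real.le_sqrt_of_sq_le (by norm_num; linarith))
    (mul_nonneg (pow_nonneg hγ m) (mul_nonneg (sq_nonneg _) (dotProduct_self_nonneg_real v)))
    hU hb (by linarith) hs hk hk'

theorem occ_of_subsingleton [Subsingleton S] (hπ : IsPolicy π) {ν : S → ℝ} (hν : IsProbVec ν)
    (l : ℕ) : M.occ π ν l = ν := by
  have h : ∀ {κ : S → ℝ}, IsProbVec κ → ∀ s, κ s = 1 := fun {κ} hκ s => by
    rw [← hκ.2, Fintype.sum_subsingleton _ s]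
  funext s
  rw [h hν, h (M.occ_isProbVec hπ hν l)]

/-- With a single state the tail has the same law as the whole, so truncation rescales the weights
and creates no bias. This replaces `bform_truncDisc_ge`, which needs two states. -/
theorem transSum_truncDisc_of_subsingleton [Subsingleton S] (hπ : IsPolicy π) (ε : ℝ) {ν : S → ℝ}
    (hν : IsProbVec ν) (m : ℕ) (h : S × A → S × A → ℝ) :
    M.transSum π (stWeight π ε (M.truncDisc π ν m)) h
      = (1 - M.γ ^ m) * M.transSum π (stWeight π ε (M.disc π ν)) h := by
  have := M.transSum_truncDisc hπ ε hν m h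
  rw [M.occ_of_subsingleton hπ hν] at this
  linarith

/-- Drift of the squared error with one state. -/
theorem drift_of_subsingleton [Subsingleton S] (hπ : IsPolicy π) {ε : ℝ} (h0 : 0 ≤ ε) {ν : S → ℝ}
    (hν : IsProbVec ν) (hε : ∀ s, ε ≤ (1 - M.γ) * M.disc π ν s / 4) (m : ℕ) {θ : Fin d → ℝ}
    (hθ : (M.tdMatrix π Φ (stWeight π ε (M.disc π ν))).mulVec θ
      = (Φ.transpose * Matrix.diagonal (stWeight π ε (M.disc π ν))).mulVec fun z => M.c z.1 z.2)
    (v : Fin d → ℝ) {k : ℝ} (hk : 0 ≤ k) (hk' : k ≤ (1 - M.γ) / 512) :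
    -2 * M.bform π (stWeight π ε (M.truncDisc π ν m)) (Φ.mulVec v) (Φ.mulVec v)
      - 2 * M.transSum π (stWeight π ε (M.truncDisc π ν m))
        (fun z z' => Φ.mulVec v z * M.resid (Φ.mulVec θ) z z')
      + k * M.transSum π (stWeight π ε (M.truncDisc π ν m))
        (fun z z' => M.resid (Φ.mulVec θ + Φ.mulVec v) z z' ^ 2)
      ≤ (1 - M.γ ^ m)
        * (-((1 - M.γ) / 2) * wNormSq (stWeight π ε (M.disc π ν)) (Φ.mulVec v) + 1 / 8) := by
  have hκ := M.disc_isProbVec hπ hν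
  have hx := M.one_sub_γ_pos
  have hγ := M.γ_nonneg
  have hε4 := M.eps_le h0 hκ.2 hε
  have hw := stWeight_nonneg hπ h0 (by linarith : ε ≤ 1) hκ.1
  have hz := M.transSum_resid_eq_zero hπ hθ
  have hQ : M.bform π (stWeight π ε (M.disc π ν)) (Φ.mulVec θ) (Φ.mulVec θ)
      = ∑ z, stWeight π ε (M.disc π ν) z * (Φ.mulVec θ z * M.c z.1 z.2) := by
    have := hz θ
    rw [M.transSum_mul_resid hπ] at this
    linarith
  have hs := (M.transSum_resid_add_sq_le hπ hw (Φ.mulVec θ) (Φ.mulVec v)).trans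
    (add_le_add_left (mul_le_mul_of_nonneg_left
      (M.transSum_sq_disc_le hπ h0 hν hε (Φ.mulVec v)) (by norm_num)) _)
  have h := drift_le_of_one hx (by linarith) (M.transSum_resid_sq_le hπ h0 hν hε hQ)
    (wNormSq_nonneg hw (Φ.mulVec v)) (M.bform_disc_ge hπ h0 hν hε (Φ.mulVec v)) hs hk hk'
  have hG : 0 ≤ 1 - M.γ ^ m := sub_nonneg.2 (pow_le_one₀ hγ M.γ_lt_one.le)
  have h2 := mul_le_mul_of_nonneg_left h hG
  rw [← M.transSum_mul_sub hπ, M.transSum_truncDisc_of_subsingleton hπ ε hν,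
    M.transSum_truncDisc_of_subsingleton hπ ε hν, M.transSum_truncDisc_of_subsingleton hπ ε hν,
    hz v, M.transSum_mul_sub hπ]
  linarith

end MDP

/-! ### Mean squared error of the iterates -/

namespace CTDRun

variable {S A : Type*} [Fintype S] [Fintype A] [DecidableEq S] [DecidableEq A]
  {M : MDP S A} {π : S → A → ℝ} {sor : S} {f : ℝ} {m : ℕ} {εS εA : ℝ}
  {Ω : Type*} [MeasurableSpace Ω] {ℙ : Measure Ω}
  {d : ℕ} {Φ : Matrix (S × A) (Fin d) ℝ}

variable (X : CTDRun M π sor f m εS εA ℙ)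

/-- Mean squared error of the parameters. -/
def err (Φ : Matrix (S × A) (Fin d) ℝ) (ι : ℝ) (θ' : Fin d → ℝ) (t : ℕ) : ℝ :=
  ∫ ω, (X.theta Φ ι t ω - θ') ⬝ᵥ (X.theta Φ ι t ω - θ') ∂ℙ

/-- The mean of the stochastic operator. -/
def meanStep (M : MDP S A) (π : S → A → ℝ) (εA : ℝ) (ν : S → ℝ) (m : ℕ)
    (Φ : Matrix (S × A) (Fin d) ℝ) (θ : Fin d → ℝ) : Fin d → ℝ :=
  ∑ r, sampleProb M π εA ν m r • M.tdStep Φ θ r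

theorem dotProduct_meanStep (ν : S → ℝ) (v θ : Fin d → ℝ) :
    v ⬝ᵥ meanStep M π εA ν m Φ θ = M.transSum π (stWeight π εA (M.truncDisc π ν m))
        (fun z z' => Φ.mulVec v z * M.resid (Φ.mulVec θ) z z') := by
  rw [← sum_sampleProb_dotProduct, meanStep, dotProduct_sum]
  simp only [dotProduct_smul, smul_eq_mul]

/-- The average of the errors of the parameters. -/
def avgErr (Φ : Matrix (S × A) (Fin d) ℝ) (ι : ℝ) (θ' : Fin d → ℝ) (N : ℕ) (ω : Ω) : Fin d → ℝ :=
  (N : ℝ)⁻¹ • ∑ t ∈ Ico N (2 * N), (X.theta Φ ι t ω - θ')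

theorem Qhat_sub (ι : ℝ) (θ' : Fin d → ℝ) {N : ℕ} (hN : 1 ≤ N) (ω : Ω) :
    X.Qhat Φ ι N ω - Φ.mulVec θ' = Φ.mulVec (X.avgErr Φ ι θ' N ω) := by
  have hN' : (N : ℝ) ≠ 0 := by positivity
  rw [avgErr, sum_sub_distrib, sum_const, Nat.card_Ico, Matrix.mulVec_smul, Matrix.mulVec_sub, Qhat,
    Matrix.mulVec_sum, smul_sub, show 2 * N - N = N by omega, ← Nat.cast_smul_eq_nsmul ℝ,
    Matrix.mulVec_smul, smul_smul, inv_mul_cancel₀ hN', one_smul]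

theorem avgErr_sq_le (ι : ℝ) (θ' : Fin d → ℝ) (N : ℕ) (ω : Ω) :
    X.avgErr Φ ι θ' N ω ⬝ᵥ X.avgErr Φ ι θ' N ω
      ≤ (N : ℝ)⁻¹ * ∑ t ∈ Ico N (2 * N), (X.theta Φ ι t ω - θ') ⬝ᵥ (X.theta Φ ι t ω - θ') := by
  rw [avgErr, smul_dotProduct, dotProduct_smul, smul_eq_mul, smul_eq_mul]
  have h := sum_dotProduct_sum_le (Ico N (2 * N)) fun t => X.theta Φ ι t ω - θ'
  rw [Nat.card_Ico, show 2 * N - N = N by omega] at h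
  have hN : (0 : ℝ) ≤ (N : ℝ)⁻¹ := by positivity
  refine mul_le_mul_of_nonneg_left ?_ hN
  rcases Nat.eq_zero_or_pos N with h0 | h0
  · simp [h0]
  · rwa [inv_mul_le_iff₀ (by positivity)]

variable [Nonempty A] [IsProbabilityMeasure ℙ]

variable {X} in
theorem Adapted.mono {σ : Type*} {t t' : ℕ} {Y : Ω → σ} (hY : X.Adapted t Y) (h : t ≤ t') :
    X.Adapted t' Y := by
  induction t', h using Nat.le_induction with
  | base => exact hY
  | succ n _ ih => exact ih.succ

theorem adapted_avgErr (ι : ℝ) (θ' : Fin d → ℝ) (N : ℕ) :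
    X.Adapted (2 * N) (X.avgErr Φ ι θ' N) := by
  have h : ∀ t ≤ 2 * N, X.Adapted (2 * N) (X.theta Φ ι t) := fun t ht =>
    (X.adapted_theta ι t).mono ht
  choose y hy using h
  refine ⟨fun x => (N : ℝ)⁻¹ • ∑ t ∈ (Ico N (2 * N)).attach,
    (y t (mem_Ico.1 t.2).2.le x - θ'), fun ω => ?_⟩
  rw [avgErr, ← sum_attach]
  congr 1
  exact sum_congr rfl fun t _ => by rw [← hy]

theorem integrable_wNormSq_Qhat (w : S × A → ℝ) (ι : ℝ) (θ' : Fin d → ℝ) {N : ℕ} (hN : 1 ≤ N) :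
    Integrable (fun ω => wNormSq w (X.Qhat Φ ι N ω - Φ.mulVec θ')) ℙ := by
  simp only [X.Qhat_sub ι θ' hN]
  exact ((X.adapted_avgErr ι θ' N).comp fun v => wNormSq w (Φ.mulVec v)).integrable

theorem integrable_sq_sub (ι : ℝ) (θ' : Fin d → ℝ) (t : ℕ) :
    Integrable (fun ω => (X.theta Φ ι t ω - θ') ⬝ᵥ (X.theta Φ ι t ω - θ')) ℙ :=
  ((X.adapted_theta ι t).comp fun θ => (θ - θ') ⬝ᵥ (θ - θ')).integrable

theorem err_nonneg (ι : ℝ) (θ' : Fin d → ℝ) (t : ℕ) : 0 ≤ X.err Φ ι θ' t :=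
  integral_nonneg fun _ => dotProduct_self_nonneg_real _

theorem err_zero (ι : ℝ) (θ' : Fin d → ℝ) : X.err Φ ι θ' 0 = θ' ⬝ᵥ θ' := by
  have : ∀ ω, X.theta Φ ι 0 ω = 0 := fun _ => rfl
  simp [err, this]

/-- Jensen for the average and ‖Φv‖² ≤ Ω²|v|². It ignores the effect of averaging and is used only
when the truncation term of the bound is large. -/
theorem integral_wNormSq_Qhat_le [Nonempty S] (hπ : IsPolicy π) {ε : ℝ} (h0 : 0 ≤ ε) (h1 : ε ≤ 1)
    {κ : S → ℝ} (hκ : IsProbVec κ) (ι : ℝ) (θ' : Fin d → ℝ) {N : ℕ} (hN : 1 ≤ N) {B : ℝ}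
    (hB : ∀ t < 2 * N, X.err Φ ι θ' t ≤ B) :
    ∫ ω, wNormSq (stWeight π ε κ) (X.Qhat Φ ι N ω - Φ.mulVec θ') ∂ℙ ≤ specNorm Φ ^ 2 * B := by
  have hN' : (0 : ℝ) < N := by positivity
  have h2 : ∀ ω, wNormSq (stWeight π ε κ) (X.Qhat Φ ι N ω - Φ.mulVec θ')
      ≤ specNorm Φ ^ 2 * ((N : ℝ)⁻¹
        * ∑ t ∈ Ico N (2 * N), (X.theta Φ ι t ω - θ') ⬝ᵥ (X.theta Φ ι t ω - θ')) := fun ω => by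
    rw [X.Qhat_sub ι θ' hN]
    exact (MDP.wNormSq_le_specNorm hπ h0 h1 hκ _).trans
      (mul_le_mul_of_nonneg_left (X.avgErr_sq_le ι θ' N ω) (sq_nonneg _))
  have hi : Integrable (fun ω => ∑ t ∈ Ico N (2 * N),
      (X.theta Φ ι t ω - θ') ⬝ᵥ (X.theta Φ ι t ω - θ')) ℙ :=
    integrable_finsetSum _ fun t _ => X.integrable_sq_sub ι θ' t
  refine (integral_mono (X.integrable_wNormSq_Qhat _ ι θ' hN)
    ((hi.const_mul _).const_mul _) h2).trans ?_
  rw [integral_const_mul, integral_const_mul,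
    integral_finsetSum _ fun t _ => X.integrable_sq_sub ι θ' t]
  refine mul_le_mul_of_nonneg_left ?_ (sq_nonneg _)
  rw [inv_mul_le_iff₀ hN']
  have := sum_le_sum fun t (ht : t ∈ Ico N (2 * N)) => hB t (mem_Ico.1 ht).2
  rw [sum_const, Nat.card_Ico, show 2 * N - N = N by omega, nsmul_eq_mul] at this
  exact this

/-- The map e ↦ (1 - ιc)e + ιK is monotone for ιc ≤ 1 and does not increase the value |θ'|² + K/c,
which dominates the initial error since θ₀ = 0. -/
theorem err_le_of_contraction {ι c K : ℝ} (θ' : Fin d → ℝ) {n : ℕ} (hc : 0 < c)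
    (hι : 0 ≤ ι) (hιc : ι * c ≤ 1) (hK : 0 ≤ K)
    (hstep : ∀ t < n, X.err Φ ι θ' (t + 1) ≤ X.err Φ ι θ' t
      + ι * ∫ ω, (-c * ((X.theta Φ ι t ω - θ') ⬝ᵥ (X.theta Φ ι t ω - θ')) + K) ∂ℙ)
    {t : ℕ} (ht : t ≤ n) : X.err Φ ι θ' t ≤ θ' ⬝ᵥ θ' + K / c := by
  have hB : 0 ≤ θ' ⬝ᵥ θ' := dotProduct_self_nonneg_real θ'
  have hKc : 0 ≤ K / c := by positivity
  induction t with
  | zero => rw [err_zero]; linarith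
  | succ t ih =>
    have h := hstep t (by omega)
    rw [integral_add ((X.integrable_sq_sub ι θ' t).const_mul _) (integrable_const _),
      integral_const_mul, integral_const] at h
    simp only [probReal_univ, one_smul] at h
    change _ ≤ X.err Φ ι θ' t + ι * (-c * X.err Φ ι θ' t + K) at h
    have h2 := mul_le_mul_of_nonneg_left (ih (by omega)) (sub_nonneg.2 hιc)
    have e : (1 - ι * c) * (θ' ⬝ᵥ θ' + K / c) + ι * K = θ' ⬝ᵥ θ' + K / c - ι * c * (θ' ⬝ᵥ θ') := by
      field_simp
      ring
    have := mul_nonneg (mul_nonneg hι hc.le) hB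
    linarith

end CTDRun

/-! ### The averaged recursion and its martingale noise -/

namespace MDP

variable {S A : Type*} [Fintype S] [Fintype A] [DecidableEq S] (M : MDP S A)

theorem bform_add_right (π : S → A → ℝ) (w u v v' : S × A → ℝ) :
    M.bform π w u (v + v') = M.bform π w u v + M.bform π w u v' := by
  simp only [bform, Matrix.mulVec_add, Pi.add_apply, ← sum_add_distrib]
  exact sum_congr rfl fun _ _ => by ring

theorem bform_smul_right (π : S → A → ℝ) (w u v : S × A → ℝ) (t : ℝ) :
    M.bform π w u (t • v) = t * M.bform π w u v := by
  simp only [bform, Matrix.mulVec_smul, Pi.smul_apply, smul_eq_mul, mul_sum]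
  exact sum_congr rfl fun _ _ => by ring

theorem bform_sum_right {ι' : Type*} (s : Finset ι') (π : S → A → ℝ) (w u : S × A → ℝ)
    (v : ι' → S × A → ℝ) : M.bform π w u (∑ i ∈ s, v i) = ∑ i ∈ s, M.bform π w u (v i) := by
  classical
  induction s using Finset.induction_on with
  | empty => simpa using M.bform_smul_right π w u 0 0
  | insert i s hi ih => rw [sum_insert hi, sum_insert hi, bform_add_right, ih]

end MDP

namespace CTDRun

variable {S A : Type*} [Fintype S] [Fintype A] [DecidableEq S] [DecidableEq A]
  {M : MDP S A} {π : S → A → ℝ} {sor : S} {f : ℝ} {m : ℕ} {εS εA : ℝ}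
  {Ω : Type*} [MeasurableSpace Ω] {ℙ : Measure Ω}
  {d : ℕ} {Φ : Matrix (S × A) (Fin d) ℝ}

variable (X : CTDRun M π sor f m εS εA ℙ)

/-- The sum of the deviations of the stochastic operators from their means in the iterations
`N, …, n - 1`. -/
def noise (Φ : Matrix (S × A) (Fin d) ℝ) (ι : ℝ) (N n : ℕ) (ω : Ω) : Fin d → ℝ :=
  ∑ t ∈ Ico N n, (M.tdStep Φ (X.theta Φ ι t ω) (X.sample t ω)
    - meanStep M π εA (MDP.originDist S sor f) m Φ (X.theta Φ ι t ω))

theorem noise_succ (ι : ℝ) {N n : ℕ} (h : N ≤ n) (ω : Ω) :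
    X.noise Φ ι N (n + 1) ω = X.noise Φ ι N n ω
      + (M.tdStep Φ (X.theta Φ ι n ω) (X.sample n ω)
        - meanStep M π εA (MDP.originDist S sor f) m Φ (X.theta Φ ι n ω)) :=
  sum_Ico_succ_top h _

/-- Telescoping the recursion. Since the mean operator is affine, its sum is N times its value at
the averaged parameter, which `bform_avgErr` exploits. -/
theorem theta_sub_theta (ι : ℝ) {N n : ℕ} (h : N ≤ n) (ω : Ω) :
    X.theta Φ ι N ω - X.theta Φ ι n ω = ι • (X.noise Φ ι N n ω
      + ∑ t ∈ Ico N n, meanStep M π εA (MDP.originDist S sor f) m Φ (X.theta Φ ι t ω)) := by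
  induction n, h using Nat.le_induction with
  | base => simp [noise]
  | succ n h ih =>
    rw [theta_succ, noise_succ X ι h, sum_Ico_succ_top h, ← sub_add, ih, ← smul_add]
    congr 1
    abel

/-- The averaged recursion, tested against the average error. -/
theorem bform_avgErr (hπ : IsPolicy π) {ι : ℝ} (hι : 0 < ι) (θ' : Fin d → ℝ) {N : ℕ} (hN : 1 ≤ N)
    (ω : Ω) :
    M.bform π (stWeight π εA (M.truncDisc π (MDP.originDist S sor f) m))
        (Φ.mulVec (X.avgErr Φ ι θ' N ω)) (Φ.mulVec (X.avgErr Φ ι θ' N ω))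
      + M.transSum π (stWeight π εA (M.truncDisc π (MDP.originDist S sor f) m))
        (fun z z' => Φ.mulVec (X.avgErr Φ ι θ' N ω) z * M.resid (Φ.mulVec θ') z z')
      = X.avgErr Φ ι θ' N ω ⬝ᵥ ((ι * N)⁻¹ • (X.theta Φ ι N ω - X.theta Φ ι (2 * N) ω)
        - (N : ℝ)⁻¹ • X.noise Φ ι N (2 * N) ω) := by
  have hN' : (N : ℝ) ≠ 0 := by positivity
  set v := X.avgErr Φ ι θ' N ω with hv
  have h1 : (ι * N)⁻¹ • (X.theta Φ ι N ω - X.theta Φ ι (2 * N) ω)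
        - (N : ℝ)⁻¹ • X.noise Φ ι N (2 * N) ω
      = (N : ℝ)⁻¹ • ∑ t ∈ Ico N (2 * N),
        meanStep M π εA (MDP.originDist S sor f) m Φ (X.theta Φ ι t ω) := by
    rw [X.theta_sub_theta ι (by omega), smul_smul, smul_add, mul_inv, mul_right_comm,
      inv_mul_cancel₀ hι.ne', one_mul]
    abel
  have h2 : ∀ t, v ⬝ᵥ meanStep M π εA (MDP.originDist S sor f) m Φ (X.theta Φ ι t ω)
      = M.bform π (stWeight π εA (M.truncDisc π (MDP.originDist S sor f) m)) (Φ.mulVec v)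
          (Φ.mulVec (X.theta Φ ι t ω - θ'))
        + M.transSum π (stWeight π εA (M.truncDisc π (MDP.originDist S sor f) m))
          (fun z z' => Φ.mulVec v z * M.resid (Φ.mulVec θ') z z') := fun t => by
    have e : Φ.mulVec (X.theta Φ ι t ω) = Φ.mulVec θ' + Φ.mulVec (X.theta Φ ι t ω - θ') := by
      rw [← Matrix.mulVec_add, add_sub_cancel]
    rw [dotProduct_meanStep, e, M.transSum_mul_resid_add hπ]
  have h3 : Φ.mulVec v
      = (N : ℝ)⁻¹ • ∑ t ∈ Ico N (2 * N), Φ.mulVec (X.theta Φ ι t ω - θ') := by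
    rw [hv, avgErr, Matrix.mulVec_smul, Matrix.mulVec_sum]
  rw [h1, dotProduct_smul, dotProduct_sum, smul_eq_mul]
  simp only [h2, sum_add_distrib, sum_const, Nat.card_Ico, show 2 * N - N = N by omega,
    nsmul_eq_mul]
  rw [mul_add, inv_mul_cancel_left₀ hN', ← M.bform_sum_right, ← M.bform_smul_right, ← h3]

variable [Nonempty A] [IsProbabilityMeasure ℙ]

theorem adapted_noise (ι : ℝ) (N n : ℕ) (h : N ≤ n) : X.Adapted n (X.noise Φ ι N n) := by
  induction n, h using Nat.le_induction with
  | base => exact ⟨fun _ => 0, fun ω => by simp [noise]⟩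
  | succ n h ih =>
    have := (((X.adapted_theta (Φ := Φ) ι n).prodMk ih).succ.prodMk (X.adapted_sample n)).comp
      fun p => p.1.2 + (M.tdStep Φ p.1.1 p.2
        - meanStep M π εA (MDP.originDist S sor f) m Φ p.1.1)
    simpa only [← X.noise_succ ι h] using this

/-- The deviations are uncorrelated. -/
theorem integral_noise_sq_succ_le (hπ : IsPolicy π) (hf : f ∈ Set.Icc (0 : ℝ) 1)
    (h0 : 0 ≤ εA) (h1 : εA ≤ 1) {N n : ℕ} (h : N ≤ n)
    (hr : ∀ᵐ ω ∂ℙ, X.len n ω < m → ∃ k, X.st n k ω = X.origin n ω) (ι : ℝ)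
    {K : (Fin d → ℝ) → ℝ}
    (hK : ∀ θ, M.transSum π (stWeight π εA (M.truncDisc π (MDP.originDist S sor f) m))
        (fun z z' => M.resid (Φ.mulVec θ) z z' ^ 2) ≤ K θ) :
    ∫ ω, X.noise Φ ι N (n + 1) ω ⬝ᵥ X.noise Φ ι N (n + 1) ω ∂ℙ
      ≤ ∫ ω, X.noise Φ ι N n ω ⬝ᵥ X.noise Φ ι N n ω ∂ℙ
        + specNorm Φ ^ 2 * ∫ ω, K (X.theta Φ ι n ω) ∂ℙ := by
  have hν := MDP.originDist_isProbVec sor hf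
  have had := (X.adapted_theta (Φ := Φ) ι n).prodMk (X.adapted_noise (Φ := Φ) ι N n h)
  set b := meanStep M π εA (MDP.originDist S sor f) m Φ with hb
  have e := had.integral_sample hπ hf h0 h1 hr fun p r =>
    (p.2 + (M.tdStep Φ p.1 r - b p.1)) ⬝ᵥ (p.2 + (M.tdStep Φ p.1 r - b p.1))
  simp only [X.noise_succ ι h, ← hb]
  rw [e, ← integral_const_mul, ← integral_add
    (had.comp fun p => p.2 ⬝ᵥ p.2).integrable
    (had.comp fun p => specNorm Φ ^ 2 * K p.1).integrable]
  refine integral_mono (had.comp fun p => ∑ r, sampleProb M π εA (MDP.originDist S sor f) m r *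
    ((p.2 + (M.tdStep Φ p.1 r - b p.1)) ⬝ᵥ (p.2 + (M.tdStep Φ p.1 r - b p.1)))).integrable
    (had.comp fun p => p.2 ⬝ᵥ p.2 + specNorm Φ ^ 2 * K p.1).integrable fun ω => ?_
  simp only
  set θ := X.theta Φ ι n ω
  set y := X.noise Φ ι N n ω
  have h3 : ∀ r, sampleProb M π εA (MDP.originDist S sor f) m r *
      ((y + (M.tdStep Φ θ r - b θ)) ⬝ᵥ (y + (M.tdStep Φ θ r - b θ)))
      = sampleProb M π εA (MDP.originDist S sor f) m r * ((y - b θ) ⬝ᵥ (y - b θ))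
        + 2 * (sampleProb M π εA (MDP.originDist S sor f) m r * ((y - b θ) ⬝ᵥ M.tdStep Φ θ r))
        + sampleProb M π εA (MDP.originDist S sor f) m r
          * (M.tdStep Φ θ r ⬝ᵥ M.tdStep Φ θ r) := fun r => by
    have : y + (M.tdStep Φ θ r - b θ) = (y - b θ) + M.tdStep Φ θ r := by abel
    rw [this]
    simp only [add_dotProduct, dotProduct_add]
    rw [dotProduct_comm (M.tdStep Φ θ r) (y - b θ)]
    ring
  have h4 : ∑ r, sampleProb M π εA (MDP.originDist S sor f) m r * ((y - b θ) ⬝ᵥ M.tdStep Φ θ r)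
      = (y - b θ) ⬝ᵥ b θ := by
    rw [hb, meanStep, dotProduct_sum]
    simp only [dotProduct_smul, smul_eq_mul]
  simp only [h3, sum_add_distrib, ← mul_sum, ← sum_mul, sum_sampleProb hπ hν h0 h1, h4]
  have h5 := sum_sampleProb_dotProduct_self_le (m := m) (Φ := Φ) (M := M) hπ h0 h1 hν θ
  have h6 := mul_le_mul_of_nonneg_left (hK θ) (sq_nonneg (specNorm Φ))
  have h7 := dotProduct_self_nonneg_real (b θ)
  -- The cross term with the past has mean zero, and centring only lowers the second moment by |b|²,
  -- which is dropped.
  have h8 : (y - b θ) ⬝ᵥ (y - b θ) + 2 * ((y - b θ) ⬝ᵥ b θ) = y ⬝ᵥ y - b θ ⬝ᵥ b θ := by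
    simp only [sub_dotProduct, dotProduct_sub]
    rw [dotProduct_comm (b θ) y]
    ring
  linarith

end CTDRun

theorem dotProduct_le_young {d : ℕ} (u v : Fin d → ℝ) {t : ℝ} (ht : 0 < t) :
    u ⬝ᵥ v ≤ t / 4 * (u ⬝ᵥ u) + 1 / t * (v ⬝ᵥ v) := by
  have h := dotProduct_self_nonneg_real ((t / 2) • u - v)
  simp only [sub_dotProduct, dotProduct_sub, smul_dotProduct, dotProduct_smul, smul_eq_mul] at h
  rw [dotProduct_comm v u] at h
  have e : t / 4 * (u ⬝ᵥ u) + 1 / t * (v ⬝ᵥ v) - u ⬝ᵥ v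
      = 1 / t * (t / 2 * (t / 2 * (u ⬝ᵥ u) - u ⬝ᵥ v) - (t / 2 * (u ⬝ᵥ v) - v ⬝ᵥ v)) := by
    field_simp
    ring
  have : 0 ≤ 1 / t * (t / 2 * (t / 2 * (u ⬝ᵥ u) - u ⬝ᵥ v)
      - (t / 2 * (u ⬝ᵥ v) - v ⬝ᵥ v)) := mul_nonneg (by positivity) h
  linarith

section

variable {Ω : Type*} [MeasurableSpace Ω] {ρ : Measure Ω} [IsProbabilityMeasure ρ] {f g h : Ω → ℝ}

theorem integral_neg_add_const (hf : Integrable f ρ) (c : ℝ) :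
    ∫ ω, (-f ω + c) ∂ρ = -∫ ω, f ω ∂ρ + c := by
  have h1 : Integrable (fun ω => -f ω) ρ := hf.neg
  rw [integral_add h1 (integrable_const c), integral_neg]
  simp

theorem integral_combination (hf : Integrable f ρ) (hg : Integrable g ρ) (hh : Integrable h ρ)
    (k p q c : ℝ) : Integrable (fun ω => k * (p * (f ω + g ω) + q * h ω) + c) ρ ∧
      ∫ ω, (k * (p * (f ω + g ω) + q * h ω) + c) ∂ρ
        = k * (p * (∫ ω, f ω ∂ρ + ∫ ω, g ω ∂ρ) + q * ∫ ω, h ω ∂ρ) + c := by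
  have h1 : Integrable (fun ω => p * (f ω + g ω)) ρ := (hf.add hg).const_mul p
  have h2 : Integrable (fun ω => q * h ω) ρ := hh.const_mul q
  have h3 : Integrable (fun ω => k * (p * (f ω + g ω) + q * h ω)) ρ := (h1.add h2).const_mul k
  refine ⟨h3.add (integrable_const c), ?_⟩
  rw [integral_add h3 (integrable_const c), integral_const_mul, integral_add h1 h2,
    integral_const_mul, integral_const_mul, integral_add hf hg]
  simp

end

/-- Coercivity gives xW/4; the bias, with t = x/(8r), and the Young term each take xW/16, leaving
xW/8 to bound the error. -/
theorem average_error_le {x μ r R G U W a b vv vy yy : ℝ} (hx : 0 < x) (hμ : 0 < μ) (hr : 0 < r)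
    (hR : R ≤ 7 / x) (ha : x / 4 * W ≤ a) (hab : a + b = vy)
    (hb : ∀ t, 0 < t → -(t * (G * U) + R / t) ≤ 2 * b) (hU : G * U ≤ r * W) (hv : μ * vv ≤ W)
    (hy : vy ≤ x * μ / 4 / 4 * vv + 1 / (x * μ / 4) * yy) :
    W ≤ 32 / (x ^ 2 * μ) * yy + 224 * r / x ^ 3 := by
  have h1 := hb (x / (8 * r)) (by positivity)
  have h2 : x / (8 * r) * (G * U) ≤ x / (8 * r) * (r * W) := by gcongr
  have e2 : x / (8 * r) * (r * W) = x / 8 * W := by field_simp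
  have h3 : R / (x / (8 * r)) ≤ 7 / x / (x / (8 * r)) := by gcongr
  have e3 : 7 / x / (x / (8 * r)) = 56 * r / x ^ 2 := by field_simp; ring
  have h4 := mul_le_mul_of_nonneg_left hv (by positivity : 0 ≤ x / 16)
  have h5 : x / 8 * W ≤ 1 / (x * μ / 4) * yy + 28 * r / x ^ 2 := by
    have : 56 * r / x ^ 2 = 2 * (28 * r / x ^ 2) := by ring
    linarith
  have h6 := mul_le_mul_of_nonneg_left h5 (by positivity : 0 ≤ 8 / x)
  have e6 : 8 / x * (x / 8 * W) = W := by field_simp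
  have e7 : 8 / x * (1 / (x * μ / 4) * yy + 28 * r / x ^ 2)
      = 32 / (x ^ 2 * μ) * yy + 224 * r / x ^ 3 := by
    field_simp
    ring
  linarith

/-- Arithmetic of the averaging bound; `p` stands for `1 / (ι N)` and `q` for `Ω² / N`. -/
theorem averaging_bound_le {x μ r L p q D K : ℝ} (hx : 0 < x) (hx1 : x ≤ 1) (hμ : 0 < μ)
    (hr : 0 < r) (hL : 1 ≤ L) (hp0 : 0 ≤ p) (hp : p ≤ x * μ / (8 * L))
    (hq : q ≤ x ^ 2 * μ / (4096 * L)) (hK : K = 56 * r / x ^ 2 + 1 / 8)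
    (hD : D = 9 / (x ^ 2 * μ) + K / (x * μ / 4)) :
    32 / (x ^ 2 * μ) * (8 * D * p ^ 2 + 2 * q * (9 / 2 * (D * p + K) + 63 / x)) + 224 * r / x ^ 3
      ≤ 40 / (L * x ^ 2) + 1200 * r / x ^ 3 := by
  have hK0 : 0 ≤ K := by rw [hK]; positivity
  have hD0 : 0 ≤ D := by rw [hD]; positivity
  have h1 : D * p ≤ 9 / (8 * x) + K / 2 := by
    calc D * p ≤ D * (x * μ / (8 * L)) := by gcongr
      _ ≤ D * (x * μ / (8 * 1)) := by gcongr
      _ = 9 / (8 * x) + K / 2 := by rw [hD]; field_simp; ring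
  have h2 : 8 * D * p ^ 2 ≤ 8 * (9 / (8 * x) + K / 2) * (x * μ / (8 * L)) := by
    calc 8 * D * p ^ 2 = 8 * (D * p) * p := by ring
      _ ≤ _ := by gcongr
  have h3 : 2 * q * (9 / 2 * (D * p + K) + 63 / x)
      ≤ 2 * (x ^ 2 * μ / (4096 * L)) * (9 / 2 * ((9 / (8 * x) + K / 2) + K) + 63 / x) := by
    have h0 : 0 ≤ 9 / 2 * (D * p + K) + 63 / x := by positivity
    have : 2 * q * (9 / 2 * (D * p + K) + 63 / x)
      ≤ 2 * (x ^ 2 * μ / (4096 * L)) * (9 / 2 * (D * p + K) + 63 / x) := by gcongr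
    refine this.trans ?_
    gcongr
  have h4 := mul_le_mul_of_nonneg_left (add_le_add h2 h3)
    (by positivity : 0 ≤ 32 / (x ^ 2 * μ))
  have e4 : 32 / (x ^ 2 * μ) * (8 * (9 / (8 * x) + K / 2) * (x * μ / (8 * L))
      + 2 * (x ^ 2 * μ / (4096 * L)) * (9 / 2 * ((9 / (8 * x) + K / 2) + K) + 63 / x))
      = 1 / L * ((36 + 2 * x + 1 / 64 * ((81 / 16 + 63) * x + 27 / 32 * x ^ 2)) / x ^ 2
        + (896 + 1 / 64 * 378 * x) * r / x ^ 3) := by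
    rw [hK]
    field_simp
    ring
  rw [e4] at h4
  have h5 : 36 + 2 * x + 1 / 64 * ((81 / 16 + 63) * x + 27 / 32 * x ^ 2) ≤ 40 := by nlinarith
  have h6 : 1 / L * ((36 + 2 * x + 1 / 64 * ((81 / 16 + 63) * x + 27 / 32 * x ^ 2)) / x ^ 2)
      ≤ 1 / L * (40 / x ^ 2) := by gcongr
  have h7 : 1 / L * ((896 + 1 / 64 * 378 * x) * r / x ^ 3) ≤ 1 * (976 * r / x ^ 3) := by
    gcongr
    · rw [div_le_one (by linarith)]; exact hL
    · linarith
  have e6 : 1 / L * (40 / x ^ 2) = 40 / (L * x ^ 2) := by field_simp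
  have e7 : 1200 * r / x ^ 3 = 1 * (976 * r / x ^ 3) + 224 * r / x ^ 3 := by ring
  rw [mul_add] at h4
  linarith

/-! ### Error of the average for a small tail -/

namespace CTDRun

variable {S A : Type*} [Fintype S] [Fintype A] [DecidableEq S] [DecidableEq A]
  {M : MDP S A} {π : S → A → ℝ} {sor : S} {f : ℝ} {m : ℕ} {εS εA : ℝ}
  {Ω : Type*} [MeasurableSpace Ω] {ℙ : Measure Ω}
  {d : ℕ} {Φ : Matrix (S × A) (Fin d) ℝ}

variable (X : CTDRun M π sor f m εS εA ℙ)

variable [Nonempty A] [Nonempty S] [IsProbabilityMeasure ℙ]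

/-- Error of the average when the truncation error is small. -/
theorem integral_wNormSq_Qhat_le_of_small (hπ : IsPolicy π) (hf : f ∈ Set.Icc (0 : ℝ) 1)
    (h0 : 0 ≤ εA) (hε : ∀ s, εA ≤ (1 - M.γ) * M.disc π (MDP.originDist S sor f) s / 4)
    {N : ℕ} (hN : 1 ≤ N)
    (hr : ∀ t < 2 * N, ∀ᵐ ω ∂ℙ, X.len t ω < m → ∃ n, X.st t n ω = X.origin t ω)
    {w : S × A → ℝ} (hw : w = stWeight π εA (M.disc π (MDP.originDist S sor f)))
    {θ : Fin d → ℝ} (hθ : (M.tdMatrix π Φ w).mulVec θ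
      = (Φ.transpose * Matrix.diagonal w).mulVec fun z => M.c z.1 z.2)
    {r : ℝ} (hr0 : 0 < r) (hr8 : r ≤ 1 / 8)
    (hU : ∀ v : Fin d → ℝ, M.γ ^ m * (specNorm Φ ^ 2 * (v ⬝ᵥ v)) ≤ r * wNormSq w (Φ.mulVec v))
    {μ : ℝ} (hμ0 : 0 < μ) (hμ : ∀ v : Fin d → ℝ, μ * (v ⬝ᵥ v) ≤ wNormSq w (Φ.mulVec v))
    {ι : ℝ} (hι : 0 < ι) (hk : ι * specNorm Φ ^ 2 ≤ (1 - M.γ) / 512)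
    (hιc : ι * ((1 - M.γ) * μ / 4) ≤ 1) (hθ9 : θ ⬝ᵥ θ ≤ 9 / ((1 - M.γ) ^ 2 * μ))
    {L : ℝ} (hL : 1 ≤ L) (hNL : 8 * L ≤ (1 - M.γ) * μ * (ι * N)) :
    ∫ ω, wNormSq w (X.Qhat Φ ι N ω - Φ.mulVec θ) ∂ℙ
      ≤ 40 / (L * (1 - M.γ) ^ 2) + 1200 * r / (1 - M.γ) ^ 3 := by
  subst hw
  have hν := MDP.originDist_isProbVec sor hf
  have hκ := M.disc_isProbVec hπ hν
  have hx := M.one_sub_γ_pos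
  have hγ := M.γ_nonneg
  have hε4 := M.eps_le h0 hκ.2 hε
  have hε1 : εA ≤ 1 := by linarith
  have hN' : (0 : ℝ) < N := by positivity
  set x := 1 - M.γ with hxdef
  set wm := stWeight π εA (M.truncDisc π (MDP.originDist S sor f) m) with hwm
  set a : (Fin d → ℝ) → ℝ := fun v => M.bform π wm (Φ.mulVec v) (Φ.mulVec v) with ha
  set K := 56 * r / x ^ 2 + 1 / 8 with hK
  have hK0 : 0 ≤ K := by positivity
  have hdr := fun v => M.drift_of_small hπ h0 hν hε m hθ hr0 hr8 (hU v)
    (mul_nonneg hι.le (sq_nonneg (specNorm Φ))) hk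
  have hia : ∀ t, Integrable (fun ω => a (X.theta Φ ι t ω - θ)) ℙ := fun t =>
    ((X.adapted_theta ι t).comp fun y => a (y - θ)).integrable
  have hstep : ∀ t < 2 * N, X.err Φ ι θ (t + 1) ≤ X.err Φ ι θ t
      + ι * ∫ ω, (-a (X.theta Φ ι t ω - θ) + K) ∂ℙ := fun t ht =>
    X.integral_sq_succ_le hπ hf h0 hε1 (hr t ht) hι.le θ (K := fun v => -a v + K)
      fun v => (hdr v).1
  -- Weakening the form to (xμ/4)|v|² yields a contraction, and with it the uniform bound D on the
  -- error.
  have hstep2 : ∀ t < 2 * N, X.err Φ ι θ (t + 1) ≤ X.err Φ ι θ t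
      + ι * ∫ ω, (-(x * μ / 4) * ((X.theta Φ ι t ω - θ) ⬝ᵥ (X.theta Φ ι t ω - θ)) + K) ∂ℙ :=
    fun t ht => (hstep t ht).trans (add_le_add_right (mul_le_mul_of_nonneg_left
      (integral_mono ((hia t).neg.add (integrable_const _))
        (((X.integrable_sq_sub ι θ t).const_mul _).add (integrable_const _)) fun ω => by
          have h1 := (hdr (X.theta Φ ι t ω - θ)).2.2
          have h2 := mul_le_mul_of_nonneg_left (hμ (X.theta Φ ι t ω - θ)) (by positivity : 0 ≤ x / 4)
          simp only [ha, Pi.add_apply, Pi.neg_apply]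
          linarith) hι.le) _)
  set D := 9 / (x ^ 2 * μ) + K / (x * μ / 4) with hD
  have herr : ∀ t ≤ 2 * N, X.err Φ ι θ t ≤ D := fun t ht =>
    (X.err_le_of_contraction θ (by positivity) hι.le hιc hK0 hstep2 ht).trans
      (add_le_add_left hθ9 _)
  -- Summing the unweakened drift bounds the accumulated form by D/ι + NK. The noise variance is
  -- charged to this sum rather than to the squared errors, so no extra factor Ω²/μ arises.
  have hsum : ∀ n, N ≤ n → n ≤ 2 * N → X.err Φ ι θ n
      ≤ X.err Φ ι θ N + ι * ((n - N : ℝ) * K - ∑ t ∈ Ico N n, ∫ ω, a (X.theta Φ ι t ω - θ) ∂ℙ) := by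
    intro n hn
    induction n, hn using Nat.le_induction with
    | base => intro _; simp
    | succ n hn ih =>
      intro h
      have h1 := hstep n (by omega)
      rw [integral_neg_add_const (hia n)] at h1
      have h2 := ih (by omega)
      rw [sum_Ico_succ_top hn]
      push_cast
      linarith
  have hsumN := hsum (2 * N) (by omega) le_rfl
  set Sa := ∑ t ∈ Ico N (2 * N), ∫ ω, a (X.theta Φ ι t ω - θ) ∂ℙ with hSa
  have hSa' : Sa ≤ D / ι + N * K := by
    have h1 := X.err_nonneg (Φ := Φ) ι θ (2 * N)
    have h2 := herr N (by omega)
    push_cast at hsumN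
    have h3 : ι * Sa ≤ D + ι * (N * K) := by linarith
    rw [div_add' _ _ _ hι.ne', le_div_iff₀ hι]
    linarith
  have hnoise : ∀ n, N ≤ n → n ≤ 2 * N →
      ∫ ω, X.noise Φ ι N n ω ⬝ᵥ X.noise Φ ι N n ω ∂ℙ
      ≤ specNorm Φ ^ 2 * (9 / 2 * ∑ t ∈ Ico N n, ∫ ω, a (X.theta Φ ι t ω - θ) ∂ℙ
        + (n - N : ℝ) * (63 / x)) := by
    intro n hn
    induction n, hn using Nat.le_induction with
    | base => intro _; simp [noise]
    | succ n hn ih =>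
      intro h
      have h1 := X.integral_noise_sq_succ_le (Φ := Φ) hπ hf h0 hε1 hn (hr n (by omega)) ι
        (K := fun y => 9 / 2 * a (y - θ) + 63 / x) fun y => by
          have := (hdr (y - θ)).2.1
          rwa [← Matrix.mulVec_add, add_sub_cancel] at this
      rw [integral_add ((hia n).const_mul _) (integrable_const _), integral_const_mul,
        integral_const] at h1
      simp only [probReal_univ, one_smul] at h1
      have h2 := ih (by omega)
      rw [sum_Ico_succ_top hn]
      push_cast
      linarith
  have hnoiseN := hnoise (2 * N) (by omega) le_rfl
  -- Sample by sample, the error of the average is bounded by the two boundary iterates, the noise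
  -- and the bias.
  have hpt : ∀ ω, wNormSq (stWeight π εA (M.disc π (MDP.originDist S sor f)))
      (X.Qhat Φ ι N ω - Φ.mulVec θ) ≤ 32 / (x ^ 2 * μ)
        * (4 * (ι * N)⁻¹ ^ 2 * ((X.theta Φ ι N ω - θ) ⬝ᵥ (X.theta Φ ι N ω - θ)
          + (X.theta Φ ι (2 * N) ω - θ) ⬝ᵥ (X.theta Φ ι (2 * N) ω - θ))
          + 2 * (N : ℝ)⁻¹ ^ 2 * (X.noise Φ ι N (2 * N) ω ⬝ᵥ X.noise Φ ι N (2 * N) ω))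
        + 224 * r / x ^ 3 := by
    intro ω
    rw [X.Qhat_sub ι θ hN]
    set v := X.avgErr Φ ι θ N ω
    have hz := M.transSum_resid_eq_zero hπ hθ
    have hQ : M.bform π (stWeight π εA (M.disc π (MDP.originDist S sor f)))
        (Φ.mulVec θ) (Φ.mulVec θ)
        = ∑ z, stWeight π εA (M.disc π (MDP.originDist S sor f)) z
          * (Φ.mulVec θ z * M.c z.1 z.2) := by
      have := hz θ
      rw [M.transSum_mul_resid hπ] at this
      linarith
    have hu : ∀ z, Φ.mulVec v z ^ 2 ≤ specNorm Φ ^ 2 * (v ⬝ᵥ v) := fun z =>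
      (single_le_sum (f := fun z => Φ.mulVec v z ^ 2) (fun z _ => sq_nonneg _)
        (mem_univ z)).trans (sum_sq_mulVec_le Φ v)
    have hy := X.bform_avgErr (Φ := Φ) hπ hι θ hN ω
    refine (average_error_le hx hμ0 hr0 (M.transSum_resid_sq_le hπ h0 hν hε hQ) (hdr v).2.2 hy
      (fun t ht => M.transSum_truncDisc_resid_ge hπ h0 hε1 hν m hu ht le_rfl (hz v)) (hU v) (hμ v)
      (dotProduct_le_young _ _ (by positivity))).trans ?_
    have h1 := sub_dotProduct_sub_le ((ι * N : ℝ)⁻¹ • (X.theta Φ ι N ω - X.theta Φ ι (2 * N) ω))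
      ((N : ℝ)⁻¹ • X.noise Φ ι N (2 * N) ω)
    have h2 := sub_dotProduct_sub_le (X.theta Φ ι N ω - θ) (X.theta Φ ι (2 * N) ω - θ)
    rw [sub_sub_sub_cancel_right] at h2
    have h3 := mul_le_mul_of_nonneg_left h2 (sq_nonneg (ι * N : ℝ)⁻¹)
    simp only [smul_dotProduct, dotProduct_smul, smul_eq_mul] at h1
    refine add_le_add_left (mul_le_mul_of_nonneg_left ?_ (by positivity)) _
    linarith
  have hiN := X.integrable_sq_sub (Φ := Φ) ι θ N
  have hi2N := X.integrable_sq_sub (Φ := Φ) ι θ (2 * N)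
  have hin : Integrable (fun ω => X.noise Φ ι N (2 * N) ω ⬝ᵥ X.noise Φ ι N (2 * N) ω) ℙ :=
    ((X.adapted_noise (Φ := Φ) ι N (2 * N) (by omega)).comp fun y => y ⬝ᵥ y).integrable
  obtain ⟨hi, hie⟩ := integral_combination hiN hi2N hin (32 / (x ^ 2 * μ))
    (4 * (ι * N : ℝ)⁻¹ ^ 2) (2 * (N : ℝ)⁻¹ ^ 2) (224 * r / x ^ 3)
  refine (integral_mono (X.integrable_wNormSq_Qhat _ ι θ hN) hi hpt).trans ?_
  rw [hie]
  change 32 / (x ^ 2 * μ) * (4 * (ι * N)⁻¹ ^ 2 * (X.err Φ ι θ N + X.err Φ ι θ (2 * N))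
    + 2 * (N : ℝ)⁻¹ ^ 2 * _) + _ ≤ _
  have h1 := herr N (by omega)
  have h2 := herr (2 * N) le_rfl
  have hp : (ι * N : ℝ)⁻¹ ≤ x * μ / (8 * L) := by
    rw [inv_le_comm₀ (by positivity) (by positivity), inv_div, div_le_iff₀ (by positivity)]
    linarith
  have hq : specNorm Φ ^ 2 / N ≤ x ^ 2 * μ / (4096 * L) := by
    have e : specNorm Φ ^ 2 / N = ι * specNorm Φ ^ 2 * (ι * N)⁻¹ := by field_simp
    rw [e]
    calc ι * specNorm Φ ^ 2 * (ι * N)⁻¹ ≤ x / 512 * (x * μ / (8 * L)) := by gcongr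
      _ = x ^ 2 * μ / (4096 * L) := by ring
  refine le_trans ?_ (averaging_bound_le hx (by linarith) hμ0 hr0 hL (by positivity) hp hq hK hD)
  refine add_le_add_left (mul_le_mul_of_nonneg_left ?_ (by positivity)) _
  have h3 : 4 * (ι * N : ℝ)⁻¹ ^ 2 * (X.err Φ ι θ N + X.err Φ ι θ (2 * N))
      ≤ 4 * (ι * N : ℝ)⁻¹ ^ 2 * (D + D) := by gcongr
  have h4 : 2 * (N : ℝ)⁻¹ ^ 2
      * ∫ ω, X.noise Φ ι N (2 * N) ω ⬝ᵥ X.noise Φ ι N (2 * N) ω ∂ℙ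
      ≤ 2 * (N : ℝ)⁻¹ ^ 2 * (specNorm Φ ^ 2 * (9 / 2 * (D / ι + N * K) + N * (63 / x))) := by
    gcongr
    refine hnoiseN.trans ?_
    push_cast
    rw [show (2 * (N : ℝ) - N) = N by ring]
    gcongr
  have e4 : 2 * (N : ℝ)⁻¹ ^ 2 * (specNorm Φ ^ 2 * (9 / 2 * (D / ι + N * K) + N * (63 / x)))
      = 2 * (specNorm Φ ^ 2 / N) * (9 / 2 * (D * (ι * N)⁻¹ + K) + 63 / x) := by
    field_simp
  rw [e4] at h4
  linarith

end CTDRun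

/-! ### Comparison with the stated bound, and conclusion -/

/-- The bound of the theorem dominates the bounds of all cases. -/
theorem le_sigmaHatSq {nS : ℕ} {γ Om μ ι : ℝ} {m N : ℕ} (hγ0 : 0 ≤ γ) (hγ1 : γ < 1) (hμ : 0 < μ)
    (hμO : μ ≤ Om ^ 2) (hι : 0 < ι) (hι' : ι ≤ (1 - γ) / (512 * Om ^ 2)) {r : ℝ}
    (hr : r = √(nS : ℝ) * Om ^ 2 * γ ^ m / μ) (hr1 : r ≤ 1) :
    2156 / (((N / epochLen γ ι μ : ℕ) : ℝ) * (1 - γ) ^ 2)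
      + 246300 * (Om ^ 2 / μ) * (r / (1 - γ) ^ 3) ≤ sigmaHatSq nS γ Om μ ι m N := by
  have hx : 0 < 1 - γ := by linarith
  set x := 1 - γ with hxd
  have hO : 0 < Om ^ 2 := hμ.trans_le hμO
  have hr0 : 0 ≤ r := by rw [hr]; positivity
  set T : ℝ := (epochLen γ ι μ : ℝ) with hT
  have hT8 : 8 / (x * ι * μ) ≤ T := Nat.le_ceil _
  have hk : ι * Om ^ 2 ≤ x / 512 := by
    rw [le_div_iff₀ (by positivity)] at hι'
    linarith
  have hT1 : 1 ≤ T := by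
    refine le_trans ?_ hT8
    rw [le_div_iff₀ (by positivity)]
    have h1 : ι * μ ≤ x / 512 := (mul_le_mul_of_nonneg_left hμO hι.le).trans hk
    have h2 : x * (ι * μ) ≤ 1 * (1 / 512) := by
      refine mul_le_mul (by linarith) (by linarith) (by positivity) zero_le_one
    linarith
  rw [sigmaHatSq]
  refine add_le_add ?_ ?_
  · refine div_le_div_of_nonneg_right ?_ (by positivity)
    -- The logarithm is only needed to be nonnegative: 196·11 = 2156.
    have hl : 0 ≤ Real.logb 2 (T * Om ^ 2 / μ) := by
      refine Real.logb_nonneg (by norm_num) ?_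
      rw [le_div_iff₀ hμ, one_mul]
      exact hμO.trans (le_mul_of_one_le_left hO.le hT1)
    linarith
  · have h1 : 6 * ι * r ≤ C2 nS γ Om μ ι m := by
      have e : C2 nS γ Om μ ι m = 6 * ι * r * (1 + 2 * ι * √(nS : ℝ) * Om ^ 2 * γ ^ m) := by
        rw [C2, hr]
        ring
      rw [e]
      refine le_mul_of_one_le_right (by positivity) ?_
      have : 0 ≤ 2 * ι * √(nS : ℝ) * Om ^ 2 * γ ^ m := by positivity
      linarith
    -- From T ≥ 8/(xιμ), C₂ ≥ 6ιr and 1/ι ≥ 512Ω²/x the radicand is at least 64·6·512 = 196608 >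
    -- 443² times the required square. Then 556·443 ≥ 246300.
    have h2 : 443 * (Om ^ 2 * r / (x * μ)) ≤ √(Om ^ 2 * T ^ 2 * C2 nS γ Om μ ι m) := by
      refine Real.le_sqrt_of_sq_le ?_
      calc (443 * (Om ^ 2 * r / (x * μ))) ^ 2
          = 196249 * (Om ^ 2 * r * (r * (Om ^ 2 * 1))) / (x * μ) ^ 2 := by
            rw [mul_pow, div_pow]
            ring
        _ ≤ 196608 * (Om ^ 2 * r * (1 * (Om ^ 2 * (1 / x)))) / (x * μ) ^ 2 := by
            gcongr
            · norm_num
            · rw [le_div_iff₀ hx]; linarith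
        _ = 384 * (Om ^ 2 * r) / (x * μ) ^ 2 * (512 * Om ^ 2 / x) := by ring
        _ ≤ 384 * (Om ^ 2 * r) / (x * μ) ^ 2 * (1 / ι) := by
            exact mul_le_mul_of_nonneg_left
              ((div_le_div_iff₀ hx hι).2 (by linarith)) (by positivity)
        _ = Om ^ 2 * (8 / (x * ι * μ)) ^ 2 * (6 * ι * r) := by
            field_simp
            ring
        _ ≤ Om ^ 2 * T ^ 2 * C2 nS γ Om μ ι m := by gcongr
    have h3 : √(x ^ 4 * min 1 μ) ≤ x ^ 2 := by
      refine Real.sqrt_le_iff.2 ⟨by positivity, ?_⟩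
      have := mul_le_mul_of_nonneg_left (min_le_left 1 μ) (by positivity : 0 ≤ x ^ 4)
      calc x ^ 4 * min 1 μ ≤ x ^ 4 * 1 := this
        _ = (x ^ 2) ^ 2 := by ring
    have h4 : 0 < √(x ^ 4 * min 1 μ) := Real.sqrt_pos.2 (mul_pos (by positivity)
      (lt_min one_pos hμ))
    calc 246300 * (Om ^ 2 / μ) * (r / x ^ 3)
        = 246300 * (Om ^ 2 * r / (x * μ)) / x ^ 2 := by field_simp
      _ ≤ 556 * (443 * (Om ^ 2 * r / (x * μ))) / x ^ 2 := by
          refine div_le_div_of_nonneg_right ?_ (by positivity)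
          have : 0 ≤ Om ^ 2 * r / (x * μ) := by positivity
          linarith
      _ ≤ 556 * √(Om ^ 2 * T ^ 2 * C2 nS γ Om μ ι m) / √(x ^ 4 * min 1 μ) := by gcongr

theorem muMin_le_specNorm_sq {S A : Type*} [Fintype S] [Fintype A] [DecidableEq S]
    [DecidableEq A] [Nonempty A] [Nonempty S] {π : S → A → ℝ} (hπ : IsPolicy π) {ε : ℝ}
    (h0 : 0 ≤ ε) (h1 : ε ≤ 1) {κ : S → ℝ} (hκ : IsProbVec κ) {d : ℕ} (hd : 0 < d)
    (Φ : Matrix (S × A) (Fin d) ℝ) : muMin Φ (stWeight π ε κ) ≤ specNorm Φ ^ 2 := by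
  have h := (muMin_mul_le Φ (stWeight π ε κ) (Pi.single ⟨0, hd⟩ 1)).trans
    (MDP.wNormSq_le_specNorm hπ h0 h1 hκ _)
  simpa using h

namespace CTDRun

variable {S A : Type*} [Fintype S] [Fintype A] [DecidableEq S] [DecidableEq A]
  {M : MDP S A} {π : S → A → ℝ} {sor : S} {f : ℝ} {m : ℕ} {εS εA : ℝ}
  {Ω : Type*} [MeasurableSpace Ω] {ℙ : Measure Ω}
  {d : ℕ} {Φ : Matrix (S × A) (Fin d) ℝ}

variable (X : CTDRun M π sor f m εS εA ℙ)

variable [Nonempty A] [Nonempty S] [IsProbabilityMeasure ℙ]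

/-- Error of the average from a contracting mean squared error. -/
theorem integral_wNormSq_Qhat_le_of_drift (hπ : IsPolicy π) (hf : f ∈ Set.Icc (0 : ℝ) 1)
    (h0 : 0 ≤ εA) (h1 : εA ≤ 1) {N : ℕ} (hN : 1 ≤ N)
    (hr : ∀ t < 2 * N, ∀ᵐ ω ∂ℙ, X.len t ω < m → ∃ n, X.st t n ω = X.origin t ω)
    {κ : S → ℝ} (hκ : IsProbVec κ) {θ : Fin d → ℝ} {μ : ℝ}
    (hμ : ∀ v : Fin d → ℝ, μ * (v ⬝ᵥ v) ≤ wNormSq (stWeight π εA κ) (Φ.mulVec v))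
    {ι c K : ℝ} (hι : 0 ≤ ι) (hc : 0 < c) (hcμ : 0 < c * μ) (hιc : ι * (c * μ) ≤ 1) (hK : 0 ≤ K)
    (hdr : ∀ v, -2 * M.bform π (stWeight π εA (M.truncDisc π (MDP.originDist S sor f) m))
        (Φ.mulVec v) (Φ.mulVec v)
      - 2 * M.transSum π (stWeight π εA (M.truncDisc π (MDP.originDist S sor f) m))
        (fun z z' => Φ.mulVec v z * M.resid (Φ.mulVec θ) z z')
      + ι * specNorm Φ ^ 2 * M.transSum π
        (stWeight π εA (M.truncDisc π (MDP.originDist S sor f) m))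
        (fun z z' => M.resid (Φ.mulVec θ + Φ.mulVec v) z z' ^ 2)
      ≤ -c * wNormSq (stWeight π εA κ) (Φ.mulVec v) + K) :
    ∫ ω, wNormSq (stWeight π εA κ) (X.Qhat Φ ι N ω - Φ.mulVec θ) ∂ℙ
      ≤ specNorm Φ ^ 2 * (θ ⬝ᵥ θ + K / (c * μ)) := by
  refine X.integral_wNormSq_Qhat_le hπ h0 h1 hκ ι θ hN fun t ht =>
    X.err_le_of_contraction θ hcμ hι hιc hK (fun t ht => ?_) ht.le
  refine X.integral_sq_succ_le hπ hf h0 h1 (hr t ht) hι θ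
    (K := fun v => -(c * μ) * (v ⬝ᵥ v) + K) fun v => (hdr v).trans ?_
  have := mul_le_mul_of_nonneg_left (hμ v) hc.le
  linarith

/-- For r ≤ 1/8 averaging is used. For r > 1/8 a factor 8r is available for free, and the uniform
bound on the mean squared error already lies below the truncation term. -/
theorem integral_wNormSq_Qhat_le_sum (hγ : 0 < M.γ) (hπ : IsPolicy π)
    (hf : f ∈ Set.Icc (0 : ℝ) 1) (h0 : 0 ≤ εA)
    (hε : ∀ s, εA ≤ (1 - M.γ) * M.disc π (MDP.originDist S sor f) s / 4)
    {N : ℕ} (hN : 1 ≤ N)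
    (hr : ∀ t < 2 * N, ∀ᵐ ω ∂ℙ, X.len t ω < m → ∃ n, X.st t n ω = X.origin t ω)
    {w : S × A → ℝ} (hw : w = stWeight π εA (M.disc π (MDP.originDist S sor f)))
    {θ : Fin d → ℝ} (hθ : (M.tdMatrix π Φ w).mulVec θ
      = (Φ.transpose * Matrix.diagonal w).mulVec fun z => M.c z.1 z.2)
    {μ : ℝ} (hμ0 : 0 < μ) (hμO : μ ≤ specNorm Φ ^ 2)
    (hμ : ∀ v : Fin d → ℝ, μ * (v ⬝ᵥ v) ≤ wNormSq w (Φ.mulVec v))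
    {r : ℝ} (hr' : r = √(Fintype.card S : ℝ) * specNorm Φ ^ 2 * M.γ ^ m / μ)
    (hm : M.γ ^ m * ((specNorm Φ ^ 2 + 1) * √(Fintype.card S : ℝ)) ≤ μ)
    {ι : ℝ} (hι : 0 < ι) (hk : ι * specNorm Φ ^ 2 ≤ (1 - M.γ) / 512)
    {L : ℝ} (hL : 1 ≤ L) (hNL : 8 * L ≤ (1 - M.γ) * μ * (ι * N)) :
    ∫ ω, wNormSq w (X.Qhat Φ ι N ω - Φ.mulVec θ) ∂ℙ
      ≤ 2156 / (L * (1 - M.γ) ^ 2)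
        + 246300 * (specNorm Φ ^ 2 / μ) * (r / (1 - M.γ) ^ 3) := by
  have hν := MDP.originDist_isProbVec sor hf
  have hκ := M.disc_isProbVec hπ hν
  have hx := M.one_sub_γ_pos
  have hε4 := M.eps_le h0 hκ.2 hε
  have hε1 : εA ≤ 1 := by linarith
  have hO : 0 < specNorm Φ ^ 2 := hμ0.trans_le hμO
  have hG : 0 < M.γ ^ m := pow_pos hγ m
  have hn : 1 ≤ √(Fintype.card S : ℝ) :=
    Real.one_le_sqrt.2 (by exact_mod_cast Nat.one_le_iff_ne_zero.2 Fintype.card_ne_zero)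
  have hr0 : 0 < r := by rw [hr']; positivity
  have hr1 : r ≤ 1 := by
    rw [hr', div_le_one hμ0]
    have : 0 ≤ M.γ ^ m * √(Fintype.card S : ℝ) := by positivity
    linarith
  have hrW : ∀ v : Fin d → ℝ, √(Fintype.card S : ℝ) * (M.γ ^ m * (specNorm Φ ^ 2 * (v ⬝ᵥ v)))
      ≤ r * wNormSq w (Φ.mulVec v) := fun v => by
    have h := mul_le_mul_of_nonneg_left (hμ v) hr0.le
    have e : r * (μ * (v ⬝ᵥ v))
        = √(Fintype.card S : ℝ) * (M.γ ^ m * (specNorm Φ ^ 2 * (v ⬝ᵥ v))) := by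
      rw [hr']
      field_simp
    rwa [e] at h
  have hθ9 : θ ⬝ᵥ θ ≤ 9 / ((1 - M.γ) ^ 2 * μ) := by
    subst hw
    have hz := M.transSum_resid_eq_zero hπ hθ θ
    rw [M.transSum_mul_resid hπ] at hz
    have h := (hμ θ).trans (M.wNormSq_le_of_bform_eq hπ h0 hν hε (by linarith))
    rw [← div_div, le_div_iff₀ hμ0]
    linarith
  have hιμ : ι * μ ≤ (1 - M.γ) / 512 := (mul_le_mul_of_nonneg_left hμO hι.le).trans hk
  have hx1 : 1 - M.γ ≤ 1 := by linarith
  have hιx : (1 - M.γ) * (ι * μ) ≤ 1 :=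
    mul_le_one₀ hx1 (by positivity) (by linarith)
  have hk0 : 0 ≤ ι * specNorm Φ ^ 2 := by positivity
  rcases le_or_gt r (1 / 8) with hr8 | hr8
  · refine (X.integral_wNormSq_Qhat_le_of_small hπ hf h0 hε hN hr hw hθ hr0 hr8 (fun v => ?_) hμ0 hμ
      hι hk (by linarith) hθ9 hL hNL).trans ?_
    · exact (le_mul_of_one_le_left (mul_nonneg hG.le
        (mul_nonneg hO.le (dotProduct_self_nonneg_real v))) hn).trans (hrW v)
    · refine add_le_add (by gcongr; norm_num) ?_
      have h1 : 1 ≤ specNorm Φ ^ 2 / μ := (one_le_div hμ0).2 hμO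
      have h2 : 0 ≤ r / (1 - M.γ) ^ 3 := by positivity
      calc 1200 * r / (1 - M.γ) ^ 3 = 1200 * 1 * (r / (1 - M.γ) ^ 3) := by ring
        _ ≤ 246300 * (specNorm Φ ^ 2 / μ) * (r / (1 - M.γ) ^ 3) := by gcongr; norm_num
  · have hL0 : 0 ≤ 2156 / (L * (1 - M.γ) ^ 2) := by positivity
    have hx3 : (1 - M.γ) ^ 3 ≤ (1 - M.γ) ^ 2 :=
      pow_le_pow_of_le_one hx.le hx1 (by norm_num)
    have hx31 : (1 - M.γ) ^ 3 ≤ 1 - M.γ :=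
      (pow_le_pow_of_le_one hx.le hx1 (by norm_num : 1 ≤ 3)).trans (pow_one _).le
    have b1 : 9 / ((1 - M.γ) ^ 2 * μ) ≤ 72 * r / ((1 - M.γ) ^ 3 * μ) := by
      gcongr
      linarith
    have hfin : ∀ B, B ≤ 246300 * r / ((1 - M.γ) ^ 3 * μ) → specNorm Φ ^ 2 * B
        ≤ 2156 / (L * (1 - M.γ) ^ 2)
          + 246300 * (specNorm Φ ^ 2 / μ) * (r / (1 - M.γ) ^ 3) := fun B hB => by
      have h := mul_le_mul_of_nonneg_left hB hO.le
      have e : specNorm Φ ^ 2 * (246300 * r / ((1 - M.γ) ^ 3 * μ))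
          = 246300 * (specNorm Φ ^ 2 / μ) * (r / (1 - M.γ) ^ 3) := by field_simp
      linarith
    subst hw
    rcases Nat.lt_or_ge (Fintype.card S) 2 with hS | hS
    · have : Subsingleton S := Fintype.card_le_one_iff_subsingleton.1 (by omega)
      -- m = 0 would give Ω² + 1 ≤ μ ≤ Ω². Hence 1 - γ^m > 0, and this factor cancels between drift
      -- and noise.
      have hm0 : m ≠ 0 := by
        rintro rfl
        have := le_mul_of_one_le_right (by positivity : 0 ≤ specNorm Φ ^ 2 + 1) hn
        linarith
      have hG1 : 0 < 1 - M.γ ^ m := sub_pos.2 (pow_lt_one₀ hγ.le M.γ_lt_one hm0)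
      refine (X.integral_wNormSq_Qhat_le_of_drift hπ hf h0 hε1 hN hr hκ hμ
        (c := (1 - M.γ ^ m) * ((1 - M.γ) / 2)) (K := (1 - M.γ ^ m) / 8) hι.le (by positivity)
        (by positivity) ?_ (by positivity) fun v => ?_).trans (hfin _ ?_)
      · have : (1 - M.γ ^ m) * ((1 - M.γ) * (ι * μ)) ≤ 1 :=
          mul_le_one₀ (by linarith) (by positivity) hιx
        have : 0 ≤ (1 - M.γ ^ m) * ((1 - M.γ) * (ι * μ)) := by positivity
        linarith
      · have := M.drift_of_subsingleton hπ h0 hν hε m hθ v hk0 hk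
        linarith
      · have e : (1 - M.γ ^ m) / 8 / ((1 - M.γ ^ m) * ((1 - M.γ) / 2) * μ)
            = (1 / 4) / ((1 - M.γ) * μ) := by
          field_simp
          norm_num
        have b2 : (1 / 4) / ((1 - M.γ) * μ) ≤ 2 * r / ((1 - M.γ) ^ 3 * μ) := by
          gcongr
          linarith
        have b3 : 0 ≤ r / ((1 - M.γ) ^ 3 * μ) := by positivity
        rw [e]
        have e1 : ∀ t : ℝ, t * r / ((1 - M.γ) ^ 3 * μ) = t * (r / ((1 - M.γ) ^ 3 * μ)) :=
          fun t => by ring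
        rw [e1] at b1 b2 ⊢
        linarith
    · refine (X.integral_wNormSq_Qhat_le_of_drift hπ hf h0 hε1 hN hr hκ hμ
        (c := (1 - M.γ) / 200) (K := 990 * r / (1 - M.γ) ^ 2 + 1 / 8) hι.le (by positivity)
        (by positivity) (by linarith) (by positivity)
        fun v => M.drift_of_two_le hπ h0 hν hε m hθ hr0 hr1 hS (hrW v) hk0 hk).trans (hfin _ ?_)
      have e : (990 * r / (1 - M.γ) ^ 2 + 1 / 8) / ((1 - M.γ) / 200 * μ)
          = 198000 * r / ((1 - M.γ) ^ 3 * μ) + 25 / ((1 - M.γ) * μ) := by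
        field_simp
        ring
      have b2 : 25 / ((1 - M.γ) * μ) ≤ 200 * r / ((1 - M.γ) ^ 3 * μ) := by
        gcongr
        linarith
      have b3 : 0 ≤ r / ((1 - M.γ) ^ 3 * μ) := by positivity
      rw [e]
      have e1 : ∀ t : ℝ, t * r / ((1 - M.γ) ^ 3 * μ) = t * (r / ((1 - M.γ) ^ 3 * μ)) :=
        fun t => by ring
      rw [e1] at b1 b2 ⊢
      rw [e1]
      linarith

end CTDRun

end

theorem mainTheorem8 {S A : Type*} [Fintype S] [Fintype A] [DecidableEq S] [DecidableEq A]
    (M : MDP S A) (hγ : 0 < M.γ)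
    (π : S → A → ℝ) (hπ : IsPolicy π)
    (d : ℕ) (hd : 0 < d) (Φ : Matrix (S × A) (Fin d) ℝ) (hΦ : Φ.rank = d)
    (sor : S) (f : ℝ) (hf : f ∈ Set.Icc (0 : ℝ) 1)
    (εS : ℝ) (hεS : εS ∈ Set.Icc (0 : ℝ) 1)
    (εA : ℝ) (hκ : 0 < ⨅ s, M.mixedVisitation π sor f s)
    (hεA : εA ∈ Set.Ioc (0 : ℝ) ((1 - M.γ) * (⨅ s, M.mixedVisitation π sor f s) / 4))
    (w : S × A → ℝ) (hw : w = M.weight π sor f εA)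
    (Om μ : ℝ) (hOm : Om = specNorm Φ) (hμ : μ = muMin Φ w)
    (m : ℕ)
    (hm : Real.logb (1 / M.γ) ((Om ^ 2 + 1) * √(Fintype.card S : ℝ) / μ) ≤ (m : ℝ))
    (ι : ℝ) (hι : 0 < ι) (hι' : ι ≤ (1 - M.γ) / (512 * Om ^ 2))
    (N : ℕ) (hN : 1 ≤ N) (hNT : epochLen M.γ ι μ ≤ N)
    {Ω : Type*} [MeasurableSpace Ω] (ℙ : Measure Ω) [IsProbabilityMeasure ℙ]
    (X : CTDRun M π sor f m εS εA ℙ)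
    (hreach : ∀ᵐ ω ∂ℙ, ∀ i < 2 * N, X.len i ω < m → ∃ n, X.st i n ω = X.origin i ω) :
    (∃! Q : S × A → ℝ, ProjBellman M π Φ w Q) ∧
    ∀ Qbar : S × A → ℝ, ProjBellman M π Φ w Qbar →
      Integrable (fun ω => wNormSq w (X.Qhat Φ ι N ω - Qbar)) ℙ ∧
      ∫ ω, wNormSq w (X.Qhat Φ ι N ω - Qbar) ∂ℙ
        ≤ sigmaHatSq (Fintype.card S) M.γ Om μ ι m N := by
  have : Nonempty S := ⟨sor⟩
  have : Nonempty A := by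
    by_contra h
    rw [not_nonempty_iff] at h
    have := hπ.2 sor
    simp at this
  have hν := MDP.originDist_isProbVec sor hf
  have hdisc := M.disc_isProbVec hπ hν
  have hx := M.one_sub_γ_pos
  have hbd : BddBelow (Set.range fun s => M.mixedVisitation π sor f s) := Set.finite_range _ |>.bddBelow
  have hinf : ∀ s, (⨅ s, M.mixedVisitation π sor f s) ≤ M.disc π (MDP.originDist S sor f) s :=
    fun s => (ciInf_le hbd s).trans (M.mixedVisitation_eq_disc hπ sor f s).le
  have hε : ∀ s, εA ≤ (1 - M.γ) * M.disc π (MDP.originDist S sor f) s / 4 := fun s => by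
    have := mul_le_mul_of_nonneg_left (hinf s) hx.le
    linarith [hεA.2]
  have h0 : 0 ≤ εA := hεA.1.le
  have hε4 := M.eps_le h0 hdisc.2 hε
  have hε1 : εA ≤ 1 := by linarith [M.γ_nonneg]
  have hw' : w = stWeight π εA (M.disc π (MDP.originDist S sor f)) := by
    rw [hw]
    funext z
    rw [MDP.weight, M.mixedVisitation_eq_disc hπ, stWeight]
  have hwpos : ∀ z, 0 < w z := fun z => by
    rw [hw', stWeight]
    refine mul_pos (hκ.trans_le (hinf z.1)) ?_
    have h1 : 0 < εA / (Fintype.card A : ℝ) := div_pos hεA.1 (by exact_mod_cast Fintype.card_pos)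
    have h2 : 0 ≤ (1 - εA) * π z.1 z.2 := mul_nonneg (by linarith) (hπ.1 _ _)
    rw [perturbed]
    linarith
  have hμ0 : 0 < μ := hμ ▸ muMin_pos Φ hd hΦ hwpos
  have hμO : μ ≤ specNorm Φ ^ 2 := by
    rw [hμ, hw']
    exact muMin_le_specNorm_sq hπ h0 hε1 hdisc hd Φ
  have hμv : ∀ v : Fin d → ℝ, μ * (v ⬝ᵥ v) ≤ wNormSq w (Φ.mulVec v) := fun v =>
    hμ ▸ muMin_mul_le Φ w v
  have hO : 0 < specNorm Φ ^ 2 := hμ0.trans_le hμO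
  subst hOm
  refine ⟨M.existsUnique_projBellman hΦ hwpos (by positivity : 0 < (1 - M.γ) / 3) fun u => ?_,
    fun Qbar hQ => ?_⟩
  · rw [hw']
    exact M.bform_disc_ge hπ h0 hν hε u
  obtain ⟨θ, rfl, hθ⟩ := (M.projBellman_iff hΦ hwpos Qbar).1 hQ
  refine ⟨X.integrable_wNormSq_Qhat w ι θ hN, ?_⟩
  have hn : 1 ≤ √(Fintype.card S : ℝ) :=
    Real.one_le_sqrt.2 (by exact_mod_cast Nat.one_le_iff_ne_zero.2 Fintype.card_ne_zero)
  have hm' : M.γ ^ m * ((specNorm Φ ^ 2 + 1) * √(Fintype.card S : ℝ)) ≤ μ := by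
    rw [Real.logb_le_iff_le_rpow (one_lt_one_div hγ M.γ_lt_one) (by positivity), Real.rpow_natCast,
      one_div, inv_pow, div_le_iff₀ hμ0, inv_mul_eq_div, le_div_iff₀ (pow_pos hγ m)] at hm
    linarith
  have hk : ι * specNorm Φ ^ 2 ≤ (1 - M.γ) / 512 := by
    rw [le_div_iff₀ (by positivity)] at hι'
    linarith
  have hT : 0 < epochLen M.γ ι μ := Nat.ceil_pos.2 (by positivity)
  have hL : (1 : ℝ) ≤ ((N / epochLen M.γ ι μ : ℕ) : ℝ) := by
    exact_mod_cast (Nat.one_le_div_iff hT).2 hNT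
  -- The epoch length enters the analysis only here: each full epoch contributes at least 8 to
  -- (1-γ)μιN.
  have hNL : 8 * ((N / epochLen M.γ ι μ : ℕ) : ℝ) ≤ (1 - M.γ) * μ * (ι * N) := by
    have h1 : 8 / ((1 - M.γ) * ι * μ) ≤ (epochLen M.γ ι μ : ℝ) := Nat.le_ceil _
    rw [div_le_iff₀ (by positivity)] at h1
    have h2 : ((N / epochLen M.γ ι μ : ℕ) : ℝ) * (epochLen M.γ ι μ : ℝ) ≤ N := by
      exact_mod_cast Nat.div_mul_le_self N _
    have h3 := mul_le_mul_of_nonneg_left h1 (by positivity :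
      (0 : ℝ) ≤ ((N / epochLen M.γ ι μ : ℕ) : ℝ))
    have h4 := mul_le_mul_of_nonneg_right h2 (by positivity : 0 ≤ (1 - M.γ) * ι * μ)
    linarith
  refine (X.integral_wNormSq_Qhat_le_sum hγ hπ hf h0 hε hN (fun t ht => ?_) hw' hθ hμ0 hμO hμv rfl
    hm' hι hk hL hNL).trans (le_sigmaHatSq hγ.le M.γ_lt_one hμ0 hμO hι hι' rfl ?_)
  · filter_upwards [hreach] with ω hω
    exact hω t ht
  · rw [div_le_one hμ0]
    have : 0 ≤ M.γ ^ m * √(Fintype.card S : ℝ) := mul_nonneg (pow_nonneg hγ.le m) (by linarith)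
    linarith
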